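/- Let $\mathcal S\subset\{-1,0,1\}^3$ be a step set with positive weights $w(s)$, $s\in\mathcal S$, which is not contained in any half-space $\{y\in\mathbb R^3:\langle x,y\rangle\ge 0\}$ with $x\ne 0$. Let $\chi(x_1,x_2,x_3)=\sum_{s\in\mathcal S}w(s)\,x_1^{s_1}x_2^{s_2}x_3^{s_3}$ and, for each $i$, write $\chi=x_iA_i+B_i+x_i^{-1}C_i$ with $A_i,B_i,C_i$ not depending on $x_i$. Let $\varphi_i$ be the birational involution that replaces $x_i$ by $x_i^{-1}C_i/A_i$ and fixes the other variables, let $G=\langle\varphi_1,\varphi_2,\varphi_3\rangle$ be the group of birational transformations that they generate, and let $m_{ij}\in\mathbb N^*\cup\{\infty\}$ be the order of $\varphi_i\varphi_j$ in $G$. The system $\partial\chi/\partial x_1=\partial\chi/\partial x_2=\partial\chi/\partial x_3=0$ has a unique solution $x_0\in(0,\infty)^3$. Let $\Delta=(a_{ij})$ be the matrix with $$a_{ij}=\frac{\frac{\partial^2\chi}{\partial x_i\partial x_j}(x_0)}{\sqrt{\frac{\partial^2\chi}{\partial x_i^2}(x_0)\,\frac{\partial^2\chi}{\partial x_j^2}(x_0)}}.$$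 Let $T=\Delta^{-1/2}\mathbb R_+^3$ (where $\mathbb R_+=[0,\infty)$), and let $H$ be the group generated by the orthogonal reflections in the three planes $\Delta^{-1/2}\operatorname{Span}\{e_j:j\ne i\}$, $i=1,2,3$, that bound $T$. One says that $G$ is finite with the Weyl property if $G$ is finite and $T$ is a (closed) Weyl chamber of $H$, that is, the closure of a connected component of the complement of the union of all planes $P$ such that the orthogonal reflection in $P$ belongs to $H$. Then $G$ is finite with the Weyl property if and only if both of the following conditions hold: 1. up to a permutation of the coordinates, the triple $(m_{12},m_{13},m_{23})$ belongs to $\{(2,2,k),(3,2,3),(3,2,4),(3,2,5) : k\in\mathbb N^*\}$; 2. $a_{ij}=-\cos(\pi/m_{ij})$ for all $i\neq j$. Moreover, if up to a permutation of the coordinates $(m_{12},m_{13},m_{23})$ is $(2,2,k)$ with $k\in\mathbb N^*$, $(3,2,3)$, $(3,2,4)$ or $(3,2,5)$, then $G$ is isomorphic respectively to $\mathbb Z/2\mathbb Z\times D_{2k}$ (with $D_{2k}$ the dihedral group of order $2k$), or to the Coxeter group of type $A_3$, $B_3$ or $H_3$. -/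

import Mathlib

open scoped MatrixOrder

noncomputable section

/-- A weighted small-step model in dimension `d`: a finite set of steps in `{-1, 0, 1}^d`, each
with a positive weight. (The values of `weight` outside `steps` are irrelevant.) -/
structure WalkModel (d : ℕ) where
  steps : Finset (Fin d → ℤ)
  weight : (Fin d → ℤ) → ℝ
  small : ∀ s ∈ steps, ∀ i, s i = -1 ∨ s i = 0 ∨ s i = 1
  weight_pos : ∀ s ∈ steps, 0 < weight s

namespace WalkModel

variable {d : ℕ}

/-- The irreducibility hypothesis: the step set is not included in any half-space
`{y | ⟨x, y⟩ ≥ 0}` with `x ≠ 0`. -/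
def Irreducible (M : WalkModel d) : Prop :=
  ¬ ∃ x : Fin d → ℝ, x ≠ 0 ∧ ∀ s ∈ M.steps, 0 ≤ ∑ i, x i * (s i : ℝ)

/-! ### The combinatorial group -/

/-- The field `ℝ(x₁, …, x_d)` of rational functions. -/
abbrev RatFun (d : ℕ) : Type := FractionRing (MvPolynomial (Fin d) ℝ)

/-- The coordinate `x_i` as a rational function. -/
def coord (i : Fin d) : RatFun d :=
  algebraMap (MvPolynomial (Fin d) ℝ) (RatFun d) (MvPolynomial.X i)

/-- The coefficient of `x_i ^ e` in the inventory `∑ s, w(s) x ^ s`, a Laurent polynomial in the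
variables other than `x_i`. -/
def coeff (M : WalkModel d) (i : Fin d) (e : ℤ) : RatFun d :=
  ∑ s ∈ M.steps with s i = e,
    algebraMap ℝ (RatFun d) (M.weight s) * ∏ j ∈ Finset.univ.erase i, coord j ^ s j

/-- The coefficient `A_i` of `x_i` in the inventory. -/
def coeffA (M : WalkModel d) (i : Fin d) : RatFun d := M.coeff i 1

/-- The coefficient `C_i` of `x_i⁻¹` in the inventory. -/
def coeffC (M : WalkModel d) (i : Fin d) : RatFun d := M.coeff i (-1)

/-- The tuple of rational functions `[x₁, …, x_i⁻¹ C_i / A_i, …, x_d]`. -/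
def genTuple (M : WalkModel d) (i : Fin d) : Fin d → RatFun d :=
  Function.update coord i ((coord i)⁻¹ * (M.coeffC i / M.coeffA i))

theorem coord_ne_zero (i : Fin d) : coord i ≠ 0 := by
  unfold coord
  rw [Ne, map_eq_zero_iff _ (IsFractionRing.injective (MvPolynomial (Fin d) ℝ) (RatFun d))]
  exact MvPolynomial.X_ne_zero i

theorem Irreducible.exists_step {M : WalkModel d} (h : M.Irreducible) (i : Fin d) (e : ℤ)
    (he : e = 1 ∨ e = -1) : ∃ s ∈ M.steps, s i = e := by
  by_contra hc
  push Not at hc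
  refine h ⟨Pi.single i (-(e : ℝ)), ?_, fun s hs => ?_⟩
  · intro h0
    have := congrFun h0 i
    rcases he with rfl | rfl <;> simp at this
  · have h1 := hc s hs
    rw [Finset.sum_eq_single i (by intro j _ hj; simp [hj]) (by simp)]
    rcases he with rfl | rfl <;> rcases M.small s hs i with h2 | h2 | h2 <;> simp_all

theorem coeff_ne_zero (M : WalkModel d) (i : Fin d) (e : ℤ) (h : ∃ s ∈ M.steps, s i = e) :
    M.coeff i e ≠ 0 := by
  classical
  let P : MvPolynomial (Fin d) ℝ := ∑ s ∈ M.steps with s i = e,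
    MvPolynomial.C (M.weight s) * ∏ j ∈ Finset.univ.erase i, MvPolynomial.X j ^ (s j + 1).toNat
  have hP : P ≠ 0 := by
    intro h0
    have h1 : MvPolynomial.eval (fun _ => (1 : ℝ)) P = 0 := by rw [h0, map_zero]
    have h2 : MvPolynomial.eval (fun _ => (1 : ℝ)) P
        = ∑ s ∈ M.steps with s i = e, M.weight s := by
      simp [P, map_sum, map_prod]
    obtain ⟨s, hs, hse⟩ := h
    have h3 : 0 < ∑ s ∈ M.steps with s i = e, M.weight s :=
      Finset.sum_pos (fun t ht => M.weight_pos t (Finset.mem_filter.1 ht).1)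
        ⟨s, Finset.mem_filter.2 ⟨hs, hse⟩⟩
    linarith
  have hE : algebraMap (MvPolynomial (Fin d) ℝ) (RatFun d) P
      = M.coeff i e * ∏ j ∈ Finset.univ.erase i, coord j := by
    simp only [P, coeff, map_sum, map_mul, map_prod, map_pow, Finset.sum_mul]
    refine Finset.sum_congr rfl fun s hs => ?_
    rw [mul_assoc, ← Finset.prod_mul_distrib]
    congr 1
    refine Finset.prod_congr rfl fun j _ => ?_
    have hs0 : 0 ≤ s j + 1 := by
      rcases M.small s (Finset.mem_filter.1 hs).1 j with h2 | h2 | h2 <;> omega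
    rw [← zpow_add_one₀ (coord_ne_zero j), ← zpow_natCast, Int.toNat_of_nonneg hs0]
    rfl
  intro h0
  rw [h0, zero_mul, map_eq_zero_iff _
    (IsFractionRing.injective (MvPolynomial (Fin d) ℝ) (RatFun d))] at hE
  exact hP hE

theorem coeff_mem (M : WalkModel d) (i : Fin d) (e : ℤ) (F : IntermediateField ℝ (RatFun d))
    (hF : ∀ j, j ≠ i → coord j ∈ F) : M.coeff i e ∈ F :=
  sum_mem fun _ _ => mul_mem (F.algebraMap_mem _) <|
    prod_mem fun j hj => zpow_mem (hF j (Finset.ne_of_mem_erase hj)) _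

theorem map_coeff (M : WalkModel d) (i : Fin d) (e : ℤ) (f : RatFun d →ₐ[ℝ] RatFun d)
    (hf : ∀ j, j ≠ i → f (coord j) = coord j) : f (M.coeff i e) = M.coeff i e := by
  simp only [coeff, map_sum, map_mul, map_prod, map_zpow₀, AlgHom.commutes]
  refine Finset.sum_congr rfl fun s _ => congrArg _ <| Finset.prod_congr rfl fun j hj => ?_
  rw [hf j (Finset.ne_of_mem_erase hj)]

theorem adjoin_coord_eq_top : IntermediateField.adjoin ℝ (Set.range (coord (d := d))) = ⊤ := by
  rw [eq_top_iff]
  intro a _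
  obtain ⟨p, q, _, rfl⟩ := IsFractionRing.div_surjective (A := MvPolynomial (Fin d) ℝ) a
  have key : ∀ p : MvPolynomial (Fin d) ℝ, algebraMap _ (RatFun d) p
      ∈ IntermediateField.adjoin ℝ (Set.range (coord (d := d))) := by
    intro p
    induction p using MvPolynomial.induction_on with
    | C a => exact IntermediateField.algebraMap_mem _ a
    | add p q hp hq => rw [map_add]; exact add_mem hp hq
    | mul_X p j hp =>
      rw [map_mul]
      exact mul_mem hp (IntermediateField.subset_adjoin _ _ ⟨j, rfl⟩)
  exact div_mem (key p) (key q)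

open scoped IntermediateField.algebraAdjoinAdjoin in
theorem genTuple_algebraicIndependent (M : WalkModel d) (h : M.Irreducible) (i : Fin d) :
    AlgebraicIndependent ℝ (M.genTuple i) := by
  have hA : M.coeffA i ≠ 0 := M.coeff_ne_zero i 1 (h.exists_step i 1 (Or.inl rfl))
  have hC : M.coeffC i ≠ 0 := M.coeff_ne_zero i (-1) (h.exists_step i (-1) (Or.inr rfl))
  have hmem : ∀ j, j ≠ i → coord j ∈ IntermediateField.adjoin ℝ (Set.range (M.genTuple i)) := by
    intro j hj
    refine IntermediateField.subset_adjoin _ _ ⟨j, ?_⟩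
    simp [genTuple, hj]
  have htop : IntermediateField.adjoin ℝ (Set.range (M.genTuple i)) = ⊤ := by
    rw [eq_top_iff, ← adjoin_coord_eq_top, IntermediateField.adjoin_le_iff]
    rintro _ ⟨j, rfl⟩
    by_cases hj : j = i
    · subst hj
      have h1 : M.genTuple j j ∈ IntermediateField.adjoin ℝ (Set.range (M.genTuple j)) :=
        IntermediateField.subset_adjoin _ _ ⟨j, rfl⟩
      have h2 : coord j = (M.genTuple j j)⁻¹ * (M.coeffC j / M.coeffA j) := by
        have := coord_ne_zero j
        simp only [genTuple, Function.update_self]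
        field_simp
      rw [h2]
      exact mul_mem (inv_mem h1) (div_mem (M.coeff_mem j _ _ hmem) (M.coeff_mem j _ _ hmem))
    · exact hmem j hj
  have halg : Algebra.IsAlgebraic (Algebra.adjoin ℝ (Set.range (M.genTuple i))) (RatFun d) := by
    have h1 : Algebra.IsAlgebraic (IntermediateField.adjoin ℝ (Set.range (M.genTuple i)))
        (RatFun d) := by
      refine ⟨fun a => ?_⟩
      have ha : a ∈ IntermediateField.adjoin ℝ (Set.range (M.genTuple i)) := by
        rw [htop]; trivial
      exact isAlgebraic_algebraMap
        (⟨a, ha⟩ : IntermediateField.adjoin ℝ (Set.range (M.genTuple i)))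
    exact (IsFractionRing.comap_isAlgebraic_iff (A := Algebra.adjoin ℝ (Set.range (M.genTuple i)))
      (K := IntermediateField.adjoin ℝ (Set.range (M.genTuple i)))).2 h1
  refine (Algebra.IsAlgebraic.isTranscendenceBasis_of_le_trdeg_of_finite ℝ (M.genTuple i) ?_).1
  have : Algebra.IsAlgebraic (MvPolynomial (Fin d) ℝ) (RatFun d) :=
    IsLocalization.isAlgebraic _ (nonZeroDivisors (MvPolynomial (Fin d) ℝ))
  have hX : IsTranscendenceBasis ℝ (coord (d := d)) :=
    (IsTranscendenceBasis.mvPolynomial (Fin d) ℝ).algebraMap_comp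
  exact hX.cardinalMk_eq_trdeg.le

/-- Substitution of the tuple `genTuple i` into rational functions. -/
def genHom (M : WalkModel d) (h : M.Irreducible) (i : Fin d) : RatFun d →ₐ[ℝ] RatFun d :=
  IsFractionRing.liftAlgHom (g := MvPolynomial.aeval (M.genTuple i))
    (algebraicIndependent_iff_injective_aeval.1 (M.genTuple_algebraicIndependent h i))

theorem genHom_coord (M : WalkModel d) (h : M.Irreducible) (i j : Fin d) :
    M.genHom h i (coord j) = M.genTuple i j := by
  simp [genHom, coord]

theorem genHom_comp_self (M : WalkModel d) (h : M.Irreducible) (i : Fin d) :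
    (M.genHom h i).comp (M.genHom h i) = AlgHom.id ℝ (RatFun d) := by
  have hA : M.coeffA i ≠ 0 := M.coeff_ne_zero i 1 (h.exists_step i 1 (Or.inl rfl))
  have hC : M.coeffC i ≠ 0 := M.coeff_ne_zero i (-1) (h.exists_step i (-1) (Or.inr rfl))
  have hfix : ∀ j, j ≠ i → M.genHom h i (coord j) = coord j := by
    intro j hj
    rw [genHom_coord]
    simp [genTuple, hj]
  refine IsLocalization.algHom_ext (nonZeroDivisors (MvPolynomial (Fin d) ℝ)) ?_
  refine MvPolynomial.algHom_ext fun j => ?_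
  change M.genHom h i (M.genHom h i (coord j)) = coord j
  by_cases hj : j = i
  · subst hj
    have h1 : M.genHom h j (coord j) = (coord j)⁻¹ * (M.coeffC j / M.coeffA j) := by
      rw [genHom_coord]; simp [genTuple]
    have h2 : M.genHom h j (M.coeffA j) = M.coeffA j := M.map_coeff j _ _ hfix
    have h3 : M.genHom h j (M.coeffC j) = M.coeffC j := M.map_coeff j _ _ hfix
    have := coord_ne_zero j
    rw [h1, map_mul, map_inv₀, map_div₀, h1, h2, h3]
    field_simp
  · rw [hfix j hj, hfix j hj]

/-- The group of birational transformations of the variables `[x₁, …, x_d]`. A birational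
transformation `φ` is encoded by the automorphism `f ↦ f ∘ φ` of the field of rational functions,
i.e. by the substitution of the tuple of rational functions `φ([x₁, …, x_d])`. This reverses
composition, hence the opposite group, in which multiplication is composition of
transformations. -/
abbrev Birational (d : ℕ) : Type := (RatFun d ≃ₐ[ℝ] RatFun d)ᵐᵒᵖ

/-- The generator `φ_i : [x₁, …, x_d] ↦ [x₁, …, x_i⁻¹ C_i / A_i, …, x_d]`. -/
def gen (M : WalkModel d) (h : M.Irreducible) (i : Fin d) : Birational d :=
  MulOpposite.op <| AlgEquiv.ofAlgHom (M.genHom h i) (M.genHom h i)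
    (M.genHom_comp_self h i) (M.genHom_comp_self h i)

/-- The group `G = ⟨φ₁, …, φ_d⟩` of the model. -/
def group (M : WalkModel d) (h : M.Irreducible) : Subgroup (Birational d) :=
  Subgroup.closure (Set.range (M.gen h))

/-- `m_{ij}`, the order of `φ_i φ_j` (with value `0` if this order is infinite). -/
def m (M : WalkModel d) (h : M.Irreducible) (i j : Fin d) : ℕ :=
  orderOf (M.gen h i * M.gen h j)

/-! ### The critical point and the covariance matrix -/

/-- The inventory `χ(x) = ∑ s, w(s) x ^ s` as a real function. -/
def inventory (M : WalkModel d) (x : Fin d → ℝ) : ℝ :=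
  ∑ s ∈ M.steps, M.weight s * ∏ i, x i ^ s i

/-- The partial derivative `∂f/∂x_i`. -/
def partialDeriv (i : Fin d) (f : (Fin d → ℝ) → ℝ) (x : Fin d → ℝ) : ℝ :=
  lineDeriv ℝ f x (Pi.single i 1)

/-- `x` lies in `(0, ∞)^d` and all first partial derivatives of the inventory vanish at `x`. -/
def IsCriticalPoint (M : WalkModel d) (x : Fin d → ℝ) : Prop :=
  (∀ i, 0 < x i) ∧ ∀ i, partialDeriv i M.inventory x = 0

/-- The covariance matrix `Δ = (a_{ij})` computed at the point `x₀`. -/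
def covMatrix (M : WalkModel d) (x₀ : Fin d → ℝ) : Matrix (Fin d) (Fin d) ℝ :=
  Matrix.of fun i j =>
    partialDeriv i (partialDeriv j M.inventory) x₀ /
      √(partialDeriv i (partialDeriv i M.inventory) x₀ *
        partialDeriv j (partialDeriv j M.inventory) x₀)

/-! ### The cone `T`, the reflection group `H` and the Weyl property -/

/-- `Δ^{-1/2}`, the inverse of the positive square root, as a linear map of Euclidean space. -/
def invSqrtMap (M : WalkModel d) (x₀ : Fin d → ℝ) :
    EuclideanSpace ℝ (Fin d) →ₗ[ℝ] EuclideanSpace ℝ (Fin d) :=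
  Matrix.toEuclideanLin (CFC.sqrt (M.covMatrix x₀))⁻¹

/-- The cone `T = Δ^{-1/2} ℝ₊^d`. -/
def cone (M : WalkModel d) (x₀ : Fin d → ℝ) : Set (EuclideanSpace ℝ (Fin d)) :=
  M.invSqrtMap x₀ '' {v | ∀ i, 0 ≤ v i}

/-- The hyperplane `H_i = Δ^{-1/2} Span {e_j | j ≠ i}`, which supports the `i`-th side of `T`. -/
def side (M : WalkModel d) (x₀ : Fin d → ℝ) (i : Fin d) :
    Submodule ℝ (EuclideanSpace ℝ (Fin d)) :=
  (Submodule.span ℝ {v | ∃ j, j ≠ i ∧ v = EuclideanSpace.single j (1 : ℝ)}).map (M.invSqrtMap x₀)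

/-- The group `H` generated by the orthogonal reflections in the hyperplanes `H_i`. -/
def reflectionGroup (M : WalkModel d) (x₀ : Fin d → ℝ) :
    Subgroup (EuclideanSpace ℝ (Fin d) ≃ₗᵢ[ℝ] EuclideanSpace ℝ (Fin d)) :=
  Subgroup.closure (Set.range fun i => (M.side x₀ i).reflection)

end WalkModel

/-- The union of the mirrors of a group `W` of isometries: all hyperplanes `u^⊥`, `u ≠ 0`, such that
the orthogonal reflection in `u^⊥` belongs to `W`. -/
def mirrorUnion {d : ℕ} (W : Subgroup (EuclideanSpace ℝ (Fin d) ≃ₗᵢ[ℝ] EuclideanSpace ℝ (Fin d))) :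
    Set (EuclideanSpace ℝ (Fin d)) :=
  {x | ∃ u : EuclideanSpace ℝ (Fin d), u ≠ 0 ∧ (ℝ ∙ u)ᗮ.reflection ∈ W ∧ x ∈ (ℝ ∙ u)ᗮ}

/-- `T` is a (closed) Weyl chamber of `W`: the closure of a connected component of the complement
of the union of the mirrors of `W`. -/
def IsWeylChamber {d : ℕ}
    (W : Subgroup (EuclideanSpace ℝ (Fin d) ≃ₗᵢ[ℝ] EuclideanSpace ℝ (Fin d)))
    (T : Set (EuclideanSpace ℝ (Fin d))) : Prop :=
  ∃ x ∈ (mirrorUnion W)ᶜ, T = closure (connectedComponentIn (mirrorUnion W)ᶜ x)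

namespace WalkModel

/-- `G` is a finite group with the Weyl property: `G` is finite and the cone `T` is a Weyl chamber
of the reflection group `H`. Here `x₀` is the critical point of the inventory. -/
def FiniteWithWeylProperty {d : ℕ} (M : WalkModel d) (h : M.Irreducible) (x₀ : Fin d → ℝ) : Prop :=
  Finite (M.group h) ∧ IsWeylChamber (M.reflectionGroup x₀) (M.cone x₀)

/-- In dimension 3: up to a permutation of the coordinates, the triple `(m₁₂, m₁₃, m₂₃)` equals the
given triple `t`. -/
def OrdersUpToPerm (M : WalkModel 3) (h : M.Irreducible) (t : ℕ × ℕ × ℕ) : Prop :=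
  ∃ σ : Equiv.Perm (Fin 3), (M.m h (σ 0) (σ 1), M.m h (σ 0) (σ 2), M.m h (σ 1) (σ 2)) = t

end WalkModel

end

noncomputable section

/-! ### Laurent sums and their partial derivatives -/

/-! In logarithmic coordinates the inventory is strictly convex and coercive, so it has exactly one
critical point `x₀`. There its Hessian is the form `Q` of second moments of the steps, and `Δ` is
`Q` normalized to have diagonal 1. Each `φ_i` fixes `x₀`, and its tangent map there is the
`Q`-orthogonal reflection negating `e_i` (`isTangentMap_gen`). A linear isometry from `Q` to the
Euclidean form turns these maps into the reflections in the unit vectors `α_i = Δ^{1/2} e_i`. The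
cone `T` is the set where all `⟪α_i, y⟫ ≥ 0`, so the tangent reflections generate `H`.

Hence every relation between the `φ_i` holds between the reflections. Conversely, in characteristic
0 an automorphism of finite order of a Noetherian local ring with residue field `ℝ` that is tangent
to the identity is the identity (`AlgHom.eq_id_of_tangent_of_pow_eq_one`). A word that is trivial in
`H` and of finite order in `G` is therefore trivial in `G`. In particular a finite `m_ij` is the
order of the product of the reflections in `α_i` and `α_j`.

If `T` is a chamber, the angle between two walls must be `π / k`, since otherwise some mirror of the
dihedral group of the two walls cuts the interior of `T` (`angle_of_isWeylChamber`). When `G` is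
finite, `k = m_ij`, which is condition 2. Positivity of `det Δ` then leaves only the triples of
condition 1.

For the converse and for the isomorphism types, the engine is the deletion argument
(`word_eq_one_of_preserves_positive`): a word in simple reflections that keeps the simple roots
positive can be shortened to the empty word. With an explicit finite system of positive roots, it
shows both that the simplicial cone is a chamber and that the geometric representation of the
abstract Coxeter group is faithful with finite source. That representation kills the kernel of the
surjection from the Coxeter group onto `G`, so the surjection is an isomorphism. The orders alone
fix the entries of `Δ` only up to sign and, for order 5, Galois conjugation. The root tables over
`ℤ[τ]` are made to absorb this ambiguity. For `(2, 2, k)` the product decomposition is proved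
directly. -/

theorem hasLineDerivAt_monomial {d : ℕ} {x : Fin d → ℝ} (hx : ∀ k, 0 < x k) (s : Fin d → ℤ)
    (i : Fin d) :
    HasLineDerivAt ℝ (fun y : Fin d → ℝ => ∏ k, y k ^ s k)
      ((x i)⁻¹ * s i * ∏ k, x k ^ s k) x (Pi.single i 1) := by
  have h1 : ∀ t : ℝ, ∏ k, (x + t • (Pi.single i 1 : Fin d → ℝ)) k ^ s k
      = (x i + t) ^ s i * ∏ k ∈ Finset.univ.erase i, x k ^ s k := by
    intro t
    rw [← Finset.mul_prod_erase _ _ (Finset.mem_univ i)]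
    congr 1
    · simp
    · refine Finset.prod_congr rfl fun k hk => ?_
      simp [Finset.ne_of_mem_erase hk]
  unfold HasLineDerivAt
  simp only [h1]
  have h2 : HasDerivAt (fun t : ℝ => (x i + t) ^ s i) (s i * (x i) ^ (s i - 1)) 0 := by
    have := (hasDerivAt_zpow (s i) (x i + 0) (Or.inl (by simpa using (hx i).ne'))).comp_const_add
      (x i) 0
    simpa using this
  refine (h2.mul_const (∏ k ∈ Finset.univ.erase i, x k ^ s k)).congr_deriv ?_
  rw [← Finset.mul_prod_erase _ _ (Finset.mem_univ i), zpow_sub_one₀ (hx i).ne']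
  ring

theorem lineDeriv_laurent {d : ℕ} {ι : Type*} (S : Finset ι) (c : ι → ℝ) (f : ι → Fin d → ℤ)
    {x : Fin d → ℝ} (hx : ∀ k, 0 < x k) (i : Fin d) :
    lineDeriv ℝ (fun y : Fin d → ℝ => ∑ s ∈ S, c s * ∏ k, y k ^ f s k) x (Pi.single i 1)
      = ∑ s ∈ S, c s * ((x i)⁻¹ * f s i * ∏ k, x k ^ f s k) := by
  refine HasLineDerivAt.lineDeriv ?_
  unfold HasLineDerivAt
  exact HasDerivAt.fun_sum fun s _ => (hasLineDerivAt_monomial hx (f s) i).const_mul (c s)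

/-! ### Moments of the steps and the Hessian at the critical point -/

namespace WalkModel

variable {d : ℕ}

/-- The weight of the step `s` in the inventory at the point `x`. -/
def termAt (M : WalkModel d) (x : Fin d → ℝ) (s : Fin d → ℤ) : ℝ :=
  M.weight s * ∏ k, x k ^ s k

theorem termAt_pos (M : WalkModel d) {x : Fin d → ℝ} (hx : ∀ k, 0 < x k) {s : Fin d → ℤ}
    (hs : s ∈ M.steps) : 0 < M.termAt x s :=
  mul_pos (M.weight_pos s hs) (Finset.prod_pos fun k _ => zpow_pos (hx k) _)

/-- The second moments of the steps, i.e. the Hessian of the inventory in logarithmic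
coordinates. -/
def hess (M : WalkModel d) (x : Fin d → ℝ) (i j : Fin d) : ℝ :=
  ∑ s ∈ M.steps, M.termAt x s * (s i * s j)

theorem hess_comm (M : WalkModel d) (x : Fin d → ℝ) (i j : Fin d) :
    M.hess x i j = M.hess x j i :=
  Finset.sum_congr rfl fun s _ => by ring

theorem partialDeriv_inventory (M : WalkModel d) {x : Fin d → ℝ} (hx : ∀ k, 0 < x k) (i : Fin d) :
    partialDeriv i M.inventory x = (x i)⁻¹ * ∑ s ∈ M.steps, M.termAt x s * s i := by
  unfold partialDeriv inventory
  rw [lineDeriv_laurent M.steps M.weight (fun s => s) hx i, Finset.mul_sum]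
  exact Finset.sum_congr rfl fun s _ => by unfold termAt; ring

theorem isCriticalPoint_iff (M : WalkModel d) {x : Fin d → ℝ} :
    M.IsCriticalPoint x ↔
      (∀ k, 0 < x k) ∧ ∀ i, ∑ s ∈ M.steps, M.termAt x s * (s i : ℝ) = 0 := by
  unfold IsCriticalPoint
  refine and_congr_right fun hx => forall_congr' fun i => ?_
  rw [M.partialDeriv_inventory hx]
  simp [(hx i).ne']

/-- Besides the second moment, differentiating twice leaves `-δ_ij` times a first moment, which
vanishes at a critical point. -/
theorem partialDeriv_partialDeriv_inventory (M : WalkModel d) {x : Fin d → ℝ}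
    (hx : M.IsCriticalPoint x) (i j : Fin d) :
    partialDeriv i (partialDeriv j M.inventory) x = (x i)⁻¹ * (x j)⁻¹ * M.hess x i j := by
  have hpos := hx.1
  have hcrit := (M.isCriticalPoint_iff.1 hx).2
  have hmon : ∀ y : Fin d → ℝ, (∀ k, 0 < y k) → ∀ s : Fin d → ℤ,
      ∏ k, y k ^ (s - Pi.single j 1 : Fin d → ℤ) k = (y j)⁻¹ * ∏ k, y k ^ s k := by
    intro y hy s
    simp only [Pi.sub_apply, zpow_sub₀ (hy _).ne', Finset.prod_div_distrib]
    rw [div_eq_inv_mul]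
    congr 2
    rw [Finset.prod_eq_single j (fun k _ hk => by simp [hk]) (by simp)]
    simp
  have hopen : IsOpen {y : Fin d → ℝ | ∀ k, 0 < y k} := by
    simp only [Set.ofPred_forall]
    exact isOpen_iInter_of_finite fun k => isOpen_lt continuous_const (continuous_apply k)
  -- The first derivative is again a Laurent sum, but only on the open orthant; a neighbourhood of
  -- `x` suffices for the second derivative.
  have heq : partialDeriv j M.inventory =ᶠ[nhds x]
      fun y => ∑ s ∈ M.steps, (M.weight s * s j) * ∏ k, y k ^ (s - Pi.single j 1 : Fin d → ℤ) k := by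
    filter_upwards [hopen.mem_nhds hpos] with y hy
    rw [M.partialDeriv_inventory hy, Finset.mul_sum]
    refine Finset.sum_congr rfl fun s _ => ?_
    rw [hmon y hy]
    unfold termAt
    ring
  have h1 : partialDeriv i (partialDeriv j M.inventory) x
      = (x i)⁻¹ * (x j)⁻¹ *
        ∑ s ∈ M.steps, M.termAt x s * (s j * ((s i : ℝ) - (Pi.single j 1 : Fin d → ℤ) i)) := by
    unfold partialDeriv at heq ⊢
    refine heq.lineDeriv_eq.trans ((lineDeriv_laurent M.steps (fun s => M.weight s * s j)
      (fun s => (s - Pi.single j 1 : Fin d → ℤ)) hpos i).trans ?_)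
    rw [Finset.mul_sum]
    refine Finset.sum_congr rfl fun s _ => ?_
    rw [hmon x hpos]
    unfold termAt
    push_cast [Pi.sub_apply]
    ring
  rw [h1]
  congr 1
  unfold hess
  have h2 : ∑ s ∈ M.steps, M.termAt x s * (s j * ((s i : ℝ) - (Pi.single j 1 : Fin d → ℤ) i))
      = ∑ s ∈ M.steps, M.termAt x s * (s i * s j)
        - (Pi.single j 1 : Fin d → ℤ) i * ∑ s ∈ M.steps, M.termAt x s * (s j : ℝ) := by
    rw [Finset.mul_sum, ← Finset.sum_sub_distrib]
    exact Finset.sum_congr rfl fun s _ => by ring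
  rw [h2, hcrit j, mul_zero, sub_zero]

theorem hess_quadratic (M : WalkModel d) (x v : Fin d → ℝ) :
    ∑ i, ∑ j, v i * M.hess x i j * v j
      = ∑ s ∈ M.steps, M.termAt x s * (∑ i, v i * s i) ^ 2 := by
  simp only [hess, sq, Finset.mul_sum, Finset.sum_mul]
  rw [Finset.sum_comm' (t' := Finset.univ) (s' := fun _ => Finset.univ) (by simp)]
  rw [Finset.sum_congr rfl fun i _ => Finset.sum_comm, Finset.sum_comm]
  refine Finset.sum_congr rfl fun s _ => Finset.sum_congr rfl fun i _ =>
    Finset.sum_congr rfl fun j _ => by ring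

/-- The form is a positively weighted sum of squares `⟨v, s⟩²`; if it vanished, all steps would lie
in `v^⊥`, hence in a half-space. -/
theorem hess_quadratic_pos (M : WalkModel d) (h : M.Irreducible) {x : Fin d → ℝ}
    (hx : ∀ k, 0 < x k) {v : Fin d → ℝ} (hv : v ≠ 0) :
    0 < ∑ i, ∑ j, v i * M.hess x i j * v j := by
  rw [hess_quadratic]
  refine lt_of_le_of_ne (Finset.sum_nonneg fun s hs =>
    mul_nonneg (M.termAt_pos hx hs).le (sq_nonneg _)) fun h0 => h ⟨v, hv, fun s hs => ?_⟩
  have h1 := (Finset.sum_eq_zero_iff_of_nonneg fun s hs =>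
    mul_nonneg (M.termAt_pos hx hs).le (sq_nonneg _)).1 h0.symm s hs
  rcases mul_eq_zero.1 h1 with h2 | h2
  · exact absurd h2 (M.termAt_pos hx hs).ne'
  · rw [pow_eq_zero_iff two_ne_zero] at h2
    exact h2.ge

theorem hess_self_pos (M : WalkModel d) (h : M.Irreducible) {x : Fin d → ℝ}
    (hx : ∀ k, 0 < x k) (i : Fin d) : 0 < M.hess x i i := by
  have := M.hess_quadratic_pos h hx (v := Pi.single i 1) (by simp)
  simpa [Pi.single_apply] using this

/-- The factors `1 / x_i` cancel: `Δ` is the correlation matrix of the steps weighted by `w(s) x^s`.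
-/
theorem covMatrix_apply (M : WalkModel d) {x : Fin d → ℝ}
    (hx : M.IsCriticalPoint x) (i j : Fin d) :
    M.covMatrix x i j = M.hess x i j / (√(M.hess x i i) * √(M.hess x j j)) := by
  have hi := hx.1 i
  have hj := hx.1 j
  have hii : 0 ≤ M.hess x i i := Finset.sum_nonneg fun s hs =>
    mul_nonneg (M.termAt_pos hx.1 hs).le (mul_self_nonneg _)
  simp only [covMatrix, Matrix.of_apply, M.partialDeriv_partialDeriv_inventory hx]
  have h1 : (x i)⁻¹ * (x i)⁻¹ * M.hess x i i * ((x j)⁻¹ * (x j)⁻¹ * M.hess x j j)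
      = ((x i)⁻¹ * (x j)⁻¹) ^ 2 * (M.hess x i i * M.hess x j j) := by ring
  rw [h1, Real.sqrt_mul (sq_nonneg _), Real.sqrt_sq (by positivity), Real.sqrt_mul hii]
  rw [mul_div_mul_left _ _ (by positivity)]

/-! ### Existence and uniqueness of the critical point -/

/-- The inventory in logarithmic coordinates. -/
def logInventory (M : WalkModel d) (u : Fin d → ℝ) : ℝ :=
  ∑ s ∈ M.steps, M.weight s * Real.exp (∑ i, u i * s i)

theorem termAt_exp (M : WalkModel d) (u : Fin d → ℝ) (s : Fin d → ℤ) :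
    M.termAt (fun k => Real.exp (u k)) s = M.weight s * Real.exp (∑ i, u i * s i) := by
  unfold termAt
  rw [Real.exp_sum]
  congr 1
  refine Finset.prod_congr rfl fun k _ => ?_
  rw [Real.exp_mul, Real.rpow_intCast]

/-- Since `exp a ≥ max a 0`, the inventory dominates a positively homogeneous function that is
positive off 0 by irreducibility. Its minimum on the unit sphere serves as `c`. -/
theorem Irreducible.exists_lower_bound {M : WalkModel d} (h : M.Irreducible) :
    ∃ c > 0, ∀ u : Fin d → ℝ, c * ‖u‖ ≤ M.logInventory u := by
  let p : (Fin d → ℝ) → ℝ := fun u => ∑ s ∈ M.steps, M.weight s * max (∑ i, u i * s i) 0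
  have hpc : Continuous p := by unfold p; fun_prop
  have hppos : ∀ u, u ≠ 0 → 0 < p u := by
    intro u hu
    refine lt_of_le_of_ne (Finset.sum_nonneg fun s hs =>
      mul_nonneg (M.weight_pos s hs).le (le_max_right _ _)) fun h0 =>
        h ⟨-u, by simpa using hu, fun s hs => ?_⟩
    have h1 := (Finset.sum_eq_zero_iff_of_nonneg fun s hs =>
      mul_nonneg (M.weight_pos s hs).le (le_max_right _ _)).1 h0.symm s hs
    rcases mul_eq_zero.1 h1 with h2 | h2
    · exact absurd h2 (M.weight_pos s hs).ne'
    · simpa using max_eq_right_iff.1 h2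
  have hle : ∀ u, p u ≤ M.logInventory u := fun u =>
    Finset.sum_le_sum fun s hs => mul_le_mul_of_nonneg_left
      (max_le (by linarith [Real.add_one_le_exp (∑ i, u i * (s i : ℝ))]) (Real.exp_pos _).le)
      (M.weight_pos s hs).le
  have hhom : ∀ (t : ℝ) (u), 0 ≤ t → p (t • u) = t * p u := by
    intro t u ht
    simp only [p, Finset.mul_sum, Pi.smul_apply, smul_eq_mul]
    refine Finset.sum_congr rfl fun s _ => ?_
    rw [mul_left_comm, mul_max_of_nonneg _ _ ht, mul_zero, Finset.mul_sum]
    simp only [mul_assoc]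
  -- The sphere is empty only for `d = 0`, where any `c` works.
  rcases (Metric.sphere (0 : Fin d → ℝ) 1).eq_empty_or_nonempty with he | hne
  · refine ⟨1, one_pos, fun u => ?_⟩
    have hu : u = 0 := by
      by_contra hu
      have : ‖u‖⁻¹ • u ∈ Metric.sphere (0 : Fin d → ℝ) 1 := by
        simp [norm_smul, norm_ne_zero_iff.2 hu]
      rw [he] at this
      exact this
    rw [hu, norm_zero, mul_zero]
    exact Finset.sum_nonneg fun s hs => mul_nonneg (M.weight_pos s hs).le (Real.exp_pos _).le
  · obtain ⟨z, hz, hmin⟩ := (isCompact_sphere (0 : Fin d → ℝ) 1).exists_isMinOn hne hpc.continuousOn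
    have hz0 : z ≠ 0 := by
      rintro rfl
      simp at hz
    refine ⟨p z, hppos z hz0, fun u => ?_⟩
    refine le_trans ?_ (hle u)
    by_cases hu : u = 0
    · subst hu
      simp [p]
    have hn : 0 < ‖u‖ := norm_pos_iff.2 hu
    have h1 : ‖u‖⁻¹ • u ∈ Metric.sphere (0 : Fin d → ℝ) 1 := by
      simp [norm_smul, hn.ne']
    have h2 : p z ≤ p (‖u‖⁻¹ • u) := hmin h1
    rw [hhom _ _ (by positivity), ← div_eq_inv_mul, le_div_iff₀ hn] at h2
    exact h2

theorem Irreducible.exists_isCriticalPoint {M : WalkModel d} (h : M.Irreducible) :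
    ∃ x, M.IsCriticalPoint x := by
  obtain ⟨c, hc, hle⟩ := h.exists_lower_bound
  have hcont : Continuous M.logInventory := by unfold logInventory; fun_prop
  have htend : Filter.Tendsto M.logInventory (Filter.cocompact _) Filter.atTop :=
    Filter.tendsto_atTop_mono hle ((tendsto_norm_cocompact_atTop).const_mul_atTop hc)
  obtain ⟨u, hu⟩ := hcont.exists_forall_le htend
  refine ⟨fun k => Real.exp (u k), M.isCriticalPoint_iff.2 ⟨fun k => Real.exp_pos _, fun i => ?_⟩⟩
  simp only [termAt_exp]
  let g : ℝ → ℝ := fun t => M.logInventory (u + t • Pi.single i 1)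
  have hg : HasDerivAt g (∑ s ∈ M.steps, M.weight s * Real.exp (∑ k, u k * s k) * s i) 0 := by
    have hsum : ∀ (t : ℝ) (s : Fin d → ℤ),
        ∑ k, (u + t • (Pi.single i 1 : Fin d → ℝ)) k * (s k : ℝ) = ∑ k, u k * s k + t * s i := by
      intro t s
      simp only [Pi.add_apply, add_mul, Finset.sum_add_distrib]
      congr 1
      rw [Finset.sum_eq_single i (fun k _ hk => by simp [hk]) (by simp)]
      simp
    unfold g logInventory
    simp only [hsum]
    refine HasDerivAt.fun_sum fun s _ => ?_
    have h1 : HasDerivAt (fun t : ℝ => ∑ k, u k * (s k : ℝ) + t * s i) (s i : ℝ) 0 := by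
      simpa using ((hasDerivAt_id (0 : ℝ)).mul_const (s i : ℝ)).const_add (∑ k, u k * (s k : ℝ))
    simpa [mul_assoc] using h1.exp.const_mul (M.weight s)
  have hmin : IsLocalMin g 0 := Filter.Eventually.of_forall fun t => by
    simpa [g] using hu (u + t • Pi.single i 1)
  exact hmin.hasDerivAt_eq_zero hg

/-- The gradient is monotone in logarithmic coordinates: pairing its difference at two critical
points with `u' - u` gives a vanishing sum of nonnegative terms, so `u' - u` is orthogonal to every
step, against irreducibility. -/
theorem Irreducible.isCriticalPoint_unique {M : WalkModel d} (h : M.Irreducible)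
    {x y : Fin d → ℝ} (hx : M.IsCriticalPoint x) (hy : M.IsCriticalPoint y) : x = y := by
  have key : ∀ z : Fin d → ℝ, M.IsCriticalPoint z → ∃ u : Fin d → ℝ,
      z = (fun k => Real.exp (u k)) ∧
      ∀ v : Fin d → ℝ, ∑ s ∈ M.steps, M.weight s * Real.exp (∑ k, u k * s k) *
        (∑ i, v i * s i) = 0 := by
    intro z hz
    obtain ⟨hz0, hz1⟩ := M.isCriticalPoint_iff.1 hz
    have he : z = fun k => Real.exp (Real.log (z k)) := by
      ext k
      rw [Real.exp_log (hz0 k)]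
    refine ⟨fun k => Real.log (z k), he, fun v => ?_⟩
    rw [he] at hz1
    simp only [termAt_exp] at hz1
    simp only [Finset.mul_sum]
    rw [Finset.sum_comm]
    refine Finset.sum_eq_zero fun i _ => ?_
    have := hz1 i
    rw [← mul_zero (v i), ← this, Finset.mul_sum]
    exact Finset.sum_congr rfl fun s _ => by ring
  obtain ⟨u, rfl, hu⟩ := key x hx
  obtain ⟨u', rfl, hu'⟩ := key y hy
  by_contra hne
  have hv : u' - u ≠ 0 := by
    intro h0
    rw [sub_eq_zero.1 h0] at hne
    exact hne rfl
  refine h ⟨u' - u, hv, fun s hs => ?_⟩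
  have hdiff : ∀ s : Fin d → ℤ, ∑ i, (u' - u) i * (s i : ℝ)
      = ∑ k, u' k * (s k : ℝ) - ∑ k, u k * (s k : ℝ) := by
    intro s
    simp [sub_mul, Finset.sum_sub_distrib]
  have hterm : ∀ s ∈ M.steps, 0 ≤ M.weight s *
      ((Real.exp (∑ k, u' k * (s k : ℝ)) - Real.exp (∑ k, u k * (s k : ℝ))) *
      (∑ i, (u' - u) i * (s i : ℝ))) := by
    intro s hs
    refine mul_nonneg (M.weight_pos s hs).le ?_
    rw [hdiff]
    rcases le_total (∑ k, u' k * (s k : ℝ)) (∑ k, u k * (s k : ℝ)) with hle | hle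
    · exact mul_nonneg_of_nonpos_of_nonpos (sub_nonpos.2 (Real.exp_le_exp.2 hle)) (sub_nonpos.2 hle)
    · exact mul_nonneg (sub_nonneg.2 (Real.exp_le_exp.2 hle)) (sub_nonneg.2 hle)
  have hsum : ∑ s ∈ M.steps, M.weight s *
      ((Real.exp (∑ k, u' k * (s k : ℝ)) - Real.exp (∑ k, u k * (s k : ℝ))) *
      (∑ i, (u' - u) i * (s i : ℝ))) = 0 := by
    have := congrArg₂ (· - ·) (hu' (u' - u)) (hu (u' - u))
    simp only [sub_zero, ← Finset.sum_sub_distrib] at this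
    rw [← this]
    exact Finset.sum_congr rfl fun s _ => by ring
  have h1 := (Finset.sum_eq_zero_iff_of_nonneg hterm).1 hsum s hs
  rcases mul_eq_zero.1 h1 with h2 | h2
  · exact absurd h2 (M.weight_pos s hs).ne'
  rcases mul_eq_zero.1 h2 with h3 | h3
  · rw [hdiff, sub_nonneg]
    exact (Real.exp_injective (sub_eq_zero.1 h3)).ge
  · exact h3.ge

theorem Irreducible.existsUnique_isCriticalPoint {M : WalkModel d} (h : M.Irreducible) :
    ∃! x, M.IsCriticalPoint x := by
  obtain ⟨x, hx⟩ := h.exists_isCriticalPoint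
  exact ⟨x, hx, fun y hy => h.isCriticalPoint_unique hy hx⟩

end WalkModel

end



noncomputable section

/-! ### Automorphisms of finite order of a local ring that are tangent to the identity -/

section LocalRing

open IsLocalRing

variable {R : Type*} [CommRing R] [IsLocalRing R] [Algebra ℝ R]

/-- A map tangent to the identity acts trivially on each `𝔪^k / 𝔪^(k+1)`: for `k = 0` because the
residue field is `ℝ`, and then by the product rule. -/
theorem sub_mem_maximalIdeal_pow_succ (τ : R →ₐ[ℝ] R)
    (hres : ∀ a : R, ∃ c : ℝ, a - algebraMap ℝ R c ∈ maximalIdeal R)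
    (hτ : ∀ a ∈ maximalIdeal R, τ a - a ∈ maximalIdeal R ^ 2) (k : ℕ) :
    ∀ a ∈ maximalIdeal R ^ k, τ a - a ∈ maximalIdeal R ^ (k + 1) := by
  induction k with
  | zero =>
    intro a _
    obtain ⟨c, hc⟩ := hres a
    have h1 := hτ _ hc
    rw [map_sub, AlgHom.commutes, sub_sub_sub_cancel_right] at h1
    exact Ideal.pow_le_pow_right (by norm_num) h1
  | succ k ih =>
    intro a ha
    rw [pow_succ] at ha
    refine Submodule.mul_induction_on ha (fun a ha b hb => ?_) fun a b h1 h2 => ?_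
    · have h1 : τ (a * b) - a * b = τ a * (τ b - b) + (τ a - a) * b := by rw [map_mul]; ring
      have h2 := ih a ha
      have h3 : τ a ∈ maximalIdeal R ^ k := by
        have := add_mem (Ideal.pow_le_pow_right k.le_succ h2) ha
        rwa [sub_add_cancel] at this
      rw [h1]
      refine add_mem ?_ ?_
      · have := Ideal.mul_mem_mul h3 (hτ b hb)
        rwa [← pow_add] at this
      · rw [pow_succ]
        exact Ideal.mul_mem_mul h2 hb
    · have h3 : τ (a + b) - (a + b) = (τ a - a) + (τ b - b) := by rw [map_add]; ring
      rw [h3]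
      exact add_mem h1 h2

/-- If `δ = τ - 1` has image in `𝔪^(k+1)`, then `τ^j - 1 ≡ j δ` modulo `𝔪^(k+2)`. Taking `j = n` and
dividing by `n` pushes `δ` one power deeper, and Krull's intersection theorem gives `δ = 0`. -/
theorem AlgHom.eq_id_of_tangent_of_pow_eq_one [IsNoetherianRing R] (τ : R →ₐ[ℝ] R)
    (hres : ∀ a : R, ∃ c : ℝ, a - algebraMap ℝ R c ∈ maximalIdeal R)
    (hτ : ∀ a ∈ maximalIdeal R, τ a - a ∈ maximalIdeal R ^ 2)
    {n : ℕ} (hn : n ≠ 0) (hpow : ∀ a, (τ^[n]) a = a) (a : R) : τ a = a := by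
  have h1 := sub_mem_maximalIdeal_pow_succ τ hres hτ
  have h1' : ∀ k, ∀ a ∈ maximalIdeal R ^ k, τ a ∈ maximalIdeal R ^ k := by
    intro k a ha
    have := add_mem (Ideal.pow_le_pow_right k.le_succ (h1 k a ha)) ha
    rwa [sub_add_cancel] at this
  have h2 : ∀ k, ∀ a, τ a - a ∈ maximalIdeal R ^ (k + 1) := by
    intro k
    induction k with
    | zero => exact fun a => h1 0 a (by simp)
    | succ k ih =>
      intro a
      have h3 : ∀ j : ℕ, (τ^[j]) a - a - j * (τ a - a) ∈ maximalIdeal R ^ (k + 1 + 1) := by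
        intro j
        induction j with
        | zero => simp
        | succ j hj =>
          have e : (τ^[j + 1]) a - a - ((j + 1 : ℕ) : R) * (τ a - a)
              = τ ((τ^[j]) a - a - j * (τ a - a)) + j * (τ (τ a - a) - (τ a - a)) := by
            rw [Function.iterate_succ_apply']
            simp only [map_sub, map_mul, map_natCast]
            push_cast
            ring
          rw [e]
          exact add_mem (h1' _ _ hj) (Ideal.mul_mem_left _ _ (h1 _ _ (ih a)))
      have h4 := h3 n
      rw [hpow, sub_self, zero_sub, neg_mem_iff] at h4
      have h5 := Ideal.mul_mem_left _ (algebraMap ℝ R (n : ℝ)⁻¹) h4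
      have e : algebraMap ℝ R (n : ℝ)⁻¹ * (n * (τ a - a)) = τ a - a := by
        rw [← mul_assoc, ← map_natCast (algebraMap ℝ R) n, ← map_mul,
          inv_mul_cancel₀ (by exact_mod_cast hn), map_one, one_mul]
      rwa [e] at h5
  have h3 : τ a - a ∈ (⨅ i : ℕ, maximalIdeal R ^ i) := by
    rw [Submodule.mem_iInf]
    exact fun k => Ideal.pow_le_pow_right k.le_succ (h2 k a)
  rw [Ideal.iInf_pow_eq_bot_of_isLocalRing _ (maximalIdeal.isMaximal R).ne_top] at h3
  exact sub_eq_zero.1 h3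

end LocalRing

/-! ### First-order jets of rational functions at a point -/

open DualNumber

/-- The ideal of polynomials vanishing at `x`. -/
def vanishingIdealAt {d : ℕ} (x : Fin d → ℝ) : Ideal (MvPolynomial (Fin d) ℝ) :=
  RingHom.ker (MvPolynomial.eval x)

instance {d : ℕ} (x : Fin d → ℝ) : (vanishingIdealAt x).IsPrime := RingHom.ker_isPrime _

theorem mem_vanishingIdealAt {d : ℕ} {x : Fin d → ℝ} {p : MvPolynomial (Fin d) ℝ} :
    p ∈ vanishingIdealAt x ↔ MvPolynomial.eval x p = 0 := Iff.rfl

theorem primeCompl_le {d : ℕ} (x : Fin d → ℝ) :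
    (vanishingIdealAt x).primeCompl ≤ nonZeroDivisors (MvPolynomial (Fin d) ℝ) :=
  le_nonZeroDivisors_of_noZeroDivisors fun h => h (zero_mem _)

/-- The ring of rational functions that are regular at `x`. -/
def regularAt {d : ℕ} (x : Fin d → ℝ) :
    Subalgebra (MvPolynomial (Fin d) ℝ) (WalkModel.RatFun d) :=
  Localization.subalgebra.ofField _ (vanishingIdealAt x).primeCompl (primeCompl_le x)

instance {d : ℕ} (x : Fin d → ℝ) :
    IsLocalization.AtPrime (regularAt x) (vanishingIdealAt x) :=
  Localization.subalgebra.isLocalization_ofField _ _ _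

instance {d : ℕ} (x : Fin d → ℝ) : IsLocalRing (regularAt x) :=
  IsLocalization.AtPrime.isLocalRing _ (vanishingIdealAt x)

instance {d : ℕ} (x : Fin d → ℝ) : IsNoetherianRing (regularAt x) :=
  IsLocalization.isNoetherianRing (vanishingIdealAt x).primeCompl _ inferInstance

variable {d : ℕ} (x : Fin d → ℝ)

/-- The first-order expansion of polynomials at `x` in the direction with logarithmic
coordinates `v`. -/
def polyJet (v : Fin d → ℝ) : MvPolynomial (Fin d) ℝ →ₐ[ℝ] ℝ[ε] :=
  MvPolynomial.aeval fun i => TrivSqZeroExt.inl (x i) + TrivSqZeroExt.inr (x i * v i)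

theorem fst_polyJet (v : Fin d → ℝ) (p : MvPolynomial (Fin d) ℝ) :
    (polyJet x v p).fst = MvPolynomial.eval x p := by
  have : (TrivSqZeroExt.fstHom ℝ ℝ ℝ).comp (polyJet x v) = MvPolynomial.aeval x := by
    refine MvPolynomial.algHom_ext fun i => ?_
    simp [polyJet]
  have := DFunLike.congr_fun this p
  simpa using this

theorem isUnit_polyJet (v : Fin d → ℝ) (q : (vanishingIdealAt x).primeCompl) :
    IsUnit (polyJet x v q) := by
  rw [TrivSqZeroExt.isUnit_iff_isUnit_fst, fst_polyJet, isUnit_iff_ne_zero]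
  exact q.2

/-- The first-order expansion at `x` of the rational functions that are regular at `x`. -/
def jet (v : Fin d → ℝ) : regularAt x →ₐ[ℝ] ℝ[ε] :=
  IsLocalization.liftAlgHom (M := (vanishingIdealAt x).primeCompl) (f := polyJet x v)
    (isUnit_polyJet x v)

theorem jet_algebraMap (v : Fin d → ℝ) (p : MvPolynomial (Fin d) ℝ) :
    jet x v (algebraMap _ _ p) = polyJet x v p := by
  simp [jet]

theorem exists_mul_algebraMap_eq (f : regularAt x) :
    ∃ p q : MvPolynomial (Fin d) ℝ, MvPolynomial.eval x q ≠ 0 ∧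
      f * algebraMap _ (regularAt x) q = algebraMap _ (regularAt x) p := by
  obtain ⟨⟨p, q⟩, hpq⟩ := IsLocalization.surj (vanishingIdealAt x).primeCompl f
  exact ⟨p, q, q.2, hpq⟩

theorem isUnit_regularAt_iff (v : Fin d → ℝ) (f : regularAt x) :
    IsUnit f ↔ (jet x v f).fst ≠ 0 := by
  constructor
  · intro hf
    have := hf.map (jet x v)
    rwa [TrivSqZeroExt.isUnit_iff_isUnit_fst, isUnit_iff_ne_zero] at this
  · intro hf
    obtain ⟨p, q, hq, hpq⟩ := exists_mul_algebraMap_eq x f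
    have h1 := congrArg TrivSqZeroExt.fst (congrArg (jet x v) hpq)
    rw [map_mul, jet_algebraMap, jet_algebraMap, TrivSqZeroExt.fst_mul, fst_polyJet,
      fst_polyJet] at h1
    have hp : MvPolynomial.eval x p ≠ 0 := h1 ▸ mul_ne_zero hf hq
    have : IsUnit (algebraMap _ (regularAt x) p) :=
      IsLocalization.map_units (M := (vanishingIdealAt x).primeCompl) _ ⟨p, hp⟩
    rw [← hpq] at this
    exact isUnit_of_mul_isUnit_left this

theorem polyJet_eq_zero_of_mem_sq (v : Fin d → ℝ) {p : MvPolynomial (Fin d) ℝ}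
    (hp : p ∈ vanishingIdealAt x ^ 2) : polyJet x v p = 0 := by
  rw [sq] at hp
  refine Submodule.mul_induction_on hp (fun a ha b hb => ?_) fun a b h1 h2 => ?_
  · rw [map_mul]
    have h1 := (fst_polyJet x v a).trans ha
    have h2 := (fst_polyJet x v b).trans hb
    ext <;> simp [h1, h2]
  · rw [map_add, h1, h2, add_zero]

theorem exists_linear_approximation (p : MvPolynomial (Fin d) ℝ) :
    ∃ (c : ℝ) (l : Fin d → ℝ), p - (MvPolynomial.C c +
      ∑ i, MvPolynomial.C (l i) * (MvPolynomial.X i - MvPolynomial.C (x i)))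
        ∈ vanishingIdealAt x ^ 2 := by
  induction p using MvPolynomial.induction_on with
  | C a => exact ⟨a, 0, by simp⟩
  | add p q hp hq =>
    obtain ⟨c, l, h⟩ := hp
    obtain ⟨c', l', h'⟩ := hq
    refine ⟨c + c', l + l', ?_⟩
    convert add_mem h h' using 1
    simp only [Pi.add_apply, map_add, add_mul, Finset.sum_add_distrib]
    ring
  | mul_X p j hp =>
    obtain ⟨c, l, h⟩ := hp
    refine ⟨c * x j, fun i => l i * x j + if i = j then c else 0, ?_⟩
    set Y : MvPolynomial (Fin d) ℝ :=
      ∑ i, MvPolynomial.C (l i) * (MvPolynomial.X i - MvPolynomial.C (x i)) with hY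
    have hX : ∀ i, (MvPolynomial.X i - MvPolynomial.C (x i) : MvPolynomial (Fin d) ℝ)
        ∈ vanishingIdealAt x := fun i => by simp [mem_vanishingIdealAt]
    have hYm : Y ∈ vanishingIdealAt x :=
      sum_mem fun i _ => Ideal.mul_mem_left _ _ (hX i)
    have e : ∑ i, MvPolynomial.C (l i * x j + if i = j then c else 0) *
        (MvPolynomial.X i - MvPolynomial.C (x i)) = MvPolynomial.C (x j) * Y
          + MvPolynomial.C c * (MvPolynomial.X j - MvPolynomial.C (x j)) := by
      simp only [map_add, map_mul, add_mul, Finset.sum_add_distrib, hY, Finset.mul_sum]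
      congr 1
      · exact Finset.sum_congr rfl fun i _ => by ring
      · rw [Finset.sum_eq_single j (fun k _ hk => by simp [hk]) (by simp)]
        simp
    rw [e, map_mul]
    have e2 : p * MvPolynomial.X j - (MvPolynomial.C c * MvPolynomial.C (x j) +
        (MvPolynomial.C (x j) * Y + MvPolynomial.C c *
          (MvPolynomial.X j - MvPolynomial.C (x j))))
        = MvPolynomial.X j * (p - (MvPolynomial.C c + Y))
          + Y * (MvPolynomial.X j - MvPolynomial.C (x j)) := by ring
    rw [e2]
    refine add_mem (Ideal.mul_mem_left _ _ h) ?_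
    rw [sq]
    exact Ideal.mul_mem_mul hYm (hX j)

/-- The jets read off the constant and linear Taylor coefficients. The directions are scaled by `x
i`, so no coordinate may vanish. -/
theorem mem_sq_of_polyJet_eq_zero (hx : ∀ i, x i ≠ 0) {p : MvPolynomial (Fin d) ℝ}
    (hp : ∀ v, polyJet x v p = 0) : p ∈ vanishingIdealAt x ^ 2 := by
  obtain ⟨c, l, h⟩ := exists_linear_approximation x p
  have key : ∀ v : Fin d → ℝ, c = 0 ∧ ∑ i, l i * (x i * v i) = 0 := by
    intro v
    have h1 := polyJet_eq_zero_of_mem_sq x v h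
    have h2 : polyJet x v (MvPolynomial.C c +
        ∑ i, MvPolynomial.C (l i) * (MvPolynomial.X i - MvPolynomial.C (x i)))
        = TrivSqZeroExt.inl c + TrivSqZeroExt.inr (∑ i, l i * (x i * v i)) := by
      simp only [map_add, map_sum, map_mul, map_sub, polyJet, MvPolynomial.aeval_C,
        MvPolynomial.aeval_X, TrivSqZeroExt.algebraMap_eq_inl, TrivSqZeroExt.inr_sum]
      congr 1
      exact Finset.sum_congr rfl fun i _ => by
        ext
        · simp
        · simp [mul_comm]
    rw [map_sub, hp, zero_sub, neg_eq_zero, h2] at h1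
    have h3 := congrArg TrivSqZeroExt.fst h1
    have h4 := congrArg TrivSqZeroExt.snd h1
    simp only [TrivSqZeroExt.fst_add, TrivSqZeroExt.snd_add, TrivSqZeroExt.fst_inl,
      TrivSqZeroExt.snd_inl, TrivSqZeroExt.fst_inr, TrivSqZeroExt.snd_inr, add_zero, zero_add,
      TrivSqZeroExt.fst_zero, TrivSqZeroExt.snd_zero] at h3 h4
    exact ⟨h3, h4⟩
  have hc : c = 0 := (key 0).1
  have hl : ∀ i, l i = 0 := by
    intro i
    have h1 := (key (Pi.single i 1)).2
    rw [Finset.sum_eq_single i (fun k _ hk => by simp [hk]) (by simp)] at h1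
    simpa [hx i] using h1
  simpa [hc, hl] using h

theorem mem_maximalIdeal_sq_of_jet_eq_zero (hx : ∀ i, x i ≠ 0) {f : regularAt x}
    (hf : ∀ v, jet x v f = 0) : f ∈ IsLocalRing.maximalIdeal (regularAt x) ^ 2 := by
  obtain ⟨p, q, hq, hpq⟩ := exists_mul_algebraMap_eq x f
  have hp : p ∈ vanishingIdealAt x ^ 2 := by
    refine mem_sq_of_polyJet_eq_zero x hx fun v => ?_
    rw [← jet_algebraMap, ← hpq, map_mul, hf, zero_mul]
  have h1 := Ideal.mem_map_of_mem (algebraMap _ (regularAt x)) hp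
  rw [Ideal.map_pow, IsLocalization.AtPrime.map_eq_maximalIdeal (vanishingIdealAt x), ← hpq] at h1
  have hu : IsUnit (algebraMap _ (regularAt x) q) :=
    IsLocalization.map_units (M := (vanishingIdealAt x).primeCompl) _ ⟨q, hq⟩
  exact (Ideal.mul_unit_mem_iff_mem _ hu).1 h1

/-! ### Tangent maps of birational transformations -/

/-- The birational transformation with comorphism `g` fixes the point `x`, is regular there, and
its tangent map in logarithmic coordinates is `L`. -/
def IsTangentMap (g : WalkModel.RatFun d ≃ₐ[ℝ] WalkModel.RatFun d)
    (L : (Fin d → ℝ) → Fin d → ℝ) : Prop :=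
  ∀ f : regularAt x, ∃ hf : g f ∈ regularAt x, ∀ v, jet x v ⟨g f, hf⟩ = jet x (L v) f

theorem IsTangentMap.one : IsTangentMap x 1 id :=
  fun f => ⟨f.2, fun _ => rfl⟩

variable {x}

/-- The chain rule; comorphisms compose contravariantly, whence the order `L' ∘ L`. -/
theorem IsTangentMap.mul {g g' : WalkModel.RatFun d ≃ₐ[ℝ] WalkModel.RatFun d}
    {L L' : (Fin d → ℝ) → Fin d → ℝ} (h : IsTangentMap x g L) (h' : IsTangentMap x g' L') :
    IsTangentMap x (g * g') (L' ∘ L) := by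
  intro f
  obtain ⟨h1, h2⟩ := h' f
  obtain ⟨h3, h4⟩ := h ⟨g' f, h1⟩
  exact ⟨h3, fun v => (h4 v).trans (h2 _)⟩

variable (x) in
/-- The coordinate `x_i` as a regular function. -/
def regCoord (i : Fin d) : regularAt x :=
  algebraMap (MvPolynomial (Fin d) ℝ) _ (MvPolynomial.X i)

theorem jet_regCoord (v : Fin d → ℝ) (i : Fin d) :
    jet x v (regCoord x i) = TrivSqZeroExt.inl (x i) + TrivSqZeroExt.inr (x i * v i) := by
  simp [regCoord, jet_algebraMap, polyJet]

theorem IsTangentMap.eq_of_one (hx : ∀ i, x i ≠ 0) {L : (Fin d → ℝ) → Fin d → ℝ}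
    (h : IsTangentMap x 1 L) (v : Fin d → ℝ) : L v = v := by
  ext i
  obtain ⟨h1, h2⟩ := h (regCoord x i)
  have h3 : jet x v (regCoord x i) = jet x (L v) (regCoord x i) := h2 v
  rw [jet_regCoord, jet_regCoord] at h3
  have h4 := congrArg TrivSqZeroExt.snd h3
  simpa [hx i] using h4.symm

/-- Such a `g` restricts to the local ring at `x` and moves its elements only to second order, so
finite order makes it the identity there. That ring contains the polynomials, which determine `g`.
-/
theorem IsTangentMap.eq_one_of_isOfFinOrder (hx : ∀ i, x i ≠ 0)
    {g : WalkModel.RatFun d ≃ₐ[ℝ] WalkModel.RatFun d} (h : IsTangentMap x g id)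
    (hg : IsOfFinOrder g) : g = 1 := by
  let τ : regularAt x →ₐ[ℝ] regularAt x :=
    { toFun := fun f => ⟨g f, (h f).1⟩
      map_one' := Subtype.ext (map_one g)
      map_mul' := fun a b => Subtype.ext (map_mul g _ _)
      map_zero' := Subtype.ext (map_zero g)
      map_add' := fun a b => Subtype.ext (map_add g _ _)
      commutes' := fun r => Subtype.ext (g.commutes r) }
  have hτ : ∀ f v, jet x v (τ f) = jet x v f := fun f v => (h f).2 v
  obtain ⟨n, hn, hpow⟩ := isOfFinOrder_iff_pow_eq_one.1 hg
  have hiter : ∀ (k : ℕ) (f : regularAt x), ((τ^[k]) f : WalkModel.RatFun d) = (g ^ k) f := by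
    intro k f
    induction k with
    | zero => rfl
    | succ k ih =>
      rw [Function.iterate_succ_apply', pow_succ', AlgEquiv.mul_apply, ← ih]
      rfl
  have hid := AlgHom.eq_id_of_tangent_of_pow_eq_one τ
    (fun a => ⟨(jet x 0 a).fst, by
      rw [IsLocalRing.mem_maximalIdeal, mem_nonunits_iff, isUnit_regularAt_iff x 0, not_not,
        map_sub, AlgHom.commutes]
      simp [TrivSqZeroExt.algebraMap_eq_inl]⟩)
    (fun a _ => mem_maximalIdeal_sq_of_jet_eq_zero x hx fun v => by rw [map_sub, hτ, sub_self])
    hn.ne' (fun a => Subtype.ext (by rw [hiter, hpow]; rfl))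
  refine AlgEquiv.ext fun f => ?_
  have hreg : ∀ p : MvPolynomial (Fin d) ℝ, g (algebraMap _ _ p) = algebraMap _ _ p := fun p =>
    congrArg Subtype.val (hid (algebraMap _ (regularAt x) p))
  obtain ⟨p, q, _, rfl⟩ := IsFractionRing.div_surjective (A := MvPolynomial (Fin d) ℝ) f
  rw [map_div₀, hreg, hreg]
  rfl

/-- The images of the coordinates determine the jets of the images of polynomials; a denominator
nonzero at `x` keeps its value there, so quotients remain regular. -/
theorem IsTangentMap.of_coord {g : WalkModel.RatFun d ≃ₐ[ℝ] WalkModel.RatFun d}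
    {L : (Fin d → ℝ) → Fin d → ℝ}
    (hg : ∀ i, ∃ hi : g (WalkModel.coord i) ∈ regularAt x,
      ∀ v, jet x v ⟨g (WalkModel.coord i), hi⟩ = jet x (L v) (regCoord x i)) :
    IsTangentMap x g L := by
  choose hmem hjet using hg
  let ψ : MvPolynomial (Fin d) ℝ →ₐ[ℝ] regularAt x :=
    MvPolynomial.aeval fun i => ⟨g (WalkModel.coord i), hmem i⟩
  have h1 : ∀ p, (ψ p : WalkModel.RatFun d) = g (algebraMap _ _ p) := by
    intro p
    have : (((regularAt x).restrictScalars ℝ).val.comp ψ)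
        = (g : WalkModel.RatFun d →ₐ[ℝ] WalkModel.RatFun d).comp
          (IsScalarTower.toAlgHom ℝ (MvPolynomial (Fin d) ℝ) (WalkModel.RatFun d)) := by
      refine MvPolynomial.algHom_ext fun i => ?_
      have e : ψ (MvPolynomial.X i) = ⟨g (WalkModel.coord i), hmem i⟩ := MvPolynomial.aeval_X _ _
      exact congrArg Subtype.val e
    exact DFunLike.congr_fun this p
  have h2 : ∀ p v, jet x v (ψ p) = polyJet x (L v) p := by
    intro p v
    have : (jet x v).comp ψ = polyJet x (L v) := by
      refine MvPolynomial.algHom_ext fun i => ?_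
      rw [AlgHom.comp_apply]
      simp only [ψ, MvPolynomial.aeval_X, hjet]
      rw [regCoord, jet_algebraMap]
    exact DFunLike.congr_fun this p
  intro f
  obtain ⟨p, q, hq, hpq⟩ := exists_mul_algebraMap_eq x f
  have hu : IsUnit (ψ q) := by
    rw [isUnit_regularAt_iff x 0, h2, fst_polyJet]
    exact hq
  obtain ⟨u, hu⟩ := hu
  have hpq' : (f : WalkModel.RatFun d) * algebraMap _ _ q = algebraMap _ _ p :=
    congrArg Subtype.val hpq
  have e : g f * (ψ q : WalkModel.RatFun d) = ψ p := by
    rw [h1, h1, ← map_mul, hpq']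
  have e' : g f = ((ψ p * ↑(u⁻¹) : regularAt x) : WalkModel.RatFun d) := by
    have h3 : (ψ q : WalkModel.RatFun d) * ((↑(u⁻¹) : regularAt x) : WalkModel.RatFun d) = 1 := by
      rw [← hu]
      exact congrArg Subtype.val u.mul_inv
    rw [MulMemClass.coe_mul, ← e, mul_assoc, h3, mul_one]
  have hmem' : g f ∈ regularAt x := e' ▸ Subtype.property _
  refine ⟨hmem', fun v => ?_⟩
  have h3 : (⟨g f, hmem'⟩ : regularAt x) * ψ q = ψ p := Subtype.ext e
  have h4 := congrArg (jet x v) h3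
  have h5 := congrArg (jet x (L v)) hpq
  rw [map_mul, h2, h2] at h4
  rw [map_mul, jet_algebraMap, jet_algebraMap] at h5
  exact (isUnit_polyJet x (L v) ⟨q, hq⟩).mul_right_cancel (h4.trans h5.symm)

end



/-! ### Jets of Laurent monomials and tangent maps of the generators -/

noncomputable section

open DualNumber

/-- The dual number `c (1 + v ε)`, as a homomorphism in `(c, v)`. -/
def logDual : ℝˣ × Multiplicative ℝ →* ℝ[ε]ˣ :=
  MonoidHom.toHomUnits
    { toFun := fun z => TrivSqZeroExt.inl (z.1 : ℝ) + TrivSqZeroExt.inr (z.1 * z.2.toAdd)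
      map_one' := by ext <;> simp
      map_mul' := fun a b => by
        ext
        · simp
        · simp
          ring }

theorem coe_logDual (z : ℝˣ × Multiplicative ℝ) :
    (logDual z : ℝ[ε]) =
      TrivSqZeroExt.inl (z.1 : ℝ) + TrivSqZeroExt.inr (z.1 * z.2.toAdd) := rfl

theorem isUnit_regCoord {d : ℕ} {x : Fin d → ℝ} {i : Fin d} (hx : x i ≠ 0) :
    IsUnit (regCoord x i) := by
  rw [isUnit_regularAt_iff x 0, jet_regCoord]
  simpa using hx

/-- The Laurent monomial `x ^ s` as a unit of the ring of regular functions. -/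
def regMonomial {d : ℕ} {x : Fin d → ℝ} (hx : ∀ i, x i ≠ 0) (s : Fin d → ℤ) :
    (regularAt x)ˣ :=
  ∏ j, (isUnit_regCoord (hx j)).unit ^ s j

theorem coe_regMonomial {d : ℕ} {x : Fin d → ℝ} (hx : ∀ i, x i ≠ 0) (s : Fin d → ℤ) :
    ((regMonomial hx s : regularAt x) : WalkModel.RatFun d) = ∏ j, WalkModel.coord j ^ s j := by
  have h1 : ((regMonomial hx s : regularAt x) : WalkModel.RatFun d)
      = (Units.map (regularAt x).val.toRingHom.toMonoidHom (regMonomial hx s) :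
        WalkModel.RatFun d) := rfl
  rw [h1, regMonomial, map_prod, Units.coe_prod]
  refine Finset.prod_congr rfl fun j _ => ?_
  rw [map_zpow, Units.val_zpow_eq_zpow_val]
  rfl

theorem jet_regMonomial {d : ℕ} {x : Fin d → ℝ} (hx : ∀ i, x i ≠ 0) (s : Fin d → ℤ)
    (v : Fin d → ℝ) :
    jet x v (regMonomial hx s) = TrivSqZeroExt.inl (∏ k, x k ^ s k) +
      TrivSqZeroExt.inr ((∏ k, x k ^ s k) * ∑ i, v i * s i) := by
  have h1 : jet x v (regMonomial hx s)
      = (Units.map (jet x v).toRingHom.toMonoidHom (regMonomial hx s) : ℝ[ε]) := rfl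
  -- As `logDual` is a homomorphism, integer powers act separately on the value and on the
  -- logarithmic derivative.
  have h2 : Units.map (jet x v).toRingHom.toMonoidHom (regMonomial hx s)
      = logDual (∏ j, (Units.mk0 (x j) (hx j), Multiplicative.ofAdd (v j)) ^ s j) := by
    rw [regMonomial, map_prod, map_prod]
    refine Finset.prod_congr rfl fun j _ => ?_
    rw [map_zpow, map_zpow]
    congr 1
    ext1
    exact jet_regCoord v j
  have h3 : (∏ j, (Units.mk0 (x j) (hx j), Multiplicative.ofAdd (v j)) ^ s j :
      ℝˣ × Multiplicative ℝ).1 = ∏ j, (Units.mk0 (x j) (hx j)) ^ s j := by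
    rw [Prod.fst_prod]
    rfl
  have h4 : (∏ j, (Units.mk0 (x j) (hx j), Multiplicative.ofAdd (v j)) ^ s j :
      ℝˣ × Multiplicative ℝ).2 = ∏ j, (Multiplicative.ofAdd (v j)) ^ s j := by
    rw [Prod.snd_prod]
    rfl
  have h5 : ((∏ j, (Units.mk0 (x j) (hx j)) ^ s j : ℝˣ) : ℝ) = ∏ k, x k ^ s k := by
    rw [Units.coe_prod]
    exact Finset.prod_congr rfl fun j _ => by rw [Units.val_zpow_eq_zpow_val]; rfl
  have h6 : (∏ j, (Multiplicative.ofAdd (v j)) ^ s j).toAdd = ∑ i, v i * s i := by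
    rw [toAdd_prod]
    exact Finset.sum_congr rfl fun j _ => by
      rw [toAdd_zpow, toAdd_ofAdd, zsmul_eq_mul, mul_comm]
  rw [h1, h2, coe_logDual, h3, h4, h5, h6]

namespace WalkModel

variable {d : ℕ}

/-- The reflection in the hyperplane orthogonal to `e_i` for the Hessian of the inventory. -/
def hessReflection (M : WalkModel d) (x : Fin d → ℝ) (i : Fin d) (v : Fin d → ℝ) : Fin d → ℝ :=
  Function.update v i (v i - 2 * (∑ j, M.hess x i j * v j) / M.hess x i i)

/-- The part of degree `e` in `x_i` of the inventory, as a regular function. -/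
def regPart (M : WalkModel d) {x : Fin d → ℝ} (hx : ∀ i, x i ≠ 0) (i : Fin d) (e : ℤ) :
    regularAt x :=
  ∑ s ∈ M.steps with s i = e, algebraMap ℝ _ (M.weight s) * regMonomial hx s

theorem coe_regPart (M : WalkModel d) {x : Fin d → ℝ} (hx : ∀ i, x i ≠ 0) (i : Fin d) (e : ℤ) :
    (M.regPart hx i e : RatFun d) = coord i ^ e * M.coeff i e := by
  have h1 : (M.regPart hx i e : RatFun d)
      = ∑ s ∈ M.steps with s i = e,
        algebraMap ℝ _ (M.weight s) * ((regMonomial hx s : regularAt x) : RatFun d) :=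
    (map_sum (regularAt x).val _ _).trans (Finset.sum_congr rfl fun s _ => map_mul _ _ _)
  rw [h1, coeff, Finset.mul_sum]
  refine Finset.sum_congr rfl fun s hs => ?_
  rw [coe_regMonomial, ← Finset.mul_prod_erase _ _ (Finset.mem_univ i), (Finset.mem_filter.1 hs).2]
  ring

theorem jet_regPart (M : WalkModel d) {x : Fin d → ℝ} (hx : ∀ i, x i ≠ 0) (i : Fin d) (e : ℤ)
    (v : Fin d → ℝ) :
    jet x v (M.regPart hx i e)
      = TrivSqZeroExt.inl (∑ s ∈ M.steps with s i = e, M.termAt x s) +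
        TrivSqZeroExt.inr (∑ s ∈ M.steps with s i = e, M.termAt x s * ∑ j, v j * s j) := by
  rw [regPart, map_sum, TrivSqZeroExt.inl_sum, TrivSqZeroExt.inr_sum, ← Finset.sum_add_distrib]
  refine Finset.sum_congr rfl fun s _ => ?_
  rw [map_mul, AlgHom.commutes, jet_regMonomial, TrivSqZeroExt.algebraMap_eq_inl]
  unfold termAt
  ext
  · simp
  · simp [mul_assoc]

theorem sum_mul_step (M : WalkModel d) (i : Fin d) (f : (Fin d → ℤ) → ℝ) :
    ∑ s ∈ M.steps, f s * s i
      = ∑ s ∈ M.steps with s i = 1, f s - ∑ s ∈ M.steps with s i = -1, f s := by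
  rw [Finset.sum_filter, Finset.sum_filter, ← Finset.sum_sub_distrib]
  refine Finset.sum_congr rfl fun s hs => ?_
  rcases M.small s hs i with h | h | h <;> simp [h]

theorem sum_mul_step_sq (M : WalkModel d) (i : Fin d) (f : (Fin d → ℤ) → ℝ) :
    ∑ s ∈ M.steps, f s * (s i * s i)
      = ∑ s ∈ M.steps with s i = 1, f s + ∑ s ∈ M.steps with s i = -1, f s := by
  rw [Finset.sum_filter, Finset.sum_filter, ← Finset.sum_add_distrib]
  refine Finset.sum_congr rfl fun s hs => ?_
  rcases M.small s hs i with h | h | h <;> simp [h]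

/-- Criticality says that `x_i A_i` and `x_i⁻¹ C_i` take the same value `a`, so the point is fixed.
The new `i`-th logarithmic coordinate is `v_i + (c' - a') / a`, where `a' - c' = Q(e_i, v)` and `2a
= Q(e_i, e_i)`: this is the `Q`-reflection. -/
theorem isTangentMap_gen (M : WalkModel d) (h : M.Irreducible) {x : Fin d → ℝ}
    (hx : M.IsCriticalPoint x) (i : Fin d) :
    IsTangentMap x (M.gen h i).unop (M.hessReflection x i) := by
  obtain ⟨hpos, hcrit⟩ := M.isCriticalPoint_iff.1 hx
  have hx0 : ∀ k, x k ≠ 0 := fun k => (hpos k).ne'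
  have hgen : ∀ j, (M.gen h i).unop (coord j) = M.genTuple i j := M.genHom_coord h i
  refine IsTangentMap.of_coord fun j => ?_
  rw [hgen]
  by_cases hj : j = i
  · subst hj
    set a := ∑ s ∈ M.steps with s j = 1, M.termAt x s with ha
    set c := ∑ s ∈ M.steps with s j = -1, M.termAt x s with hc
    set a' : (Fin d → ℝ) → ℝ := fun v =>
      ∑ s ∈ M.steps with s j = 1, M.termAt x s * ∑ k, v k * s k with ha'
    set c' : (Fin d → ℝ) → ℝ := fun v =>
      ∑ s ∈ M.steps with s j = -1, M.termAt x s * ∑ k, v k * s k with hc'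
    have hac : a = c := by
      have := hcrit j
      rw [sum_mul_step] at this
      exact sub_eq_zero.1 this
    have hq : M.hess x j j = 2 * a := by
      rw [hess, sum_mul_step_sq, ← ha, ← hc, ← hac]
      ring
    have ha0 : a ≠ 0 := by
      have := M.hess_self_pos h hpos j
      rw [hq] at this
      linarith
    have hlin : ∀ v, ∑ k, M.hess x j k * v k = a' v - c' v := by
      intro v
      rw [ha', hc', ← sum_mul_step M j (fun s => M.termAt x s * ∑ k, v k * s k)]
      simp only [hess, Finset.sum_mul, Finset.mul_sum]
      rw [Finset.sum_comm]
      exact Finset.sum_congr rfl fun s _ => Finset.sum_congr rfl fun k _ => by ring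
    have hu : IsUnit (M.regPart hx0 j 1) := by
      rw [isUnit_regularAt_iff x 0, jet_regPart]
      simpa using ha0
    obtain ⟨u, hu⟩ := hu
    have hA : M.coeffA j ≠ 0 := M.coeff_ne_zero j 1 (h.exists_step j 1 (Or.inl rfl))
    have hcj := coord_ne_zero j
    -- Clearing the denominator reduces the computation to jets of products.
    have e1 : M.genTuple j j * (M.regPart hx0 j 1 : RatFun d)
        = coord j * (M.regPart hx0 j (-1) : RatFun d) := by
      rw [coe_regPart, coe_regPart]
      simp only [genTuple, Function.update_self]
      change _ * (_ * M.coeffA j) = _ * (_ * M.coeffC j)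
      rw [zpow_one, zpow_neg_one]
      field_simp
    have e2 : M.genTuple j j
        = ((regCoord x j * M.regPart hx0 j (-1) * ↑(u⁻¹) : regularAt x) : RatFun d) := by
      have h3 : (M.regPart hx0 j 1 : RatFun d) * ((↑(u⁻¹) : regularAt x) : RatFun d) = 1 := by
        rw [← hu]
        exact congrArg Subtype.val u.mul_inv
      rw [MulMemClass.coe_mul, MulMemClass.coe_mul]
      change _ = coord j * _ * _
      rw [← e1, mul_assoc, h3, mul_one]
    have hmem : M.genTuple j j ∈ regularAt x := e2 ▸ Subtype.property _
    refine ⟨hmem, fun v => ?_⟩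
    have e3 : (⟨M.genTuple j j, hmem⟩ : regularAt x) * M.regPart hx0 j 1
        = regCoord x j * M.regPart hx0 j (-1) := Subtype.ext e1
    have e4 := congrArg (jet x v) e3
    rw [map_mul, map_mul] at e4
    have hu' : IsUnit (jet x v (M.regPart hx0 j 1)) := by
      rw [← hu]
      exact u.isUnit.map _
    refine hu'.mul_right_cancel (e4.trans ?_)
    rw [jet_regCoord, jet_regCoord, jet_regPart, jet_regPart, ← ha, ← hc, ← hac]
    change _ * (_ + TrivSqZeroExt.inr (c' v)) = _ * (_ + TrivSqZeroExt.inr (a' v))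
    simp only [hessReflection, Function.update_self, hlin, hq]
    ext
    · simp
    · simp
      field_simp
      ring
  · have e : M.genTuple i j = coord j := by simp [genTuple, hj]
    refine ⟨e ▸ (regCoord x j).2, fun v => ?_⟩
    have e' : (⟨M.genTuple i j, e ▸ (regCoord x j).2⟩ : regularAt x) = regCoord x j :=
      Subtype.ext e
    rw [e', jet_regCoord, jet_regCoord]
    simp [hessReflection, hj]

end WalkModel

end



/-! ### The simple roots and the Euclidean form of the cone -/

noncomputable section

open RealInnerProductSpace

namespace WalkModel

variable {d : ℕ}

theorem covMatrix_posDef (M : WalkModel d) (h : M.Irreducible) {x : Fin d → ℝ}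
    (hx : M.IsCriticalPoint x) : (M.covMatrix x).PosDef := by
  have hpos := hx.1
  rw [Matrix.posDef_iff_dotProduct_mulVec]
  refine ⟨?_, fun v hv => ?_⟩
  · ext i j
    change star (M.covMatrix x j i) = M.covMatrix x i j
    rw [star_trivial, M.covMatrix_apply hx, M.covMatrix_apply hx, M.hess_comm, mul_comm]
  · have hs : ∀ i, 0 < √(M.hess x i i) := fun i => Real.sqrt_pos.2 (M.hess_self_pos h hpos i)
    have hv' : (fun i => v i / √(M.hess x i i)) ≠ 0 := by
      contrapose! hv
      ext i
      have := congrFun hv i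
      simpa [(hs i).ne'] using this
    refine (M.hess_quadratic_pos h hpos hv').trans_eq (Eq.symm ?_)
    simp only [dotProduct, Matrix.mulVec, star_trivial, M.covMatrix_apply hx, Finset.mul_sum]
    refine Finset.sum_congr rfl fun i _ => Finset.sum_congr rfl fun j _ => ?_
    have := (hs i).ne'
    have := (hs j).ne'
    field_simp

theorem covMatrix_self (M : WalkModel d) (h : M.Irreducible) {x : Fin d → ℝ}
    (hx : M.IsCriticalPoint x) (i : Fin d) : M.covMatrix x i i = 1 := by
  have := M.hess_self_pos h hx.1 i
  rw [M.covMatrix_apply hx, Real.mul_self_sqrt this.le, div_self this.ne']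

/-- The positive square root of the covariance matrix. -/
def sqrtCov (M : WalkModel d) (x : Fin d → ℝ) : Matrix (Fin d) (Fin d) ℝ :=
  CFC.sqrt (M.covMatrix x)

theorem sqrtCov_mul_self (M : WalkModel d) (h : M.Irreducible) {x : Fin d → ℝ}
    (hx : M.IsCriticalPoint x) : M.sqrtCov x * M.sqrtCov x = M.covMatrix x :=
  CFC.sqrt_mul_sqrt_self _ (M.covMatrix_posDef h hx).posSemidef.nonneg

theorem sqrtCov_transpose (M : WalkModel d) (x : Fin d → ℝ) :
    (M.sqrtCov x).transpose = M.sqrtCov x := by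
  have := (Matrix.nonneg_iff_posSemidef.1 (CFC.sqrt_nonneg (M.covMatrix x))).1
  simpa [Matrix.IsHermitian, Matrix.conjTranspose_eq_transpose_of_trivial, sqrtCov] using this

theorem isUnit_det_sqrtCov (M : WalkModel d) (h : M.Irreducible) {x : Fin d → ℝ}
    (hx : M.IsCriticalPoint x) : IsUnit (M.sqrtCov x).det := by
  have h1 := (Matrix.isUnit_iff_isUnit_det _).1 (M.covMatrix_posDef h hx).isUnit
  rw [← M.sqrtCov_mul_self h hx, Matrix.det_mul] at h1
  exact isUnit_of_mul_isUnit_left h1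

/-- The normal vector `Δ^{1/2} e_i` of the `i`-th side of the cone. -/
def simpleRoot (M : WalkModel d) (x : Fin d → ℝ) (i : Fin d) : EuclideanSpace ℝ (Fin d) :=
  WithLp.toLp 2 fun j => M.sqrtCov x j i

theorem inner_simpleRoot (M : WalkModel d) (h : M.Irreducible) {x : Fin d → ℝ}
    (hx : M.IsCriticalPoint x) (i j : Fin d) :
    ⟪M.simpleRoot x i, M.simpleRoot x j⟫ = M.covMatrix x i j := by
  rw [← M.sqrtCov_mul_self h hx, Matrix.mul_apply, PiLp.inner_apply]
  refine Finset.sum_congr rfl fun k _ => ?_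
  have : M.sqrtCov x i k = M.sqrtCov x k i := congrFun (congrFun (M.sqrtCov_transpose x) k) i
  rw [this]
  simp [simpleRoot, mul_comm]

theorem norm_simpleRoot (M : WalkModel d) (h : M.Irreducible) {x : Fin d → ℝ}
    (hx : M.IsCriticalPoint x) (i : Fin d) : ‖M.simpleRoot x i‖ = 1 := by
  have := M.inner_simpleRoot h hx i i
  rw [M.covMatrix_self h hx, real_inner_self_eq_norm_sq] at this
  exact (pow_eq_one_iff_of_nonneg (norm_nonneg _) two_ne_zero).1 this

theorem inner_simpleRoot_eq (M : WalkModel d) (x : Fin d → ℝ) (i : Fin d)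
    (y : EuclideanSpace ℝ (Fin d)) :
    ⟪M.simpleRoot x i, y⟫ = (M.sqrtCov x).mulVec y i := by
  rw [PiLp.inner_apply, Matrix.mulVec, dotProduct]
  refine Finset.sum_congr rfl fun k _ => ?_
  have : M.sqrtCov x i k = M.sqrtCov x k i := congrFun (congrFun (M.sqrtCov_transpose x) k) i
  rw [this]
  simp [simpleRoot, mul_comm]

/-- Since `Δ^{1/2}` is symmetric, the simple roots `Δ^{1/2} e_i` form the dual basis of the edge
vectors `Δ^{-1/2} e_j` of the cone. -/
theorem inner_simpleRoot_invSqrtMap (M : WalkModel d) (h : M.Irreducible) {x : Fin d → ℝ}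
    (hx : M.IsCriticalPoint x) (i : Fin d) (v : EuclideanSpace ℝ (Fin d)) :
    ⟪M.simpleRoot x i, M.invSqrtMap x v⟫ = v i := by
  rw [inner_simpleRoot_eq, invSqrtMap]
  change ((M.sqrtCov x).mulVec ((M.sqrtCov x)⁻¹.mulVec v)) i = v i
  rw [Matrix.mulVec_mulVec, Matrix.mul_nonsing_inv _ (M.isUnit_det_sqrtCov h hx),
    Matrix.one_mulVec]

theorem exists_invSqrtMap_eq (M : WalkModel d) (h : M.Irreducible) {x : Fin d → ℝ}
    (hx : M.IsCriticalPoint x) (y : EuclideanSpace ℝ (Fin d)) :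
    M.invSqrtMap x (WithLp.toLp 2 fun i => ⟪M.simpleRoot x i, y⟫) = y := by
  have h1 : (fun i => ⟪M.simpleRoot x i, y⟫) = (M.sqrtCov x).mulVec y :=
    funext fun i => M.inner_simpleRoot_eq x i y
  rw [h1]
  refine congrArg (WithLp.toLp 2) ?_
  change (M.sqrtCov x)⁻¹.mulVec ((M.sqrtCov x).mulVec y) = y
  rw [Matrix.mulVec_mulVec, Matrix.nonsing_inv_mul _ (M.isUnit_det_sqrtCov h hx),
    Matrix.one_mulVec]

theorem linearIndependent_simpleRoot (M : WalkModel d) (h : M.Irreducible) {x : Fin d → ℝ}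
    (hx : M.IsCriticalPoint x) : LinearIndependent ℝ (M.simpleRoot x) := by
  rw [Fintype.linearIndependent_iff]
  intro g hg i
  have h1 : ∀ v : EuclideanSpace ℝ (Fin d), ∑ j, g j * v j = 0 := by
    intro v
    have := congrArg (fun y => ⟪y, M.invSqrtMap x v⟫) hg
    simpa [sum_inner, inner_smul_left, M.inner_simpleRoot_invSqrtMap h hx] using this
  simpa using h1 (EuclideanSpace.single i 1)

theorem cone_eq (M : WalkModel d) (h : M.Irreducible) {x : Fin d → ℝ}
    (hx : M.IsCriticalPoint x) : M.cone x = {y | ∀ i, 0 ≤ ⟪M.simpleRoot x i, y⟫} := by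
  ext y
  constructor
  · rintro ⟨v, hv, rfl⟩ i
    rw [M.inner_simpleRoot_invSqrtMap h hx]
    exact hv i
  · intro hy
    exact ⟨_, fun i => hy i, M.exists_invSqrtMap_eq h hx y⟩

theorem side_eq (M : WalkModel d) (h : M.Irreducible) {x : Fin d → ℝ}
    (hx : M.IsCriticalPoint x) (i : Fin d) : M.side x i = (ℝ ∙ M.simpleRoot x i)ᗮ := by
  have hspan : ∀ v : EuclideanSpace ℝ (Fin d),
      v ∈ Submodule.span ℝ {v | ∃ j, j ≠ i ∧ v = EuclideanSpace.single j (1 : ℝ)} ↔ v i = 0 := by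
    intro v
    constructor
    · intro hv
      induction hv using Submodule.span_induction with
      | mem v hv =>
        obtain ⟨j, hj, rfl⟩ := hv
        simp [hj.symm]
      | zero => rfl
      | add a b _ _ ha hb => simp [ha, hb]
      | smul c a _ ha => simp [ha]
    · intro hv
      have e : v = ∑ j, v j • EuclideanSpace.single j (1 : ℝ) := by
        ext k
        simp [Pi.single_apply]
      rw [e]
      refine sum_mem fun j _ => ?_
      by_cases hj : j = i
      · rw [hj, hv, zero_smul]
        exact zero_mem _
      · exact Submodule.smul_mem _ _ (Submodule.subset_span ⟨j, hj, rfl⟩)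
  ext y
  rw [Submodule.mem_orthogonal_singleton_iff_inner_right, side, Submodule.mem_map]
  constructor
  · rintro ⟨v, hv, rfl⟩
    rw [M.inner_simpleRoot_invSqrtMap h hx]
    exact (hspan v).1 hv
  · intro hy
    exact ⟨_, (hspan _).2 hy, M.exists_invSqrtMap_eq h hx y⟩

end WalkModel

/-- The orthogonal reflection that maps `a` to `-a`. -/
def rootReflection {E : Type*} [NormedAddCommGroup E] [InnerProductSpace ℝ E] (a : E) :
    E ≃ₗᵢ[ℝ] E :=
  (ℝ ∙ a)ᗮ.reflection

theorem rootReflection_apply {E : Type*} [NormedAddCommGroup E] [InnerProductSpace ℝ E] {a : E}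
    (ha : ‖a‖ = 1) (y : E) : rootReflection a y = y - (2 * ⟪a, y⟫) • a := by
  rw [rootReflection, Submodule.reflection_orthogonal_apply, Submodule.reflection_singleton_apply,
    ha]
  simp [two_smul, two_mul, add_smul]

theorem rootReflection_mul_self {E : Type*} [NormedAddCommGroup E] [InnerProductSpace ℝ E]
    (a : E) : rootReflection a * rootReflection a = 1 :=
  Submodule.reflection_mul_reflection _

namespace WalkModel

variable {d : ℕ}

theorem reflectionGroup_eq (M : WalkModel d) (h : M.Irreducible) {x : Fin d → ℝ}
    (hx : M.IsCriticalPoint x) : M.reflectionGroup x =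
      Subgroup.closure (Set.range fun i => rootReflection (M.simpleRoot x i)) := by
  unfold reflectionGroup rootReflection
  simp only [M.side_eq h hx]

/-- The linear isomorphism from logarithmic coordinates that sends the Hessian of the inventory to
the Euclidean scalar product. -/
def logToEuclidean (M : WalkModel d) (x v : Fin d → ℝ) : EuclideanSpace ℝ (Fin d) :=
  ∑ i, (√(M.hess x i i) * v i) • M.simpleRoot x i

theorem logToEuclidean_injective (M : WalkModel d) (h : M.Irreducible) {x : Fin d → ℝ}
    (hx : M.IsCriticalPoint x) : Function.Injective (M.logToEuclidean x) := by
  intro v w hvw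
  unfold logToEuclidean at hvw
  rw [← sub_eq_zero, ← Finset.sum_sub_distrib] at hvw
  simp only [← sub_smul, ← mul_sub] at hvw
  ext i
  have h1 := Fintype.linearIndependent_iff.1 (M.linearIndependent_simpleRoot h hx) _ hvw i
  have h2 := (Real.sqrt_pos.2 (M.hess_self_pos h hx.1 i)).ne'
  rcases mul_eq_zero.1 h1 with h3 | h3
  · exact absurd h3 h2
  · exact sub_eq_zero.1 h3

theorem logToEuclidean_surjective (M : WalkModel d) (h : M.Irreducible) {x : Fin d → ℝ}
    (hx : M.IsCriticalPoint x) : Function.Surjective (M.logToEuclidean x) := by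
  intro y
  have hspan := (M.linearIndependent_simpleRoot h hx).span_eq_top_of_card_eq_finrank' (by simp)
  have hy : y ∈ Submodule.span ℝ (Set.range (M.simpleRoot x)) := by rw [hspan]; trivial
  obtain ⟨c, rfl⟩ := (Submodule.mem_span_range_iff_exists_fun ℝ).1 hy
  refine ⟨fun i => c i / √(M.hess x i i), Finset.sum_congr rfl fun i _ => ?_⟩
  rw [mul_div_cancel₀ _ (Real.sqrt_pos.2 (M.hess_self_pos h hx.1 i)).ne']

/-- The isometry sends `e_i` to a positive multiple of `α_i`, so it conjugates the `Q`-reflection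
into the Euclidean one. -/
theorem logToEuclidean_hessReflection (M : WalkModel d) (h : M.Irreducible) {x : Fin d → ℝ}
    (hx : M.IsCriticalPoint x) (i : Fin d) (v : Fin d → ℝ) :
    M.logToEuclidean x (M.hessReflection x i v)
      = rootReflection (M.simpleRoot x i) (M.logToEuclidean x v) := by
  have hs : ∀ i, 0 < √(M.hess x i i) := fun i => Real.sqrt_pos.2 (M.hess_self_pos h hx.1 i)
  rw [rootReflection_apply (M.norm_simpleRoot h hx i)]
  have h1 : ⟪M.simpleRoot x i, M.logToEuclidean x v⟫
      = (∑ j, M.hess x i j * v j) / √(M.hess x i i) := by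
    simp only [logToEuclidean, inner_sum, inner_smul_right, M.inner_simpleRoot h hx,
      M.covMatrix_apply hx, Finset.sum_div]
    refine Finset.sum_congr rfl fun j _ => ?_
    have := (hs i).ne'
    have := (hs j).ne'
    field_simp
  have h2 : M.hessReflection x i v
      = v - Pi.single i (2 * (∑ j, M.hess x i j * v j) / M.hess x i i) := by
    ext k
    by_cases hk : k = i
    · subst hk
      simp [hessReflection]
    · simp [hessReflection, hk]
  rw [h1, h2]
  simp only [logToEuclidean, Pi.sub_apply, mul_sub, sub_smul, Finset.sum_sub_distrib]
  congr 1
  rw [Finset.sum_eq_single i (fun k _ hk => by simp [hk]) (by simp), Pi.single_eq_same]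
  congr 1
  have h3 := Real.sq_sqrt (M.hess_self_pos h hx.1 i).le
  have h4 := (hs i).ne'
  have h5 := (M.hess_self_pos h hx.1 i).ne'
  field_simp
  rw [h3, mul_comm]

/-! ### Comparison of relations in `G` and in `H` -/

/-- The values in the group of the model of formal words in the generators. -/
def genWord (M : WalkModel d) (h : M.Irreducible) : FreeGroup (Fin d) →* Birational d :=
  FreeGroup.lift (M.gen h)

/-- The values in the reflection group of formal words in the generators. -/
def reflWord (M : WalkModel d) (x : Fin d → ℝ) :
    FreeGroup (Fin d) →* (EuclideanSpace ℝ (Fin d) ≃ₗᵢ[ℝ] EuclideanSpace ℝ (Fin d)) :=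
  FreeGroup.lift fun i => rootReflection (M.simpleRoot x i)

theorem gen_mul_self (M : WalkModel d) (h : M.Irreducible) (i : Fin d) :
    M.gen h i * M.gen h i = 1 := by
  refine MulOpposite.unop_injective (AlgEquiv.ext fun f => ?_)
  exact DFunLike.congr_fun (M.genHom_comp_self h i) f

/-- The chain rule along a word. The reversal by comorphisms and the one by the opposite group
cancel, so both evaluations read the word in the same order. -/
theorem exists_isTangentMap_genWord (M : WalkModel d) (h : M.Irreducible) {x : Fin d → ℝ}
    (hx : M.IsCriticalPoint x) (w : FreeGroup (Fin d)) :
    ∃ L, IsTangentMap x (M.genWord h w).unop L ∧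
      ∀ v, M.logToEuclidean x (L v) = M.reflWord x w (M.logToEuclidean x v) := by
  induction w using FreeGroup.induction_on with
  | C1 => exact ⟨id, by rw [map_one]; exact IsTangentMap.one x, fun v => by simp⟩
  | of i =>
    refine ⟨M.hessReflection x i, ?_, fun v => ?_⟩
    · rw [genWord, FreeGroup.lift_apply_of]
      exact M.isTangentMap_gen h hx i
    · rw [reflWord, FreeGroup.lift_apply_of]
      exact M.logToEuclidean_hessReflection h hx i v
  | inv_of i ih =>
    have e1 : M.genWord h (FreeGroup.of i)⁻¹ = M.genWord h (FreeGroup.of i) := by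
      rw [map_inv, inv_eq_iff_mul_eq_one, genWord, FreeGroup.lift_apply_of]
      exact M.gen_mul_self h i
    have e2 : M.reflWord x (FreeGroup.of i)⁻¹ = M.reflWord x (FreeGroup.of i) := by
      rw [map_inv, inv_eq_iff_mul_eq_one, reflWord, FreeGroup.lift_apply_of]
      exact rootReflection_mul_self _
    rw [e1, e2]
    exact ih
  | mul a b iha ihb =>
    obtain ⟨L, h1, h2⟩ := iha
    obtain ⟨L', h3, h4⟩ := ihb
    refine ⟨L ∘ L', ?_, fun v => ?_⟩
    · rw [map_mul, MulOpposite.unop_mul]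
      exact h3.mul h1
    · rw [map_mul, Function.comp_apply, h2, h4]
      rfl

theorem reflWord_eq_one_of_genWord_eq_one (M : WalkModel d) (h : M.Irreducible) {x : Fin d → ℝ}
    (hx : M.IsCriticalPoint x) {w : FreeGroup (Fin d)} (hw : M.genWord h w = 1) :
    M.reflWord x w = 1 := by
  obtain ⟨L, h1, h2⟩ := M.exists_isTangentMap_genWord h hx w
  rw [hw] at h1
  refine LinearIsometryEquiv.ext fun y => ?_
  obtain ⟨v, rfl⟩ := M.logToEuclidean_surjective h hx y
  rw [← h2, IsTangentMap.eq_of_one (fun i => (hx.1 i).ne') h1]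
  rfl

/-- A word trivial in `H` is tangent to the identity; finite order is what then forces it to be the
identity. -/
theorem genWord_eq_one_of_reflWord_eq_one (M : WalkModel d) (h : M.Irreducible) {x : Fin d → ℝ}
    (hx : M.IsCriticalPoint x) {w : FreeGroup (Fin d)} (hw : M.reflWord x w = 1)
    (hfin : IsOfFinOrder (M.genWord h w)) : M.genWord h w = 1 := by
  obtain ⟨L, h1, h2⟩ := M.exists_isTangentMap_genWord h hx w
  have hL : L = id := by
    ext1 v
    refine M.logToEuclidean_injective h hx ?_
    rw [h2, hw]
    rfl
  rw [hL] at h1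
  refine MulOpposite.unop_injective (h1.eq_one_of_isOfFinOrder (fun i => (hx.1 i).ne') ?_)
  obtain ⟨n, hn, hpow⟩ := isOfFinOrder_iff_pow_eq_one.1 hfin
  exact isOfFinOrder_iff_pow_eq_one.2 ⟨n, hn, by rw [← MulOpposite.unop_pow, hpow]; rfl⟩

end WalkModel

end



/-! ### Orthogonal reflections and their products -/

noncomputable section

open RealInnerProductSpace

section Reflections

variable {E : Type*} [NormedAddCommGroup E] [InnerProductSpace ℝ E]

theorem rootReflection_map (g : E ≃ₗᵢ[ℝ] E) (a : E) :
    rootReflection (g a) = g * rootReflection a * g⁻¹ := by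
  refine LinearIsometryEquiv.ext fun y => ?_
  have h1 : ⟪g a, y⟫ = ⟪a, g⁻¹ y⟫ := by
    rw [← g.inner_map_map a (g⁻¹ y)]
    congr 1
    exact (g.apply_symm_apply y).symm
  have h2 : g (g⁻¹ y) = y := g.apply_symm_apply y
  change rootReflection (g a) y = g (rootReflection a (g⁻¹ y))
  simp only [rootReflection, Submodule.reflection_orthogonal_apply,
    Submodule.reflection_singleton_apply, h1, g.norm_map, map_neg, map_sub, map_smul, h2,
    map_nsmul]

theorem rootReflection_neg (a : E) : rootReflection (-a) = rootReflection a := by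
  unfold rootReflection
  congr 2
  rw [← neg_one_smul ℝ a]
  exact Submodule.span_singleton_smul_eq (by simp) a

theorem rootReflection_self (a : E) : rootReflection a a = -a :=
  Submodule.reflection_orthogonalComplement_singleton_eq_neg a

/-! ### Products of two reflections -/

/-- The roots of a dihedral group with simple roots `a`, `b` at angle `π - θ`. -/
def dihedralRoot (a b : E) (θ : ℝ) (n : ℤ) : E :=
  (Real.sin ((n + 1) * θ) / Real.sin θ) • a + (Real.sin (n * θ) / Real.sin θ) • b

theorem sin_int_recurrence (θ : ℝ) (n : ℤ) :
    2 * Real.cos θ * Real.sin ((n + 1) * θ) = Real.sin ((n + 2) * θ) + Real.sin (n * θ) := by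
  have h1 : (n + 2) * θ = (n + 1) * θ + θ := by ring
  have h2 : n * θ = (n + 1) * θ - θ := by ring
  rw [h1, h2, Real.sin_add, Real.sin_sub]
  ring

variable {a b : E} {θ : ℝ} (ha : ‖a‖ = 1) (hb : ‖b‖ = 1) (hab : ⟪a, b⟫ = -Real.cos θ)
include ha hab

/-- The Chebyshev recurrence makes both reflections act on the indices up to sign: `n ↦ -n` for `a`
and `n ↦ -n - 2` for `b`. Their product then shifts the index by 2. -/
theorem rootReflection_dihedralRoot_left (n : ℤ) :
    rootReflection a (dihedralRoot a b θ n) = -dihedralRoot a b θ (-n) := by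
  rw [rootReflection_apply ha, dihedralRoot, dihedralRoot]
  simp only [inner_add_right, inner_smul_right, hab, real_inner_self_eq_norm_sq, ha]
  have h1 : Real.sin (((-n : ℤ) + 1) * θ) = Real.sin ((n + 1) * θ) -
      2 * Real.cos θ * Real.sin (n * θ) := by
    have h2 := sin_int_recurrence θ (n - 1)
    have h3 : ((-n : ℤ) + 1) * θ = -(((n - 1 : ℤ) : ℝ) * θ) := by push_cast; ring
    have h4 : (((n - 1 : ℤ) : ℝ) + 1) * θ = n * θ := by push_cast; ring
    have h5 : (((n - 1 : ℤ) : ℝ) + 2) * θ = (n + 1) * θ := by push_cast; ring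
    rw [h4, h5] at h2
    rw [h3, Real.sin_neg]
    linarith
  have h2 : Real.sin ((-n : ℤ) * θ) = -Real.sin (n * θ) := by
    rw [← Real.sin_neg]
    congr 1
    push_cast
    ring
  rw [h1, h2]
  module

include hb

omit ha in
theorem rootReflection_dihedralRoot_right (n : ℤ) :
    rootReflection b (dihedralRoot a b θ n) = -dihedralRoot a b θ (-n - 2) := by
  rw [rootReflection_apply hb, dihedralRoot, dihedralRoot]
  have hba : ⟪b, a⟫ = -Real.cos θ := by rw [real_inner_comm, hab]
  simp only [inner_add_right, inner_smul_right, hba, real_inner_self_eq_norm_sq, hb]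
  have h1 : Real.sin (((-n - 2 : ℤ) + 1) * θ) = -Real.sin ((n + 1) * θ) := by
    rw [← Real.sin_neg]
    congr 1
    push_cast
    ring
  have h2 : Real.sin ((-n - 2 : ℤ) * θ) = Real.sin (n * θ) -
      2 * Real.cos θ * Real.sin ((n + 1) * θ) := by
    have h3 : ((-n - 2 : ℤ) : ℝ) * θ = -((n + 2) * θ) := by push_cast; ring
    rw [h3, Real.sin_neg, sin_int_recurrence]
    ring
  rw [h1, h2]
  module

theorem rootReflection_mul_dihedralRoot (n : ℤ) :
    (rootReflection a * rootReflection b) (dihedralRoot a b θ n) = dihedralRoot a b θ (n + 2) := by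
  change rootReflection a (rootReflection b (dihedralRoot a b θ n)) = _
  rw [rootReflection_dihedralRoot_right hb hab, map_neg,
    rootReflection_dihedralRoot_left ha hab, neg_neg]
  congr 1
  ring

theorem rootReflection_mul_pow_dihedralRoot (k : ℕ) (n : ℤ) :
    ((rootReflection a * rootReflection b) ^ k) (dihedralRoot a b θ n)
      = dihedralRoot a b θ (n + 2 * k) := by
  induction k with
  | zero => simp
  | succ k ih =>
    rw [pow_succ']
    change (rootReflection a * rootReflection b)
      (((rootReflection a * rootReflection b) ^ k) (dihedralRoot a b θ n)) = _
    rw [ih, rootReflection_mul_dihedralRoot ha hb hab]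
    congr 1
    push_cast
    ring

/-- The product rotates the plane of `a` and `b` by `2θ` and fixes its orthogonal complement, so its
`k`-th power is trivial exactly when `kθ` is a multiple of `π`. -/
theorem rootReflection_mul_pow_eq_one_iff [FiniteDimensional ℝ E] (hθ : Real.sin θ ≠ 0)
    (hlin : ∀ p q : ℝ, p • a + q • b = 0 → p = 0 ∧ q = 0) (k : ℕ) :
    (rootReflection a * rootReflection b) ^ k = 1 ↔ Real.sin (k * θ) = 0 := by
  have h0 : dihedralRoot a b θ 0 = a := by simp [dihedralRoot, hθ]
  have h1 : dihedralRoot a b θ (-1) = -b := by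
    simp [dihedralRoot, hθ]
  have hodd : Real.sin ((2 * k + 1) * θ)
      = Real.sin (2 * (k * θ)) * Real.cos θ + Real.cos (2 * (k * θ)) * Real.sin θ := by
    rw [← Real.sin_add]
    congr 1
    ring
  constructor
  · intro hk
    have h2 := rootReflection_mul_pow_dihedralRoot ha hb hab k 0
    have e1 : (((0 + 2 * k : ℤ) : ℝ) + 1) * θ = (2 * k + 1) * θ := by push_cast; ring
    have e2 : ((0 + 2 * k : ℤ) : ℝ) * θ = 2 * (k * θ) := by push_cast; ring
    rw [hk, h0, dihedralRoot, e1, e2] at h2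
    have h3 : (Real.sin ((2 * k + 1) * θ) / Real.sin θ - 1) • a
        + (Real.sin (2 * (k * θ)) / Real.sin θ) • b = 0 := by
      rw [sub_smul, one_smul, sub_add_eq_add_sub, ← h2]
      exact sub_self a
    obtain ⟨h4, h5⟩ := hlin _ _ h3
    have h6 : Real.sin (2 * (k * θ)) = 0 := by
      rcases div_eq_zero_iff.1 h5 with h | h
      · exact h
      · exact absurd h hθ
    rw [hodd, h6, zero_mul, zero_add, mul_div_cancel_right₀ _ hθ, Real.cos_two_mul,
      Real.cos_sq'] at h4
    have h7 : Real.sin (k * θ) ^ 2 = 0 := by linarith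
    exact pow_eq_zero_iff two_ne_zero |>.1 h7
  · intro hk
    have hc : Real.cos (2 * (k * θ)) = 1 := by
      rw [Real.cos_two_mul, Real.cos_sq', hk]
      ring
    have hs : Real.sin (2 * (k * θ)) = 0 := by
      rw [Real.sin_two_mul, hk]
      ring
    have ea : ((rootReflection a * rootReflection b) ^ k) a = a := by
      have h2 := rootReflection_mul_pow_dihedralRoot ha hb hab k 0
      rw [h0] at h2
      rw [h2, dihedralRoot]
      have e1 : (((0 + 2 * k : ℤ) : ℝ) + 1) * θ = (2 * k + 1) * θ := by push_cast; ring
      have e2 : ((0 + 2 * k : ℤ) : ℝ) * θ = 2 * (k * θ) := by push_cast; ring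
      rw [e1, e2, hodd, hs, hc]
      simp [hθ]
    have eb : ((rootReflection a * rootReflection b) ^ k) b = b := by
      have h2 := rootReflection_mul_pow_dihedralRoot ha hb hab k (-1)
      rw [h1, map_neg, neg_eq_iff_eq_neg] at h2
      rw [h2, dihedralRoot]
      have e1 : (((-1 + 2 * k : ℤ) : ℝ) + 1) * θ = 2 * (k * θ) := by push_cast; ring
      have e2 : ((-1 + 2 * k : ℤ) : ℝ) * θ = 2 * (k * θ) - θ := by push_cast; ring
      rw [e1, e2, Real.sin_sub, hs, hc]
      simp [hθ]
    refine LinearIsometryEquiv.ext fun y => ?_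
    obtain ⟨u, hu, v, hv, rfl⟩ :=
      (Submodule.span ℝ {a, b}).exists_add_mem_mem_orthogonal y
    obtain ⟨p, q, rfl⟩ := Submodule.mem_span_pair.1 hu
    have hva : ⟪a, v⟫ = 0 := hv a (Submodule.subset_span (by simp))
    have hvb : ⟪b, v⟫ = 0 := hv b (Submodule.subset_span (by simp))
    have ev1 : (rootReflection a * rootReflection b) v = v := by
      change rootReflection a (rootReflection b v) = v
      rw [rootReflection_apply hb, hvb, mul_zero, zero_smul, sub_zero, rootReflection_apply ha,
        hva, mul_zero, zero_smul, sub_zero]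
    have ev : ((rootReflection a * rootReflection b) ^ k) v = v := by
      clear hk hc hs ea eb hodd
      induction k with
      | zero => rfl
      | succ k ih =>
        rw [pow_succ]
        change ((rootReflection a * rootReflection b) ^ k)
          ((rootReflection a * rootReflection b) v) = v
        rw [ev1, ih]
    rw [map_add, map_add, map_smul, map_smul, ea, eb, ev]
    rfl

theorem orderOf_rootReflection_mul [FiniteDimensional ℝ E] {k : ℕ} (hk : 2 ≤ k)
    (hθ : θ = Real.pi / k) (hlin : ∀ p q : ℝ, p • a + q • b = 0 → p = 0 ∧ q = 0) :
    orderOf (rootReflection a * rootReflection b) = k := by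
  have hk0 : (0 : ℝ) < k := by exact_mod_cast (by omega : 0 < k)
  have hpi := Real.pi_pos
  have hsin : Real.sin θ ≠ 0 := by
    refine (Real.sin_pos_of_pos_of_lt_pi (by rw [hθ]; positivity) ?_).ne'
    rw [hθ, div_lt_iff₀ hk0]
    have : (2 : ℝ) ≤ k := by exact_mod_cast hk
    nlinarith
  have key := rootReflection_mul_pow_eq_one_iff ha hb hab hsin hlin
  refine Nat.dvd_antisymm ?_ ?_
  · rw [orderOf_dvd_iff_pow_eq_one, key, hθ, mul_div_cancel₀ _ hk0.ne', Real.sin_pi]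
  · have h1 := (key _).1 (pow_orderOf_eq_one (rootReflection a * rootReflection b))
    obtain ⟨n, hn⟩ := Real.sin_eq_zero_iff.1 h1
    rw [hθ] at hn
    field_simp at hn
    have h2 : n * (k : ℤ) = orderOf (rootReflection a * rootReflection b) := by exact_mod_cast hn
    exact Int.natCast_dvd_natCast.1 ⟨n, by rw [← h2, mul_comm]⟩

end Reflections

/-! ### Words in reflections that preserve a positive system -/

section Deletion

variable {E : Type*} [NormedAddCommGroup E] [InnerProductSpace ℝ E] {Γ ι : Type*} [Group Γ]
  {s : ι → Γ} {ρ : Γ →* (E ≃ₗᵢ[ℝ] E)} {α : ι → E} {P : Set E} {t : E → Γ}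
  (hs : ∀ i, s i * s i = 1) (hα : ∀ i, α i ∈ P) (hneg : ∀ i, ρ (s i) (α i) = -α i)
  (htα : ∀ i, t (α i) = s i)
  (hstep : ∀ β ∈ P, ∀ i, β = α i ∨ (ρ (s i) β ∈ P ∧ t (ρ (s i) β) = s i * t β * (s i)⁻¹))

include hs hα hneg htα hstep

omit hs in
-- The only positive root made negative by `s i` is `α i`, so images of roots are roots up to sign.
-- The labels `t` live in `Γ` and are not read off from `ρ`, so the argument can serve to prove that
-- `ρ` is faithful.
theorem word_apply_root (L : List ι) {β : E} (hβ : β ∈ P) :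
    (ρ (L.map s).prod β ∈ P ∧
      t (ρ (L.map s).prod β) = (L.map s).prod * t β * (L.map s).prod⁻¹) ∨
    (-ρ (L.map s).prod β ∈ P ∧
      t (-ρ (L.map s).prod β) = (L.map s).prod * t β * (L.map s).prod⁻¹) := by
  induction L with
  | nil => exact Or.inl (by simpa using hβ)
  | cons k L ih =>
    have e : ρ ((k :: L).map s).prod β = ρ (s k) (ρ (L.map s).prod β) := by
      rw [List.map_cons, List.prod_cons, map_mul]
      rfl
    have e' : ∀ g : Γ, ((k :: L).map s).prod * g * ((k :: L).map s).prod⁻¹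
        = s k * ((L.map s).prod * g * (L.map s).prod⁻¹) * (s k)⁻¹ := fun g => by
      rw [List.map_cons, List.prod_cons]
      group
    have hinv : s k * s k * (s k)⁻¹ = s k := by group
    rw [e, e']
    rcases ih with ⟨h1, h2⟩ | ⟨h1, h2⟩
    · rw [← h2]
      rcases hstep _ h1 k with h3 | h3
      · right
        rw [h3, hneg, neg_neg, htα, hinv]
        exact ⟨hα k, rfl⟩
      · exact Or.inl h3
    · rw [← h2]
      generalize ρ (L.map s).prod β = y at h1 ⊢
      have hy : -ρ (s k) y = ρ (s k) (-y) := (map_neg _ _).symm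
      rcases hstep _ h1 k with h3 | h3
      · left
        have hy' : ρ (s k) y = α k := by
          rw [← neg_neg (ρ (s k) y), hy, h3, hneg, neg_neg]
        rw [h3, hy', htα, hinv]
        exact ⟨hα k, rfl⟩
      · right
        rw [hy]
        exact h3

omit hs in
-- At some letter `j` the image of `β` passes from positive to negative. Just before, it is `α j`,
-- whose label is `s j`; but that label is also the conjugate of `t β` by the letters already
-- applied.
theorem exists_split_of_neg_mem (hP : ∀ β ∈ P, -β ∉ P) (L : List ι) {β : E} (hβ : β ∈ P)
    (hL : -ρ (L.map s).prod β ∈ P) :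
    ∃ L₁ j L₂, L = L₁ ++ j :: L₂ ∧ s j = (L₂.map s).prod * t β * (L₂.map s).prod⁻¹ := by
  induction L with
  | nil => exact absurd (by simpa using hL) (hP β hβ)
  | cons k L ih =>
    have e : ρ ((k :: L).map s).prod β = ρ (s k) (ρ (L.map s).prod β) := by
      rw [List.map_cons, List.prod_cons, map_mul]
      rfl
    rw [e] at hL
    rcases word_apply_root hα hneg htα hstep L hβ with ⟨h1, h2⟩ | ⟨h1, h2⟩
    · rcases hstep _ h1 k with h3 | h3
      · exact ⟨[], k, L, rfl, by rw [← h2, h3, htα]⟩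
      · exact absurd hL (hP _ h3.1)
    · obtain ⟨L₁, j, L₂, rfl, h4⟩ := ih h1
      exact ⟨k :: L₁, j, L₂, rfl, h4⟩

/-- Deletion: if `L` ends in `i`, the rest of the word makes `α i` negative, so it splits at a `j`
with `s j` conjugate to `s i` by `L₂`. Then `L₁ s_j L₂ s_i = L₁ L₂`, and the word loses two letters.
-/
theorem word_eq_one_of_preserves_positive (hP : ∀ β ∈ P, -β ∉ P) (L : List ι)
    (hL : ∀ i, ρ (L.map s).prod (α i) ∈ P) : (L.map s).prod = 1 := by
  induction hn : L.length using Nat.strong_induction_on generalizing L with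
  | _ n ih =>
    rcases L.eq_nil_or_concat with rfl | ⟨L', i, rfl⟩
    · rfl
    · have h1 : -ρ (L'.map s).prod (α i) ∈ P := by
        have h2 := hL i
        rw [List.map_concat, List.concat_eq_append, List.prod_append, List.prod_singleton,
          map_mul] at h2
        change ρ (L'.map s).prod (ρ (s i) (α i)) ∈ P at h2
        rwa [hneg, map_neg] at h2
      obtain ⟨L₁, j, L₂, rfl, h2⟩ := exists_split_of_neg_mem hα hneg htα hstep hP L' (hα i) h1
      have h3 : (((L₁ ++ j :: L₂).concat i).map s).prod = ((L₁ ++ L₂).map s).prod := by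
        simp only [List.concat_eq_append, List.prod_append, List.map_append, List.map_cons,
          List.prod_cons, List.map_nil, List.prod_nil, mul_one]
        rw [h2, htα]
        have := hs i
        calc _ = (L₁.map s).prod * ((L₂.map s).prod * (s i * s i)) := by group
          _ = _ := by rw [this, mul_one]
      rw [h3]
      refine ih (L₁ ++ L₂).length ?_ _ (fun i => ?_) rfl
      · rw [← hn]
        simp
      · rw [← h3]
        exact hL i

end Deletion

theorem Subgroup.exists_list_map_of_mem_closure_range {Γ ι : Type*} [Group Γ] {s : ι → Γ}
    (hs : ∀ i, s i * s i = 1) {g : Γ} (hg : g ∈ Subgroup.closure (Set.range s)) :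
    ∃ L : List ι, (L.map s).prod = g := by
  induction hg using Subgroup.closure_induction with
  | mem x hx =>
    obtain ⟨i, rfl⟩ := hx
    exact ⟨[i], by simp⟩
  | one => exact ⟨[], rfl⟩
  | mul x y _ _ hx hy =>
    obtain ⟨L, rfl⟩ := hx
    obtain ⟨L', rfl⟩ := hy
    exact ⟨L ++ L', by simp⟩
  | inv x _ hx =>
    obtain ⟨L, rfl⟩ := hx
    refine ⟨L.reverse, ?_⟩
    rw [List.prod_inv_reverse, List.map_reverse, List.map_map]
    congr 2
    refine List.map_congr_left fun i _ => ?_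
    exact (inv_eq_of_mul_eq_one_left (hs i)).symm

end



noncomputable section

open RealInnerProductSpace

/-! ### Simplicial cones as Weyl chambers -/

section Chamber

variable {d : ℕ} {α : Fin d → EuclideanSpace ℝ (Fin d)}
  (hdual : ∀ c : Fin d → ℝ, ∃ y, ∀ i, ⟪α i, y⟫ = c i)
include hdual

theorem closure_open_cone :
    closure {y | ∀ i, 0 < ⟪α i, y⟫} = {y | ∀ i, 0 ≤ ⟪α i, y⟫} := by
  refine Set.Subset.antisymm ?_ fun y hy => ?_
  · refine closure_minimal (fun y hy i => (hy i).le) ?_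
    simp only [Set.ofPred_forall]
    exact isClosed_iInter fun i => isClosed_le continuous_const (by fun_prop)
  · obtain ⟨z, hz⟩ := hdual 1
    have h1 : Filter.Tendsto (fun ε : ℝ => y + ε • z) (nhdsWithin 0 (Set.Ioi 0)) (nhds y) := by
      have : Continuous fun ε : ℝ => y + ε • z := by fun_prop
      simpa using (this.tendsto 0).mono_left nhdsWithin_le_nhds
    refine mem_closure_of_tendsto h1 ?_
    filter_upwards [self_mem_nhdsWithin] with ε hε i
    rw [inner_add_right, inner_smul_right, hz]
    have := hy i
    have hε' : (0 : ℝ) < ε := hε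
    simp only [Pi.one_apply, mul_one]
    linarith

/-- The open cone is convex and avoids the mirrors, so it lies in one component; a path out of it
would cross a wall, which is itself a mirror. -/
theorem isWeylChamber_of_forall_mirror
    {W : Subgroup (EuclideanSpace ℝ (Fin d) ≃ₗᵢ[ℝ] EuclideanSpace ℝ (Fin d))}
    (hα : ∀ i, rootReflection (α i) ∈ W)
    (hW : ∀ u, u ≠ 0 → rootReflection u ∈ W → ∀ y, (∀ i, 0 < ⟪α i, y⟫) → ⟪u, y⟫ ≠ 0) :
    IsWeylChamber W {y | ∀ i, 0 ≤ ⟪α i, y⟫} := by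
  obtain ⟨z, hz⟩ := hdual 1
  have hz0 : ∀ i, 0 < ⟪α i, z⟫ := fun i => by rw [hz]; exact one_pos
  have hsub : {y | ∀ i, 0 < ⟪α i, y⟫} ⊆ (mirrorUnion W)ᶜ := by
    rintro y hy ⟨u, hu, huW, hyu⟩
    exact hW u hu huW y hy (Submodule.mem_orthogonal_singleton_iff_inner_right.1 hyu)
  refine ⟨z, hsub hz0, ?_⟩
  rw [← closure_open_cone hdual]
  congr 1
  refine Set.Subset.antisymm ?_ fun y hy i => ?_
  · refine IsPreconnected.subset_connectedComponentIn ?_ hz0 hsub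
    refine Convex.isPreconnected fun a ha b hb p q hp hq hpq i => ?_
    rw [inner_add_right, inner_smul_right, inner_smul_right]
    have h1 := ha i
    have h2 := hb i
    rcases hp.eq_or_lt with rfl | hp'
    · rw [zero_add] at hpq
      subst hpq
      linarith
    · have := mul_pos hp' h1
      have := mul_nonneg hq h2.le
      linarith
  · have hC : ∀ w ∈ connectedComponentIn (mirrorUnion W)ᶜ z, ⟪α i, w⟫ ≠ 0 := by
      intro w hw h0
      refine connectedComponentIn_subset _ _ hw ⟨α i, ?_, hα i,
        Submodule.mem_orthogonal_singleton_iff_inner_right.2 h0⟩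
      intro h1
      have := hz0 i
      rw [h1, inner_zero_left] at this
      exact this.false
    by_contra hneg
    obtain ⟨w, hw, hw0⟩ := isPreconnected_connectedComponentIn.intermediate_value hy
      (mem_connectedComponentIn (hsub hz0))
      (f := fun w => ⟪α i, w⟫) (by fun_prop) ⟨not_lt.1 hneg, (hz0 i).le⟩
    exact hC w hw hw0

omit hdual in
-- The form `⟪u, ·⟫` has a constant sign `σ` on the component and weakly on its closure `T`. An
-- interior point of `T` on the mirror could be pushed slightly to the wrong side.
theorem inner_ne_zero_of_isWeylChamber
    {W : Subgroup (EuclideanSpace ℝ (Fin d) ≃ₗᵢ[ℝ] EuclideanSpace ℝ (Fin d))}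
    (hT : IsWeylChamber W {y | ∀ i, 0 ≤ ⟪α i, y⟫}) {u : EuclideanSpace ℝ (Fin d)} (hu : u ≠ 0)
    (huW : rootReflection u ∈ W) {y : EuclideanSpace ℝ (Fin d)} (hy : ∀ i, 0 < ⟪α i, y⟫) :
    ⟪u, y⟫ ≠ 0 := by
  intro h0
  obtain ⟨x, hx, hxT⟩ := hT
  set C := connectedComponentIn (mirrorUnion W)ᶜ x with hC
  have hxC : x ∈ C := mem_connectedComponentIn hx
  have hCu : ∀ w ∈ C, ⟪u, w⟫ ≠ 0 := fun w hw h1 => connectedComponentIn_subset _ _ hw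
    ⟨u, hu, huW, Submodule.mem_orthogonal_singleton_iff_inner_right.2 h1⟩
  have hopen : IsOpen {y | ∀ i, 0 < ⟪α i, y⟫} := by
    simp only [Set.ofPred_forall]
    exact isOpen_iInter_of_finite fun i => isOpen_lt continuous_const (by fun_prop)
  obtain ⟨σ, hσ, hσC⟩ : ∃ σ : ℝ, σ ≠ 0 ∧ ∀ w ∈ C, 0 ≤ σ * ⟪u, w⟫ := by
    rcases (hCu x hxC).lt_or_gt with hlt | hgt
    · refine ⟨-1, by norm_num, fun w hw => ?_⟩
      by_contra hneg
      obtain ⟨w', hw', hw0⟩ := isPreconnected_connectedComponentIn.intermediate_value hxC hw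
        (f := fun w => ⟪u, w⟫) (by fun_prop) ⟨hlt.le, by linarith⟩
      exact hCu w' hw' hw0
    · refine ⟨1, one_ne_zero, fun w hw => ?_⟩
      by_contra hneg
      obtain ⟨w', hw', hw0⟩ := isPreconnected_connectedComponentIn.intermediate_value hw hxC
        (f := fun w => ⟪u, w⟫) (by fun_prop) ⟨by linarith, hgt.le⟩
      exact hCu w' hw' hw0
  have hcl : ∀ w ∈ closure C, 0 ≤ σ * ⟪u, w⟫ := by
    intro w hw
    exact closure_minimal (t := {w | 0 ≤ σ * ⟪u, w⟫}) hσC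
      (isClosed_le continuous_const (by fun_prop)) hw
  have h1 : Filter.Tendsto (fun ε : ℝ => y - (ε * σ) • u) (nhdsWithin 0 (Set.Ioi 0)) (nhds y) := by
    have : Continuous fun ε : ℝ => y - (ε * σ) • u := by fun_prop
    simpa using (this.tendsto 0).mono_left nhdsWithin_le_nhds
  have h2 := h1.eventually (hopen.mem_nhds hy)
  obtain ⟨ε, hε, hε0⟩ := (h2.and self_mem_nhdsWithin).exists
  have hε0' : (0 : ℝ) < ε := hε0
  have h3 := hcl (y - (ε * σ) • u) (hxT ▸ fun i => (hε i).le)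
  rw [inner_sub_right, h0, inner_smul_right] at h3
  have h4 : 0 < ⟪u, u⟫ := real_inner_self_pos.2 hu
  have h5 : 0 < ε * σ ^ 2 * ⟪u, u⟫ := by positivity
  nlinarith

theorem linearCombination_pair_eq_zero {i j : Fin d} (hij : i ≠ j) (p q : ℝ)
    (h : p • α i + q • α j = 0) : p = 0 ∧ q = 0 := by
  constructor
  · obtain ⟨y, hy⟩ := hdual (Pi.single i 1)
    have := congrArg (fun z => ⟪z, y⟫) h
    simpa [inner_add_left, inner_smul_left, hy, hij.symm] using this
  · obtain ⟨y, hy⟩ := hdual (Pi.single j 1)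
    have := congrArg (fun z => ⟪z, y⟫) h
    simpa [inner_add_left, inner_smul_left, hy, hij] using this

/-- Strict Cauchy–Schwarz for independent unit vectors; `ε = ±1` gives the two bounds. -/
theorem exists_angle (hnorm : ∀ i, ‖α i‖ = 1) {i j : Fin d} (hij : i ≠ j) :
    ∃ θ, 0 < θ ∧ θ < Real.pi ∧ ⟪α i, α j⟫ = -Real.cos θ := by
  have key : ∀ ε : ℝ, ε ^ 2 = 1 → ε * ⟪α i, α j⟫ < 1 := by
    intro ε hε
    have h1 : α i - ε • α j ≠ 0 := by
      intro h0
      have := linearCombination_pair_eq_zero hdual hij 1 (-ε)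
        (by rw [one_smul, neg_smul, ← sub_eq_add_neg, h0])
      exact one_ne_zero this.1
    have h2 : 0 < ⟪α i - ε • α j, α i - ε • α j⟫ := real_inner_self_pos.2 h1
    rw [inner_sub_left, inner_sub_right, inner_sub_right, inner_smul_left, inner_smul_right,
      inner_smul_left, inner_smul_right, real_inner_self_eq_norm_sq, real_inner_self_eq_norm_sq,
      hnorm, hnorm, real_inner_comm (α i) (α j)] at h2
    simp only [conj_trivial] at h2
    nlinarith
  have h1 := key 1 (by norm_num)
  have h2 := key (-1) (by norm_num)
  refine ⟨Real.arccos (-⟪α i, α j⟫), Real.arccos_pos.2 (by linarith), ?_, ?_⟩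
  · refine lt_of_le_of_ne (Real.arccos_le_pi _) fun h => ?_
    have := Real.arccos_eq_pi.1 h
    linarith
  · rw [Real.cos_arccos (by linarith) (by linarith), neg_neg]

/-- All vectors `dihedralRoot n` define mirrors, and their coefficients are proportional to `sin
((n+1)θ)` and `sin (nθ)`. For `n = ⌊π/θ⌋` these have opposite signs unless `nθ = π`, and opposite
signs would make the mirror cut the open cone. -/
theorem angle_of_isWeylChamber (hnorm : ∀ i, ‖α i‖ = 1)
    (hT : IsWeylChamber (Subgroup.closure (Set.range fun i => rootReflection (α i)))
      {y | ∀ i, 0 ≤ ⟪α i, y⟫}) {i j : Fin d} (hij : i ≠ j) :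
    ∃ k : ℕ, 2 ≤ k ∧ ⟪α i, α j⟫ = -Real.cos (Real.pi / k) := by
  set W := Subgroup.closure (Set.range fun i => rootReflection (α i)) with hW
  obtain ⟨θ, h0, hpi, hθ⟩ := exists_angle hdual hnorm hij
  have hsin := Real.sin_pos_of_pos_of_lt_pi h0 hpi
  have hmemW : ∀ i, rootReflection (α i) ∈ W := fun i => Subgroup.subset_closure ⟨i, rfl⟩
  have hconj : ∀ g ∈ W, ∀ u, rootReflection u ∈ W → rootReflection (g u) ∈ W := by
    intro g hg u hu
    rw [rootReflection_map]
    exact mul_mem (mul_mem hg hu) (inv_mem hg)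
  have hroot : ∀ n : ℕ, rootReflection (dihedralRoot (α i) (α j) θ n) ∈ W := by
    intro n
    have hzero : dihedralRoot (α i) (α j) θ 0 = α i := by simp [dihedralRoot, hsin.ne']
    have hone : dihedralRoot (α i) (α j) θ (-1) = -α j := by simp [dihedralRoot, hsin.ne']
    have hpow : ∀ k : ℕ, (rootReflection (α i) * rootReflection (α j)) ^ k ∈ W :=
      fun k => pow_mem (mul_mem (hmemW i) (hmemW j)) k
    -- Even indices form the orbit of `α i` under the rotation, odd ones that of `-α j`.
    obtain ⟨k, rfl | rfl⟩ := n.even_or_odd'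
    · have h1 := rootReflection_mul_pow_dihedralRoot (hnorm i) (hnorm j) hθ k 0
      have e : ((2 * k : ℕ) : ℤ) = 0 + 2 * (k : ℤ) := by push_cast; ring
      rw [e, ← h1, hzero]
      exact hconj _ (hpow k) _ (hmemW i)
    · have h1 := rootReflection_mul_pow_dihedralRoot (hnorm i) (hnorm j) hθ (k + 1) (-1)
      have e : ((2 * k + 1 : ℕ) : ℤ) = -1 + 2 * ((k + 1 : ℕ) : ℤ) := by push_cast; ring
      rw [e, ← h1, hone]
      exact hconj _ (hpow _) _ (by rw [rootReflection_neg]; exact hmemW j)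
  have hpos : ∀ n : ℕ, ¬ (0 < Real.sin (n * θ) ∧ Real.sin ((n + 1) * θ) < 0) := by
    rintro n ⟨h1, h2⟩
    -- These values make the two contributions to `⟪u, y⟫` cancel while `y` stays in the open cone.
    obtain ⟨y, hy⟩ := hdual fun k => if k = i then Real.sin (n * θ) else
      if k = j then -Real.sin ((n + 1) * θ) else 1
    have hyi : ⟪α i, y⟫ = Real.sin (n * θ) := by rw [hy, if_pos rfl]
    have hyj : ⟪α j, y⟫ = -Real.sin ((n + 1) * θ) := by rw [hy, if_neg hij.symm, if_pos rfl]
    refine inner_ne_zero_of_isWeylChamber hT (u := dihedralRoot (α i) (α j) θ n) (y := y)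
      ?_ (hroot n) (fun k => ?_) ?_
    · intro h3
      have h4 := (linearCombination_pair_eq_zero hdual hij _ _ h3).2
      rcases div_eq_zero_iff.1 h4 with h5 | h5
      · exact h1.ne' (by simpa using h5)
      · exact hsin.ne' h5
    · rw [hy]
      split_ifs
      · exact h1
      · linarith
      · exact one_pos
    · rw [dihedralRoot, inner_add_left, inner_smul_left, inner_smul_left, hyi, hyj]
      simp only [conj_trivial, Int.cast_natCast]
      ring
  set n := ⌊Real.pi / θ⌋₊ with hn
  have h1 : n * θ ≤ Real.pi := by
    rw [← le_div_iff₀ h0]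
    exact Nat.floor_le (div_pos Real.pi_pos h0).le
  have h2 : Real.pi < (n + 1) * θ := by
    rw [← div_lt_iff₀ h0]
    exact Nat.lt_floor_add_one _
  have h3 : 1 ≤ n := by
    rw [hn, Nat.one_le_floor_iff, le_div_iff₀ h0]
    linarith
  have h3' : (1 : ℝ) ≤ n := by exact_mod_cast h3
  rcases h1.eq_or_lt with h4 | h4
  · refine ⟨n, ?_, ?_⟩
    · by_contra hlt
      have : n = 1 := by omega
      rw [this, Nat.cast_one, one_mul] at h4
      exact hpi.ne h4
    · rw [hθ]
      congr 2
      rw [eq_div_iff (by positivity), mul_comm]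
      exact h4
  · refine absurd ⟨Real.sin_pos_of_pos_of_lt_pi (by positivity) h4, ?_⟩ (hpos n)
    -- As `nθ < π` and `θ < π`, the angle `(n+1)θ` lies strictly between `π` and `2π`.
    have h5 : Real.sin ((n + 1) * θ - 2 * Real.pi) < 0 :=
      Real.sin_neg_of_neg_of_neg_pi_lt (by linarith) (by linarith)
    rwa [Real.sin_sub_two_pi] at h5

/-- A reflection in `H` fixing a point `y` of the open cone preserves inner products with `y`, so it
keeps the simple roots positive. By deletion it is the identity, which no reflection is. -/
theorem isWeylChamber_of_positive_system {P : Set (EuclideanSpace ℝ (Fin d))}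
    (hα : ∀ i, α i ∈ P)
    (hstep : ∀ β ∈ P, ∀ i, β = α i ∨ rootReflection (α i) β ∈ P)
    (hpos : ∀ β ∈ P, ∀ y, (∀ i, 0 < ⟪α i, y⟫) → 0 < ⟪β, y⟫) :
    IsWeylChamber (Subgroup.closure (Set.range fun i => rootReflection (α i)))
      {y | ∀ i, 0 ≤ ⟪α i, y⟫} := by
  refine isWeylChamber_of_forall_mirror hdual (fun i => Subgroup.subset_closure ⟨i, rfl⟩)
    fun u hu huW y hy h0 => ?_
  have hs : ∀ i, rootReflection (α i) * rootReflection (α i) = 1 :=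
    fun i => rootReflection_mul_self _
  have hneg : ∀ β ∈ P, -β ∉ P := by
    intro β hβ hβ'
    have h1 := hpos _ hβ _ hy
    have h2 := hpos _ hβ' _ hy
    rw [inner_neg_left] at h2
    linarith
  have hstep' : ∀ β ∈ P, ∀ i, β = α i ∨
      (MonoidHom.id _ (rootReflection (α i)) β ∈ P ∧
        rootReflection (MonoidHom.id _ (rootReflection (α i)) β)
          = rootReflection (α i) * rootReflection β * (rootReflection (α i))⁻¹) :=
    fun β hβ i => (hstep β hβ i).imp id fun h => ⟨h, rootReflection_map _ _⟩
  have hfix : rootReflection u y = y :=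
    Submodule.reflection_mem_subspace_eq_self
      (Submodule.mem_orthogonal_singleton_iff_inner_right.2 h0)
  obtain ⟨L, hL⟩ := Subgroup.exists_list_map_of_mem_closure_range hs huW
  have h1 : (L.map fun i => rootReflection (α i)).prod = 1 := by
    refine word_eq_one_of_preserves_positive (s := fun i => rootReflection (α i))
      (ρ := MonoidHom.id _) (t := rootReflection) hs hα
      (fun i => rootReflection_self _) (fun i => rfl) hstep' hneg L fun i => ?_
    have h2 : ⟪rootReflection u (α i), y⟫ = ⟪α i, y⟫ := by
      rw [← (rootReflection u).inner_map_map (α i) y, hfix]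
    rcases word_apply_root (s := fun i => rootReflection (α i))
      (ρ := MonoidHom.id _) (t := rootReflection) hα
      (fun i => rootReflection_self _) (fun i => rfl) hstep' L (hα i) with ⟨h3, _⟩ | ⟨h3, _⟩
    · exact h3
    · have h4 := hpos _ h3 y hy
      rw [inner_neg_left, hL] at h4
      change 0 < -⟪rootReflection u (α i), y⟫ at h4
      rw [h2] at h4
      have := hy i
      linarith
  have h2 : rootReflection u u = u := by rw [← hL, h1]; rfl
  rw [rootReflection_self] at h2
  have h3 : (2 : ℝ) • u = 0 := by
    rw [two_smul]
    nth_rewrite 1 [← h2]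
    exact neg_add_cancel u
  exact hu ((smul_eq_zero_iff_right two_ne_zero).1 h3)

end Chamber

end



noncomputable section

open RealInnerProductSpace

/-! ### Finite root systems of rank three over `ℤ[τ]` -/

/-- Multiplication in `ℤ[τ]`, `τ ^ 2 = τ + 1`, where `(a, b)` stands for `a + b τ`. -/
def goldenMul (x y : ℤ × ℤ) : ℤ × ℤ :=
  (x.1 * y.1 + x.2 * y.2, x.1 * y.2 + x.2 * y.1 + x.2 * y.2)

/-- The value of an element of `ℤ[τ]` at a root `q` of `τ ^ 2 = τ + 1`. -/
def goldenVal (q : ℝ) (x : ℤ × ℤ) : ℝ := x.1 + x.2 * q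

theorem goldenVal_mul {q : ℝ} (hq : q ^ 2 = q + 1) (x y : ℤ × ℤ) :
    goldenVal q (goldenMul x y) = goldenVal q x * goldenVal q y := by
  simp only [goldenVal, goldenMul]
  push_cast
  linear_combination (-(x.2 * y.2 : ℝ)) * hq

theorem goldenVal_add (q : ℝ) (x y : ℤ × ℤ) :
    goldenVal q (x + y) = goldenVal q x + goldenVal q y := by
  simp only [goldenVal, Prod.fst_add, Prod.snd_add]
  push_cast
  ring

theorem goldenVal_neg (q : ℝ) (x : ℤ × ℤ) : goldenVal q (-x) = -goldenVal q x := by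
  simp only [goldenVal, Prod.fst_neg, Prod.snd_neg]
  push_cast
  ring

/-- `(2q - 1)² = 5` makes `q` irrational. Roots can then be compared by their integer coordinates,
which is decidable. -/
theorem goldenVal_injective {q : ℝ} (hq : q ^ 2 = q + 1) : Function.Injective (goldenVal q) := by
  have hirr : Irrational q := by
    rintro ⟨r, rfl⟩
    have h5 : Irrational (√5) := by
      have := Nat.Prime.irrational_sqrt (p := 5) (by norm_num)
      exact_mod_cast this
    have h1 : ((2 * r - 1 : ℚ) : ℝ) ^ 2 = 5 := by
      push_cast
      linear_combination 4 * hq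
    refine h5 ⟨|2 * r - 1|, ?_⟩
    rw [← h1, Real.sqrt_sq_eq_abs, Rat.cast_abs]
  have key : ∀ x : ℤ × ℤ, goldenVal q x = 0 → x = 0 := by
    rintro ⟨a, b⟩ h
    simp only [goldenVal] at h
    have hb : b = 0 := by
      by_contra hb
      refine hirr ⟨-a / b, ?_⟩
      have hb' : (b : ℝ) ≠ 0 := by exact_mod_cast hb
      push_cast
      rw [div_eq_iff hb']
      linarith
    subst hb
    simpa using h
  intro x y h
  have := key (x - y) (by rw [sub_eq_add_neg, goldenVal_add, goldenVal_neg, h, add_neg_cancel])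
  exact sub_eq_zero.1 this

/-- The Cartan matrix of a linear Coxeter diagram with three nodes whose first edge is simple. -/
def cartan (c : (ℤ × ℤ) × (ℤ × ℤ)) : Fin 3 → Fin 3 → ℤ × ℤ :=
  ![![(2, 0), (-1, 0), 0], ![(-1, 0), (2, 0), -c.1], ![0, -c.2, (2, 0)]]

/-- A finite set of vectors with coordinates in `ℤ[τ]` that is a system of positive roots for the
reflections given by a Cartan matrix. -/
structure RootTable (c : (ℤ × ℤ) × (ℤ × ℤ)) (N : ℕ) where
  simple : Fin 3 → Fin N
  root : Fin N → Fin 3 → ℤ × ℤ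
  step : Fin 3 → Fin N → Fin N
  root_simple : ∀ i, root (simple i) = Pi.single i (1, 0)
  -- The simple root is exempt because its own reflection makes it negative; `step i (simple i)` is
  -- a filler value.
  root_step : ∀ i k, k = simple i ∨ root (step i k) = Function.update (root k) i
    (root k i - (goldenMul (cartan c i 0) (root k 0) + goldenMul (cartan c i 1) (root k 1)
      + goldenMul (cartan c i 2) (root k 2)))
  root_injective : ∀ k l, root k = root l → k = l
  root_nonneg : ∀ k i, 0 ≤ (root k i).1 ∧ 0 ≤ (root k i).2
  root_ne_zero : ∀ k, root k ≠ 0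

namespace RootTable

variable {c : (ℤ × ℤ) × (ℤ × ℤ)} {N : ℕ} (T : RootTable c N)

/-- Elements of a group that are conjugated by the generators as the reflections in the roots
are. -/
def IsReflectionLabelling {Γ : Type*} [Group Γ] (s : Fin 3 → Γ) (t : Fin N → Γ) : Prop :=
  (∀ i, t (T.simple i) = s i) ∧ ∀ i k, k = T.simple i ∨ t (T.step i k) = s i * t k * (s i)⁻¹

/-- The root with given index, as a vector. -/
def toVec {E : Type*} [AddCommGroup E] [Module ℝ E] (q : ℝ) (a : Fin 3 → E) (k : Fin N) : E :=
  ∑ i, goldenVal q (T.root k i) • a i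

section Linear

variable {E : Type*} [AddCommGroup E] [Module ℝ E] {q : ℝ} {a : Fin 3 → E}

theorem toVec_simple (i : Fin 3) : T.toVec q a (T.simple i) = a i := by
  rw [toVec, T.root_simple, Finset.sum_eq_single i (fun j _ hj => by simp [hj, goldenVal])
    (by simp)]
  simp [goldenVal]

theorem map_toVec (hq : q ^ 2 = q + 1) (i : Fin 3) (r : E →ₗ[ℝ] E)
    (hr : ∀ j, r (a j) = a j - goldenVal q (cartan c i j) • a i) (k : Fin N) :
    k = T.simple i ∨ r (T.toVec q a k) = T.toVec q a (T.step i k) := by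
  refine (T.root_step i k).imp id fun h => ?_
  have h1 : T.toVec q a (T.step i k) = T.toVec q a k
      - goldenVal q (goldenMul (cartan c i 0) (T.root k 0) + goldenMul (cartan c i 1) (T.root k 1)
      + goldenMul (cartan c i 2) (T.root k 2)) • a i := by
    set z := goldenMul (cartan c i 0) (T.root k 0) + goldenMul (cartan c i 1) (T.root k 1)
      + goldenMul (cartan c i 2) (T.root k 2)
    have h2 : ∀ j, goldenVal q (T.root (T.step i k) j) • a j
        = goldenVal q (T.root k j) • a j - (Pi.single i (goldenVal q z) : Fin 3 → ℝ) j • a j := by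
      intro j
      rw [h]
      by_cases hj : j = i
      · subst hj
        rw [Function.update_self, Pi.single_eq_same, sub_eq_add_neg, goldenVal_add, goldenVal_neg]
        module
      · simp [hj]
    rw [toVec, Finset.sum_congr rfl fun j _ => h2 j, Finset.sum_sub_distrib]
    congr 1
    rw [Finset.sum_eq_single i (fun j _ hj => by simp [hj]) (by simp), Pi.single_eq_same]
  rw [h1]
  simp only [toVec, Fin.sum_univ_three, map_add, map_smul, hr, goldenVal_add, goldenVal_mul hq]
  module

theorem toVec_injective (hq : q ^ 2 = q + 1) (ha : LinearIndependent ℝ a) :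
    Function.Injective (T.toVec q a) := by
  intro k l h
  refine T.root_injective k l (funext fun i => goldenVal_injective hq ?_)
  unfold toVec at h
  rw [← sub_eq_zero, ← Finset.sum_sub_distrib] at h
  simp only [← sub_smul] at h
  exact sub_eq_zero.1 (Fintype.linearIndependent_iff.1 ha _ h i)

theorem neg_toVec_ne (hq : q ^ 2 = q + 1) (ha : LinearIndependent ℝ a) (k l : Fin N) :
    -T.toVec q a k ≠ T.toVec q a l := by
  intro h
  refine T.root_ne_zero k (funext fun i => ?_)
  unfold toVec at h
  rw [neg_eq_iff_add_eq_zero, ← Finset.sum_add_distrib] at h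
  simp only [← add_smul, ← goldenVal_add] at h
  have h1 := Fintype.linearIndependent_iff.1 ha _ h i
  have h2 : T.root k i + T.root l i = 0 :=
    goldenVal_injective hq (h1.trans (by simp [goldenVal]))
  have h3 := T.root_nonneg k i
  have h4 := T.root_nonneg l i
  have h5 := congrArg Prod.fst h2
  have h6 := congrArg Prod.snd h2
  simp only [Prod.fst_add, Prod.snd_add, Prod.fst_zero, Prod.snd_zero] at h5 h6
  exact Prod.ext (by simp; omega) (by simp; omega)

end Linear

section Faithful

variable {E : Type*} [NormedAddCommGroup E] [InnerProductSpace ℝ E]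
  {q : ℝ} {a : Fin 3 → E} {Γ : Type*} [Group Γ] {s : Fin 3 → Γ} {t : Fin N → Γ}
  {ρ : Γ →* (E ≃ₗᵢ[ℝ] E)}

/-- The labelling makes deletion available in `Γ`: an element fixing the simple roots is trivial.
Hence `ρ` is injective, and `Γ` embeds into the maps from the simple roots to the finite set `P ∪
-P`. -/
theorem faithful_and_finite (hq : q ^ 2 = q + 1)
    (ha : LinearIndependent ℝ a)
    (hρ : ∀ i j, ρ (s i) (a j) = a j - goldenVal q (cartan c i j) • a i)
    (ht : T.IsReflectionLabelling s t) (hs : ∀ i, s i * s i = 1)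
    (hgen : Subgroup.closure (Set.range s) = ⊤) :
    Function.Injective ρ ∧ Finite Γ := by
  classical
  set P : Set E := Set.range (T.toVec q a)
  have hinj := T.toVec_injective hq ha
  let t' : E → Γ := Function.extend (T.toVec q a) t 1
  have ht' : ∀ k, t' (T.toVec q a k) = t k := fun k => hinj.extend_apply t 1 k
  have hα : ∀ i, a i ∈ P := fun i => ⟨T.simple i, T.toVec_simple i⟩
  have hneg : ∀ i, ρ (s i) (a i) = -a i := by
    intro i
    have h2 : goldenVal q (cartan c i i) = 2 := by
      fin_cases i <;> simp [cartan, goldenVal]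
    rw [hρ, h2, two_smul]
    abel
  have htα : ∀ i, t' (a i) = s i := by
    intro i
    rw [← T.toVec_simple (q := q) (a := a) i, ht', ht.1]
  have hstep : ∀ β ∈ P, ∀ i, β = a i ∨
      (ρ (s i) β ∈ P ∧ t' (ρ (s i) β) = s i * t' β * (s i)⁻¹) := by
    rintro _ ⟨k, rfl⟩ i
    by_cases hk : k = T.simple i
    · left
      rw [hk, T.toVec_simple]
    · right
      have h1 : ρ (s i) (T.toVec q a k) = T.toVec q a (T.step i k) :=
        (T.map_toVec hq i ((ρ (s i)).toLinearEquiv : E →ₗ[ℝ] E) (fun j => hρ i j) k).resolve_left hk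
      rw [h1, ht', ht']
      exact ⟨⟨_, rfl⟩, (ht.2 i k).resolve_left hk⟩
  have hP : ∀ β ∈ P, -β ∉ P := by
    rintro _ ⟨k, rfl⟩ ⟨l, hl⟩
    exact T.neg_toVec_ne hq ha k l hl.symm
  have hword : ∀ g : Γ, ∃ L : List (Fin 3), (L.map s).prod = g := fun g =>
    Subgroup.exists_list_map_of_mem_closure_range hs (hgen ▸ Subgroup.mem_top g)
  have hfaith : ∀ g, (∀ i, ρ g (a i) = a i) → g = 1 := by
    intro g hg
    obtain ⟨L, rfl⟩ := hword g
    exact word_eq_one_of_preserves_positive hs hα hneg htα hstep hP L fun i => by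
      rw [hg]
      exact hα i
  refine ⟨(injective_iff_map_eq_one ρ).2 fun g hg => hfaith g fun i => by rw [hg]; rfl, ?_⟩
  have hfin : (P ∪ -P).Finite := (Set.finite_range _).union (Set.finite_range _).neg
  have : Finite ↑(P ∪ -P) := hfin
  let F : Γ → Fin 3 → ↑(P ∪ -P) := fun g i => ⟨ρ g (a i), by
    obtain ⟨L, rfl⟩ := hword g
    rcases word_apply_root hα hneg htα hstep L (hα i) with ⟨h, _⟩ | ⟨h, _⟩
    · exact Or.inl h
    · exact Or.inr h⟩
  refine Finite.of_injective F fun g g' h => ?_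
  have h1 : g'⁻¹ * g = 1 := hfaith _ fun i => by
    have h2 : ρ g (a i) = ρ g' (a i) := congrArg Subtype.val (congrFun h i)
    rw [map_mul, map_inv]
    change (ρ g')⁻¹ (ρ g (a i)) = a i
    rw [h2]
    exact (ρ g').symm_apply_apply _
  exact (inv_mul_eq_one.1 h1).symm

end Faithful

/-- Here `q` must be positive, so that nonnegative coordinates in `ℤ[τ]` have nonnegative real
values; faithfulness holds for either root of `q² = q + 1`. -/
theorem isWeylChamber (T : RootTable c N) {q : ℝ}
    {a : Fin 3 → EuclideanSpace ℝ (Fin 3)} (hq : q ^ 2 = q + 1)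
    (hq0 : 0 < q) (hdual : ∀ c : Fin 3 → ℝ, ∃ y, ∀ i, ⟪a i, y⟫ = c i)
    (hρ : ∀ i j, rootReflection (a i) (a j) = a j - goldenVal q (cartan c i j) • a i) :
    IsWeylChamber (Subgroup.closure (Set.range fun i => rootReflection (a i)))
      {y | ∀ i, 0 ≤ ⟪a i, y⟫} := by
  refine isWeylChamber_of_positive_system hdual (P := Set.range (T.toVec q a))
    (fun i => ⟨T.simple i, T.toVec_simple i⟩) ?_ ?_
  · rintro _ ⟨k, rfl⟩ i
    rcases T.map_toVec (a := a) hq i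
      ((rootReflection (a i)).toLinearEquiv : EuclideanSpace ℝ (Fin 3) →ₗ[ℝ] _)
      (fun j => hρ i j) k with h | h
    · left
      rw [h, T.toVec_simple]
    · exact Or.inr ⟨_, h.symm⟩
  · rintro _ ⟨k, rfl⟩ y hy
    have hnn : ∀ i, 0 ≤ goldenVal q (T.root k i) := fun i => by
      have h1 : (0 : ℝ) ≤ (T.root k i).1 := by exact_mod_cast (T.root_nonneg k i).1
      have h2 : (0 : ℝ) ≤ (T.root k i).2 := by exact_mod_cast (T.root_nonneg k i).2
      exact add_nonneg h1 (mul_nonneg h2 hq0.le)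
    obtain ⟨i, hi⟩ := Function.ne_iff.1 (T.root_ne_zero k)
    have hpos : 0 < goldenVal q (T.root k i) := lt_of_le_of_ne (hnn i) fun h =>
      hi (goldenVal_injective hq (h.symm.trans (by simp [goldenVal])))
    simp only [toVec, sum_inner, inner_smul_left, conj_trivial]
    exact Finset.sum_pos' (fun j _ => mul_nonneg (hnn j) (hy j).le)
      ⟨i, Finset.mem_univ i, mul_pos hpos (hy i)⟩

end RootTable

set_option maxRecDepth 100000 in
/-- The positive roots of type `A₃`. -/
def rootTableA : RootTable ((1, 0), (1, 0)) 6 where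
  simple := ![0, 1, 2]
  root := ![![(1, 0), (0, 0), (0, 0)],
    ![(0, 0), (1, 0), (0, 0)],
    ![(0, 0), (0, 0), (1, 0)],
    ![(1, 0), (1, 0), (0, 0)],
    ![(0, 0), (1, 0), (1, 0)],
    ![(1, 0), (1, 0), (1, 0)]]
  step := ![![0, 3, 2, 1, 5, 4],
    ![3, 1, 4, 0, 2, 5],
    ![0, 4, 2, 5, 1, 3]]
  root_simple := by decide
  root_step := by decide
  root_injective := by decide
  root_nonneg := by decide
  root_ne_zero := by decide

/-- Each positive root is reached from a simple one by a chain of steps, and the corresponding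
conjugate is its label. The remaining steps agree with these choices by the Coxeter relations alone,
so the labels exist in the abstract group. -/
theorem exists_isReflectionLabelling_A {Γ : Type*} [Group Γ] {s : Fin 3 → Γ}
    (hs : ∀ i, s i * s i = 1) (h01 : (s 0 * s 1) ^ 3 = 1) (h02 : (s 0 * s 2) ^ 2 = 1)
    (h12 : (s 1 * s 2) ^ 3 = 1) : ∃ t, rootTableA.IsReflectionLabelling s t := by
  -- Conjugations by the generators are abstracted to unary maps, which reduces the check to
  -- equational reasoning.
  have key : ∀ (A B C : Γ → Γ) (a b c : Γ) (hA : ∀ x, A (A x) = x) (hB : ∀ x, B (B x) = x)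
      (hC : ∀ x, C (C x) = x) (hAC : ∀ x, A (C x) = C (A x))
      (hAB : ∀ x, A (B (A x)) = B (A (B x)))
      (hBC : ∀ x, B (C (B x)) = C (B (C x))) (ha : A a = a) (hb : B b = b)
      (hc : C c = c) (hca : C a = a) (hac : A c = c) (hab : A b = B a)
      (hbc : C b = B c), ∃ t : Fin 6 → Γ, (t 0 = a ∧ t 1 = b ∧ t 2 = c) ∧
      (∀ k, k = 0 ∨ t (rootTableA.step 0 k) = A (t k)) ∧
      (∀ k, k = 1 ∨ t (rootTableA.step 1 k) = B (t k)) ∧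
      (∀ k, k = 2 ∨ t (rootTableA.step 2 k) = C (t k)) := by
    intro A B C a b c hA hB hC hAC hAB hBC ha hb hc hca hac hab hbc
    refine ⟨![a, b, c, B a, C b, C (B a)], ⟨rfl, rfl, rfl⟩, ?_, ?_, ?_⟩ <;>
      intro k <;> fin_cases k <;>
      simp [rootTableA] <;> grind
  have i0 : (s 0)⁻¹ = s 0 := inv_eq_of_mul_eq_one_left (hs 0)
  have i1 : (s 1)⁻¹ = s 1 := inv_eq_of_mul_eq_one_left (hs 1)
  have i2 : (s 2)⁻¹ = s 2 := inv_eq_of_mul_eq_one_left (hs 2)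
  have c0 : ∀ y, s 0 * (s 0 * y) = y := fun y => by rw [← mul_assoc, hs, one_mul]
  have c1 : ∀ y, s 1 * (s 1 * y) = y := fun y => by rw [← mul_assoc, hs, one_mul]
  have c2 : ∀ y, s 2 * (s 2 * y) = y := fun y => by rw [← mul_assoc, hs, one_mul]
  have conj : ∀ {u v : Γ}, u = v → ∀ x, u * x * u⁻¹ = v * x * v⁻¹ := by
    rintro u _ rfl x
    rfl
  have e01 : s 0 * s 1 * s 0 = s 1 * s 0 * s 1 := by
    have := eq_inv_of_mul_eq_one_left (a := s 0 * s 1 * s 0) (b := s 1 * s 0 * s 1)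
      (by simpa [pow_succ, mul_assoc] using h01)
    simpa [i0, i1, mul_assoc] using this
  have e02 : s 0 * s 2 = s 2 * s 0 := by
    have := eq_inv_of_mul_eq_one_left (a := s 0 * s 2) (b := s 0 * s 2)
      (by simpa [pow_succ, mul_assoc] using h02)
    simpa [i0, i2, mul_assoc] using this
  have e12 : s 1 * s 2 * s 1 = s 2 * s 1 * s 2 := by
    have := eq_inv_of_mul_eq_one_left (a := s 1 * s 2 * s 1) (b := s 2 * s 1 * s 2)
      (by simpa [pow_succ, mul_assoc] using h12)
    simpa [i1, i2, mul_assoc] using this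
  have e12' : ∀ y, s 1 * (s 2 * (s 1 * y)) = s 2 * (s 1 * (s 2 * y)) := fun y => by
    simpa [mul_assoc] using congrArg (· * y) e12
  obtain ⟨t, ⟨h0, h1, h2⟩, hA, hB, hC⟩ := key (fun x => s 0 * x * (s 0)⁻¹)
    (fun x => s 1 * x * (s 1)⁻¹) (fun x => s 2 * x * (s 2)⁻¹) (s 0) (s 1) (s 2)
    (fun x => by simp [mul_assoc, i0, c0, hs 0]) (fun x => by simp [mul_assoc, i1, c1, hs 1])
    (fun x => by simp [mul_assoc, i2, c2, hs 2])
    (fun x => by simpa [mul_assoc] using conj e02 x)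
    (fun x => by simpa [mul_assoc] using conj e01 x)
    (fun x => by simpa [mul_assoc] using conj e12 x) (by group) (by group) (by group)
    (by rw [mul_inv_eq_iff_eq_mul, e02]) (by rw [mul_inv_eq_iff_eq_mul, e02])
    (by rw [i0, i1]; exact e01)
    (by rw [i1, i2]; exact e12.symm)
  refine ⟨t, fun i => ?_, fun i k => ?_⟩
  · fin_cases i
    exacts [h0, h1, h2]
  · fin_cases i
    exacts [hA k, hB k, hC k]

set_option maxRecDepth 100000 in
/-- The positive roots of type `B₃`. -/
def rootTableB : RootTable ((2, 0), (1, 0)) 9 where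
  simple := ![0, 1, 2]
  root := ![![(1, 0), (0, 0), (0, 0)],
    ![(0, 0), (1, 0), (0, 0)],
    ![(0, 0), (0, 0), (1, 0)],
    ![(1, 0), (1, 0), (0, 0)],
    ![(0, 0), (1, 0), (1, 0)],
    ![(0, 0), (2, 0), (1, 0)],
    ![(1, 0), (1, 0), (1, 0)],
    ![(2, 0), (2, 0), (1, 0)],
    ![(1, 0), (2, 0), (1, 0)]]
  step := ![![0, 3, 2, 1, 6, 7, 4, 5, 8],
    ![3, 1, 5, 0, 4, 2, 8, 7, 6],
    ![0, 4, 2, 6, 1, 5, 3, 7, 8]]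
  root_simple := by decide
  root_step := by decide
  root_injective := by decide
  root_nonneg := by decide
  root_ne_zero := by decide

/-- The relation of even order 4 does not conjugate `s 1` to `s 2`, so it enters through two
relations, `hbc` and `hcb`, one for each generator. -/
theorem exists_isReflectionLabelling_B {Γ : Type*} [Group Γ] {s : Fin 3 → Γ}
    (hs : ∀ i, s i * s i = 1) (h01 : (s 0 * s 1) ^ 3 = 1) (h02 : (s 0 * s 2) ^ 2 = 1)
    (h12 : (s 1 * s 2) ^ 4 = 1) : ∃ t, rootTableB.IsReflectionLabelling s t := by
  have key : ∀ (A B C : Γ → Γ) (a b c : Γ) (hA : ∀ x, A (A x) = x) (hB : ∀ x, B (B x) = x)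
      (hC : ∀ x, C (C x) = x) (hAC : ∀ x, A (C x) = C (A x))
      (hAB : ∀ x, A (B (A x)) = B (A (B x)))
      (hBC : ∀ x, B (C (B (C x))) = C (B (C (B x)))) (ha : A a = a) (hb : B b = b)
      (hc : C c = c) (hca : C a = a) (hac : A c = c) (hab : A b = B a)
      (hbc : C (B (C b)) = b) (hcb : B (C (B c)) = c),
      ∃ t : Fin 9 → Γ, (t 0 = a ∧ t 1 = b ∧ t 2 = c) ∧
      (∀ k, k = 0 ∨ t (rootTableB.step 0 k) = A (t k)) ∧
      (∀ k, k = 1 ∨ t (rootTableB.step 1 k) = B (t k)) ∧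
      (∀ k, k = 2 ∨ t (rootTableB.step 2 k) = C (t k)) := by
    intro A B C a b c hA hB hC hAC hAB hBC ha hb hc hca hac hab hbc hcb
    refine ⟨![a, b, c, B a, C b, B c, C (B a), A (B c), B (C (B a))], ⟨rfl, rfl, rfl⟩, ?_, ?_, ?_⟩ <;>
      intro k <;> fin_cases k <;>
      simp [rootTableB] <;> grind
  have i0 : (s 0)⁻¹ = s 0 := inv_eq_of_mul_eq_one_left (hs 0)
  have i1 : (s 1)⁻¹ = s 1 := inv_eq_of_mul_eq_one_left (hs 1)
  have i2 : (s 2)⁻¹ = s 2 := inv_eq_of_mul_eq_one_left (hs 2)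
  have c0 : ∀ y, s 0 * (s 0 * y) = y := fun y => by rw [← mul_assoc, hs, one_mul]
  have c1 : ∀ y, s 1 * (s 1 * y) = y := fun y => by rw [← mul_assoc, hs, one_mul]
  have c2 : ∀ y, s 2 * (s 2 * y) = y := fun y => by rw [← mul_assoc, hs, one_mul]
  have conj : ∀ {u v : Γ}, u = v → ∀ x, u * x * u⁻¹ = v * x * v⁻¹ := by
    rintro u _ rfl x
    rfl
  have e01 : s 0 * s 1 * s 0 = s 1 * s 0 * s 1 := by
    have := eq_inv_of_mul_eq_one_left (a := s 0 * s 1 * s 0) (b := s 1 * s 0 * s 1)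
      (by simpa [pow_succ, mul_assoc] using h01)
    simpa [i0, i1, mul_assoc] using this
  have e02 : s 0 * s 2 = s 2 * s 0 := by
    have := eq_inv_of_mul_eq_one_left (a := s 0 * s 2) (b := s 0 * s 2)
      (by simpa [pow_succ, mul_assoc] using h02)
    simpa [i0, i2, mul_assoc] using this
  have e12 : s 1 * s 2 * s 1 * s 2 = s 2 * s 1 * s 2 * s 1 := by
    have := eq_inv_of_mul_eq_one_left (a := s 1 * s 2 * s 1 * s 2) (b := s 1 * s 2 * s 1 * s 2)
      (by simpa [pow_succ, mul_assoc] using h12)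
    simpa [i1, i2, mul_assoc] using this
  have e12' : ∀ y, s 1 * (s 2 * (s 1 * (s 2 * y))) = s 2 * (s 1 * (s 2 * (s 1 * y))) := fun y => by
    simpa [mul_assoc] using congrArg (· * y) e12
  obtain ⟨t, ⟨h0, h1, h2⟩, hA, hB, hC⟩ := key (fun x => s 0 * x * (s 0)⁻¹)
    (fun x => s 1 * x * (s 1)⁻¹) (fun x => s 2 * x * (s 2)⁻¹) (s 0) (s 1) (s 2)
    (fun x => by simp [mul_assoc, i0, c0, hs 0]) (fun x => by simp [mul_assoc, i1, c1, hs 1])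
    (fun x => by simp [mul_assoc, i2, c2, hs 2])
    (fun x => by simpa [mul_assoc] using conj e02 x)
    (fun x => by simpa [mul_assoc] using conj e01 x)
    (fun x => by simpa [mul_assoc] using conj e12 x) (by group) (by group) (by group)
    (by rw [mul_inv_eq_iff_eq_mul, e02]) (by rw [mul_inv_eq_iff_eq_mul, e02])
    (by rw [i0, i1]; exact e01)
    (by simp [mul_assoc, i1, i2, c2, hs, ← e12'])
    (by simp [mul_assoc, i1, i2, c1, hs, e12'])
  refine ⟨t, fun i => ?_, fun i k => ?_⟩
  · fin_cases i
    exacts [h0, h1, h2]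
  · fin_cases i
    exacts [hA k, hB k, hC k]

set_option maxRecDepth 100000 in
/-- The positive roots of type `H₃`. -/
def rootTableH : RootTable ((0, 1), (0, 1)) 15 where
  simple := ![0, 1, 2]
  root := ![![(1, 0), (0, 0), (0, 0)],
    ![(0, 0), (1, 0), (0, 0)],
    ![(0, 0), (0, 0), (1, 0)],
    ![(1, 0), (1, 0), (0, 0)],
    ![(0, 0), (1, 0), (0, 1)],
    ![(0, 0), (0, 1), (1, 0)],
    ![(1, 0), (1, 0), (0, 1)],
    ![(0, 0), (0, 1), (0, 1)],
    ![(0, 1), (0, 1), (1, 0)],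
    ![(1, 0), (1, 1), (0, 1)],
    ![(0, 1), (0, 1), (0, 1)],
    ![(0, 1), (1, 1), (0, 1)],
    ![(1, 0), (1, 1), (1, 1)],
    ![(0, 1), (1, 1), (1, 1)],
    ![(0, 1), (0, 2), (1, 1)]]
  step := ![![0, 3, 2, 1, 6, 8, 4, 10, 5, 11, 7, 9, 13, 12, 14],
    ![3, 1, 5, 0, 7, 2, 9, 4, 8, 6, 11, 10, 12, 14, 13],
    ![0, 4, 2, 6, 1, 7, 3, 5, 10, 12, 8, 13, 9, 11, 14]]
  root_simple := by decide
  root_step := by decide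
  root_injective := by decide
  root_nonneg := by decide
  root_ne_zero := by decide

/-- The relation of odd order 5 links the conjugates of `s 1` and `s 2` by the single equation
`hbc`. -/
theorem exists_isReflectionLabelling_H {Γ : Type*} [Group Γ] {s : Fin 3 → Γ}
    (hs : ∀ i, s i * s i = 1) (h01 : (s 0 * s 1) ^ 3 = 1) (h02 : (s 0 * s 2) ^ 2 = 1)
    (h12 : (s 1 * s 2) ^ 5 = 1) : ∃ t, rootTableH.IsReflectionLabelling s t := by
  have key : ∀ (A B C : Γ → Γ) (a b c : Γ) (hA : ∀ x, A (A x) = x) (hB : ∀ x, B (B x) = x)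
      (hC : ∀ x, C (C x) = x) (hAC : ∀ x, A (C x) = C (A x))
      (hAB : ∀ x, A (B (A x)) = B (A (B x)))
      (hBC : ∀ x, B (C (B (C (B x)))) = C (B (C (B (C x))))) (ha : A a = a) (hb : B b = b)
      (hc : C c = c) (hca : C a = a) (hac : A c = c) (hab : A b = B a)
      (hbc : C (B (C b)) = B c), ∃ t : Fin 15 → Γ, (t 0 = a ∧ t 1 = b ∧ t 2 = c) ∧
      (∀ k, k = 0 ∨ t (rootTableH.step 0 k) = A (t k)) ∧
      (∀ k, k = 1 ∨ t (rootTableH.step 1 k) = B (t k)) ∧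
      (∀ k, k = 2 ∨ t (rootTableH.step 2 k) = C (t k)) := by
    intro A B C a b c hA hB hC hAC hAB hBC ha hb hc hca hac hab hbc
    refine ⟨![a, b, c, B a, C b, B c, C (B a), B (C b), A (B c), B (C (B a)),
      A (B (C b)), A (B (C (B a))), C (B (C (B a))), C (A (B (C (B a)))),
      B (C (A (B (C (B a)))))], ⟨rfl, rfl, rfl⟩, ?_, ?_, ?_⟩ <;>
      intro k <;> fin_cases k <;>
      simp [rootTableH] <;> grind
  have i0 : (s 0)⁻¹ = s 0 := inv_eq_of_mul_eq_one_left (hs 0)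
  have i1 : (s 1)⁻¹ = s 1 := inv_eq_of_mul_eq_one_left (hs 1)
  have i2 : (s 2)⁻¹ = s 2 := inv_eq_of_mul_eq_one_left (hs 2)
  have c0 : ∀ y, s 0 * (s 0 * y) = y := fun y => by rw [← mul_assoc, hs, one_mul]
  have c1 : ∀ y, s 1 * (s 1 * y) = y := fun y => by rw [← mul_assoc, hs, one_mul]
  have c2 : ∀ y, s 2 * (s 2 * y) = y := fun y => by rw [← mul_assoc, hs, one_mul]
  have conj : ∀ {u v : Γ}, u = v → ∀ x, u * x * u⁻¹ = v * x * v⁻¹ := by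
    rintro u _ rfl x
    rfl
  have e01 : s 0 * s 1 * s 0 = s 1 * s 0 * s 1 := by
    have := eq_inv_of_mul_eq_one_left (a := s 0 * s 1 * s 0) (b := s 1 * s 0 * s 1)
      (by simpa [pow_succ, mul_assoc] using h01)
    simpa [i0, i1, mul_assoc] using this
  have e02 : s 0 * s 2 = s 2 * s 0 := by
    have := eq_inv_of_mul_eq_one_left (a := s 0 * s 2) (b := s 0 * s 2)
      (by simpa [pow_succ, mul_assoc] using h02)
    simpa [i0, i2, mul_assoc] using this
  have e12 : s 1 * s 2 * s 1 * s 2 * s 1 = s 2 * s 1 * s 2 * s 1 * s 2 := by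
    have := eq_inv_of_mul_eq_one_left (a := s 1 * s 2 * s 1 * s 2 * s 1)
      (b := s 2 * s 1 * s 2 * s 1 * s 2)
      (by simpa [pow_succ, mul_assoc] using h12)
    simpa [i1, i2, mul_assoc] using this
  have e12' : ∀ y, s 1 * (s 2 * (s 1 * (s 2 * (s 1 * y))))
      = s 2 * (s 1 * (s 2 * (s 1 * (s 2 * y)))) := fun y => by
    simpa [mul_assoc] using congrArg (· * y) e12
  obtain ⟨t, ⟨h0, h1, h2⟩, hA, hB, hC⟩ := key (fun x => s 0 * x * (s 0)⁻¹)
    (fun x => s 1 * x * (s 1)⁻¹) (fun x => s 2 * x * (s 2)⁻¹) (s 0) (s 1) (s 2)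
    (fun x => by simp [mul_assoc, i0, c0, hs 0]) (fun x => by simp [mul_assoc, i1, c1, hs 1])
    (fun x => by simp [mul_assoc, i2, c2, hs 2])
    (fun x => by simpa [mul_assoc] using conj e02 x)
    (fun x => by simpa [mul_assoc] using conj e01 x)
    (fun x => by simpa [mul_assoc] using conj e12 x) (by group) (by group) (by group)
    (by rw [mul_inv_eq_iff_eq_mul, e02]) (by rw [mul_inv_eq_iff_eq_mul, e02])
    (by rw [i0, i1]; exact e01)
    (by simp [mul_assoc, i1, i2, hs, ← e12'])
  refine ⟨t, fun i => ?_, fun i k => ?_⟩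
  · fin_cases i
    exacts [h0, h1, h2]
  · fin_cases i
    exacts [hA k, hB k, hC k]

end



noncomputable section

open RealInnerProductSpace

theorem rootReflection_smul {E : Type*} [NormedAddCommGroup E] [InnerProductSpace ℝ E]
    {c : ℝ} (hc : c ≠ 0) (a : E) : rootReflection (c • a) = rootReflection a := by
  unfold rootReflection
  congr 2
  exact Submodule.span_singleton_smul_eq hc.isUnit a

/-! ### Realizations of the root tables -/

section Scaled

variable {E : Type*} [NormedAddCommGroup E] [InnerProductSpace ℝ E]

/-- Multiples of three unit vectors that realize a Cartan matrix. -/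
def scaledRoots (α : Fin 3 → E) (x : ℝ) : Fin 3 → E :=
  ![(-2 * ⟪α 0, α 1⟫) • α 0, α 1, x • α 2]

variable {α : Fin 3 → E} {x q : ℝ} {c : (ℤ × ℤ) × (ℤ × ℤ)}

theorem scaledRoots_eq (i : Fin 3) :
    scaledRoots α x i = (![-2 * ⟪α 0, α 1⟫, 1, x] : Fin 3 → ℝ) i • α i := by
  fin_cases i <;> simp [scaledRoots]

/-- Rescaling does not change reflections. The first factor is `±1` and corrects the sign of `⟪α 0,
α 1⟫`; the factor `x` adjusts the sign and the length ratio on the second edge. -/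
theorem rootReflection_scaledRoots (hnorm : ∀ i, ‖α i‖ = 1) (h01 : 4 * ⟪α 0, α 1⟫ ^ 2 = 1)
    (h02 : ⟪α 0, α 2⟫ = 0) (hc2 : x * goldenVal q c.2 = -2 * ⟪α 1, α 2⟫)
    (hc1 : goldenVal q c.1 = -2 * x * ⟪α 1, α 2⟫) (i j : Fin 3) :
    rootReflection (α i) (scaledRoots α x j)
      = scaledRoots α x j - goldenVal q (cartan c i j) • scaledRoots α x i := by
  have hself : ∀ i, ⟪α i, α i⟫ = 1 := fun i => by
    rw [real_inner_self_eq_norm_sq, hnorm, one_pow]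
  have h10 : ⟪α 1, α 0⟫ = ⟪α 0, α 1⟫ := real_inner_comm _ _
  have h20 : ⟪α 2, α 0⟫ = 0 := by rw [real_inner_comm, h02]
  have h21 : ⟪α 2, α 1⟫ = ⟪α 1, α 2⟫ := real_inner_comm _ _
  rw [rootReflection_apply (hnorm i)]
  have e2 : goldenVal q (2, 0) = 2 := by simp [goldenVal]
  have e1 : goldenVal q (-1, 0) = -1 := by simp [goldenVal]
  have e0 : goldenVal q 0 = 0 := by simp [goldenVal]
  rw [sub_right_inj]
  generalize hb : ⟪α 0, α 1⟫ = b at *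
  fin_cases i <;> fin_cases j <;>
    simp only [scaledRoots, cartan, Fin.zero_eta, Fin.mk_one, Fin.reduceFinMk,
      Matrix.cons_val, inner_smul_right, hself, h02, h10, h20, h21, hb, e2, e1, e0,
      goldenVal_neg, mul_zero, zero_smul, smul_smul]
  all_goals first
    | (congr 1; ring1)
    | (congr 1; linear_combination (-1) * h01)
    | (congr 1; linear_combination hc1)
    | (congr 1; linear_combination hc2)
    | simp

theorem linearIndependent_scaledRoots (hα : LinearIndependent ℝ α)
    (h01 : 4 * ⟪α 0, α 1⟫ ^ 2 = 1) (hx : x ≠ 0) : LinearIndependent ℝ (scaledRoots α x) := by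
  have hb : ⟪α 0, α 1⟫ ≠ 0 := by
    intro h
    rw [h] at h01
    norm_num at h01
  rw [Fintype.linearIndependent_iff] at hα ⊢
  intro g hg i
  simp only [scaledRoots_eq, smul_smul] at hg
  have h1 := hα _ hg i
  rcases mul_eq_zero.1 h1 with h2 | h2
  · exact h2
  · fin_cases i <;> simp_all

end Scaled

/-! ### Chambers of the reducible groups -/

/-- The positive system consists of `α 0` and the `k` dihedral roots of index `0, …, k - 1`, whose
coefficients are nonnegative because `kθ = π`. -/
theorem isWeylChamber_of_orthogonal_root {α : Fin 3 → EuclideanSpace ℝ (Fin 3)}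
    (hdual : ∀ c : Fin 3 → ℝ, ∃ y, ∀ i, ⟪α i, y⟫ = c i) (hnorm : ∀ i, ‖α i‖ = 1)
    {k : ℕ} (hk : 2 ≤ k) (h01 : ⟪α 0, α 1⟫ = 0) (h02 : ⟪α 0, α 2⟫ = 0)
    (h12 : ⟪α 1, α 2⟫ = -Real.cos (Real.pi / k)) :
    IsWeylChamber (Subgroup.closure (Set.range fun i => rootReflection (α i)))
      {y | ∀ i, 0 ≤ ⟪α i, y⟫} := by
  set θ := Real.pi / k with hθ
  have hk0 : (0 : ℝ) < k := by exact_mod_cast (by omega : 0 < k)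
  have hk2 : (2 : ℝ) ≤ k := by exact_mod_cast hk
  have hpi := Real.pi_pos
  have hkθ : k * θ = Real.pi := mul_div_cancel₀ _ hk0.ne'
  have hθ0 : 0 < θ := by positivity
  have hsin : ∀ n : ℤ, 0 < n → n < k → 0 < Real.sin (n * θ) := by
    intro n h0 h1
    have h0' : (0 : ℝ) < n := by exact_mod_cast h0
    have h1' : (n : ℝ) < k := by exact_mod_cast h1
    refine Real.sin_pos_of_pos_of_lt_pi (by positivity) ?_
    rw [← hkθ]
    exact mul_lt_mul_of_pos_right h1' hθ0
  have hs1 : 0 < Real.sin θ := by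
    have := hsin 1 one_pos (by omega)
    simpa using this
  have hsk : Real.sin (k * θ) = 0 := by rw [hkθ, Real.sin_pi]
  -- Shifting the index by `k` adds `π` to the angles and negates the root; this brings reflected
  -- indices back into range.
  have hperiod : ∀ n : ℤ, -dihedralRoot (α 1) (α 2) θ (-n) = dihedralRoot (α 1) (α 2) θ (k - n) := by
    intro n
    simp only [dihedralRoot]
    have e1 : (((k - n : ℤ) : ℝ) + 1) * θ = (((-n : ℤ) : ℝ) + 1) * θ + Real.pi := by
      rw [← hkθ]; push_cast; ring
    have e2 : ((k - n : ℤ) : ℝ) * θ = ((-n : ℤ) : ℝ) * θ + Real.pi := by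
      rw [← hkθ]; push_cast; ring
    rw [e1, e2, Real.sin_add_pi, Real.sin_add_pi]
    module
  have hfirst : dihedralRoot (α 1) (α 2) θ 0 = α 1 := by simp [dihedralRoot, hs1.ne']
  have hlast : dihedralRoot (α 1) (α 2) θ (k - 1) = α 2 := by
    rw [← hperiod 1]
    simp [dihedralRoot, hs1.ne']
  have horth : ∀ n, ⟪α 0, dihedralRoot (α 1) (α 2) θ n⟫ = 0 := by
    intro n
    simp [dihedralRoot, inner_add_right, inner_smul_right, h01, h02]
  refine isWeylChamber_of_positive_system hdual
    (P := {β | β = α 0 ∨ ∃ n : ℤ, 0 ≤ n ∧ n < k ∧ β = dihedralRoot (α 1) (α 2) θ n}) ?_ ?_ ?_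
  · intro i
    fin_cases i
    · exact Or.inl rfl
    · exact Or.inr ⟨0, le_rfl, by omega, hfirst.symm⟩
    · exact Or.inr ⟨k - 1, by omega, by omega, hlast.symm⟩
  · rintro β (rfl | ⟨n, hn0, hnk, rfl⟩) i
    · fin_cases i
      · exact Or.inl rfl
      · right; left
        simp only [Fin.mk_one]
        rw [rootReflection_apply (hnorm 1), real_inner_comm, h01, mul_zero, zero_smul, sub_zero]
      · right; left
        simp only [Fin.reduceFinMk]
        rw [rootReflection_apply (hnorm 2), real_inner_comm, h02, mul_zero, zero_smul, sub_zero]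
    · fin_cases i
      · right; right
        refine ⟨n, hn0, hnk, ?_⟩
        simp only [Fin.zero_eta]
        rw [rootReflection_apply (hnorm 0), horth, mul_zero, zero_smul, sub_zero]
      · rcases hn0.eq_or_lt with rfl | hn0
        · exact Or.inl hfirst
        · right; right
          refine ⟨k - n, by omega, by omega, ?_⟩
          simp only [Fin.mk_one]
          rw [rootReflection_dihedralRoot_left (hnorm 1) h12, hperiod]
      · by_cases hn : n = k - 1
        · exact Or.inl (by rw [hn]; exact hlast)
        · right; right
          refine ⟨k - (n + 2), by omega, by omega, ?_⟩
          simp only [Fin.reduceFinMk]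
          rw [rootReflection_dihedralRoot_right (hnorm 2) h12, ← hperiod]
          ring_nf
  · rintro β (rfl | ⟨n, hn0, hnk, rfl⟩) y hy
    · exact hy 0
    · rw [dihedralRoot, inner_add_left, inner_smul_left, inner_smul_left]
      simp only [conj_trivial]
      have h1 : 0 ≤ Real.sin ((n + 1) * θ) := by
        rcases (show n + 1 ≤ k by omega).eq_or_lt with h | h
        · have : ((n : ℝ) + 1) = k := by exact_mod_cast h
          rw [this, hsk]
        · exact_mod_cast (hsin (n + 1) (by omega) h).le
      have hy1 := hy 1
      have hy2 := hy 2
      rcases hn0.eq_or_lt with rfl | hn0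
      · simp [hs1.ne', hy1]
      · have h2 := hsin n hn0 hnk
        positivity

theorem simplicial_cone_and_group_congr {α a : Fin 3 → EuclideanSpace ℝ (Fin 3)}
    (σ : Equiv.Perm (Fin 3)) (c : Fin 3 → ℝ) (hc : ∀ i, 0 < c i)
    (h : ∀ i, a i = c i • α (σ i)) :
    {y | ∀ i, 0 ≤ ⟪a i, y⟫} = {y | ∀ i, 0 ≤ ⟪α i, y⟫} ∧
    (Set.range fun i => rootReflection (a i)) = Set.range fun i => rootReflection (α i) := by
  constructor
  · ext y
    simp only [Set.mem_ofPred_eq, h, inner_smul_left, conj_trivial]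
    constructor
    · intro hy i
      have := hy (σ.symm i)
      rw [Equiv.apply_symm_apply] at this
      exact nonneg_of_mul_nonneg_right this (hc _)
    · exact fun hy i => mul_nonneg (hc i).le (hy _)
  · simp only [h, rootReflection_smul (hc _).ne']
    exact σ.surjective.range_comp fun i => rootReflection (α i)

/-! ### Products of a group of order two and a dihedral group -/

section Dihedral

variable {Γ : Type*} [Group Γ]

/-- The homomorphism from a cyclic group given by an element whose order divides that of the
group. -/
def zmodPowersHom {k : ℕ} {g : Γ} (hg : g ^ k = 1) : Multiplicative (ZMod k) →* Γ :=
  AddMonoidHom.toMultiplicativeLeft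
    (ZMod.lift k ⟨zmultiplesHom (Additive Γ) (Additive.ofMul g), by
      rw [zmultiplesHom_apply, natCast_zsmul, ← ofMul_pow, hg]
      rfl⟩)

theorem zmodPowersHom_intCast {k : ℕ} {g : Γ} (hg : g ^ k = 1) (n : ℤ) :
    zmodPowersHom hg (Multiplicative.ofAdd (n : ZMod k)) = g ^ n := by
  change Additive.toMul (ZMod.lift k _ (n : ZMod k)) = g ^ n
  rw [ZMod.lift_coe]
  rfl

/-- The homomorphism from a dihedral group given by two involutions. -/
def dihedralHom {k : ℕ} {b c : Γ} (hb : b * b = 1) (hc : c * c = 1) (hbc : (b * c) ^ k = 1) :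
    DihedralGroup k →* Γ :=
  have hinv : ∀ i : ZMod k, b * zmodPowersHom hbc (Multiplicative.ofAdd i)
      = zmodPowersHom hbc (Multiplicative.ofAdd (-i)) * b := by
    intro i
    obtain ⟨n, rfl⟩ := ZMod.intCast_surjective i
    rw [← Int.cast_neg, zmodPowersHom_intCast, zmodPowersHom_intCast, zpow_neg, ← inv_zpow]
    have h1 : (b * c)⁻¹ = b * (b * c) * b⁻¹ := by
      rw [mul_inv_rev, inv_eq_of_mul_eq_one_left hb, inv_eq_of_mul_eq_one_left hc, ← mul_assoc b b,
        hb, one_mul]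
    rw [h1, conj_zpow, inv_mul_cancel_right]
  have hadd : ∀ i j : ZMod k, zmodPowersHom hbc (Multiplicative.ofAdd (i + j))
      = zmodPowersHom hbc (Multiplicative.ofAdd i) * zmodPowersHom hbc (Multiplicative.ofAdd j) :=
    fun i j => map_mul _ _ _
  { toFun := fun
      | .r i => zmodPowersHom hbc (Multiplicative.ofAdd i)
      | .sr i => b * zmodPowersHom hbc (Multiplicative.ofAdd i)
    map_one' := map_one (zmodPowersHom hbc)
    map_mul' := by
      rintro (i | i) (j | j)
      · rw [DihedralGroup.r_mul_r]
        exact hadd i j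
      · rw [DihedralGroup.r_mul_sr]
        change b * _ = _ * (b * _)
        rw [← mul_assoc, sub_eq_neg_add, hadd, ← mul_assoc, hinv, neg_neg]
      · rw [DihedralGroup.sr_mul_r]
        change b * _ = b * _ * _
        rw [hadd, mul_assoc]
      · rw [DihedralGroup.sr_mul_sr]
        change _ = b * _ * (b * _)
        rw [hinv, mul_assoc, ← mul_assoc b b, hb, one_mul, ← hadd]
        ring_nf }

/-- The subgroup is the internal product of `⟨a⟩` and `⟨b, c⟩`, because `a` is central in it and
outside `⟨b, c⟩`. The value `k = 0` gives the infinite dihedral group. -/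
theorem nonempty_mulEquiv_zmod_two_prod_dihedralGroup {a b c : Γ} (ha : a * a = 1)
    (hb : b * b = 1) (hc : c * c = 1) (hab : a * b = b * a) (hac : a * c = c * a)
    {k : ℕ} (hk : orderOf (b * c) = k) (hb1 : b ≠ 1) (hc1 : c ≠ 1)
    (h1 : ∀ n : ℤ, a ≠ (b * c) ^ n) (h2 : ∀ n : ℤ, a ≠ b * (b * c) ^ n)
    (S : Subgroup Γ) (hS : S = Subgroup.closure {a, b, c}) :
    Nonempty (S ≃* Multiplicative (ZMod 2) × DihedralGroup k) := by
  have hbc : (b * c) ^ k = 1 := hk ▸ pow_orderOf_eq_one _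
  let D := dihedralHom hb hc hbc
  have hDr : ∀ n : ℤ, D (.r (n : ZMod k)) = (b * c) ^ n := fun n => zmodPowersHom_intCast hbc n
  have hDs : ∀ n : ℤ, D (.sr (n : ZMod k)) = b * (b * c) ^ n := fun n =>
    congrArg (b * ·) (zmodPowersHom_intCast hbc n)
  have hcomm : ∀ d, Commute a (D d) := by
    have h3 : Commute a (b * c) := (show Commute a b from hab).mul_right hac
    rintro (i | i) <;> obtain ⟨n, rfl⟩ := ZMod.intCast_surjective i
    · rw [hDr]
      exact h3.zpow_right n
    · rw [hDs]
      exact (show Commute a b from hab).mul_right (h3.zpow_right n)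
  have hrot : ∀ n : ℤ, (b * c) ^ n = 1 → (n : ZMod k) = 0 := by
    intro n hn
    rw [ZMod.intCast_zmod_eq_zero_iff_dvd, ← hk]
    exact orderOf_dvd_iff_zpow_eq_one.2 hn
  -- Otherwise `b` is a power of `b c`, so `b` and `c` commute and `(b c)² = 1`; the parity of `n`
  -- then forces `b = 1` or `c = 1`.
  have hrefl : ∀ n : ℤ, b * (b * c) ^ n ≠ 1 := by
    intro n hn
    have e1 : (b * c) ^ n = b :=
      (eq_inv_of_mul_eq_one_right hn).trans (inv_eq_of_mul_eq_one_left hb)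
    have e2 : Commute b (b * c) := by
      have : Commute ((b * c) ^ n) (b * c) := (Commute.refl (b * c)).zpow_left n
      rwa [e1] at this
    have e3 : b * c = c * b := by
      have h3 := e2.eq
      rw [← mul_assoc, hb, one_mul] at h3
      calc b * c = b * (b * c * b) := by rw [← h3]
        _ = (b * b) * c * b := by group
        _ = c * b := by rw [hb, one_mul]
    have e4 : (b * c) ^ (2 : ℤ) = 1 := by
      calc (b * c) ^ (2 : ℤ) = (b * c) * (c * b) := by
            rw [zpow_two]
            nth_rewrite 2 [e3]
            rfl
        _ = b * (c * c) * b := by group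
        _ = 1 := by rw [hc, mul_one, hb]
    obtain ⟨m, rfl | rfl⟩ := n.even_or_odd'
    · rw [zpow_mul, e4, one_zpow] at e1
      exact hb1 e1.symm
    · rw [zpow_add, zpow_mul, e4, one_zpow, one_mul, zpow_one] at e1
      exact hc1 (mul_eq_left.1 e1)
  have hinj : ∀ d, D d = 1 → d = 1 := by
    rintro (i | i) hd <;> obtain ⟨n, rfl⟩ := ZMod.intCast_surjective i
    · rw [hDr] at hd
      rw [hrot n hd]
      rfl
    · rw [hDs] at hd
      exact absurd hd (hrefl n)
  have hane : ∀ d, a ≠ D d := by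
    rintro (i | i) <;> obtain ⟨n, rfl⟩ := ZMod.intCast_surjective i
    · rw [hDr]
      exact h1 n
    · rw [hDs]
      exact h2 n
  have ha2 : a ^ 2 = 1 := by rw [sq, ha]
  let Z : Multiplicative (ZMod 2) →* Γ := zmodPowersHom ha2
  have hZ1 : Z (Multiplicative.ofAdd 1) = a := by
    have := zmodPowersHom_intCast ha2 1
    simpa using this
  have hZ : ∀ z, z = 1 ∨ (Z z = a ∧ z = Multiplicative.ofAdd 1) := by
    intro z
    have : ∀ z : Multiplicative (ZMod 2), z = 1 ∨ z = Multiplicative.ofAdd 1 := by decide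
    rcases this z with h | h
    · exact Or.inl h
    · exact Or.inr ⟨by rw [h, hZ1], h⟩
  have hcommZ : ∀ z d, Commute (Z z) (D d) := by
    intro z d
    rcases hZ z with h | ⟨h, _⟩
    · rw [h, map_one]
      exact Commute.one_left _
    · rw [h]
      exact hcomm d
  let F : Multiplicative (ZMod 2) × DihedralGroup k →* Γ := Z.noncommCoprod D hcommZ
  have hF : ∀ z d, F (z, d) = Z z * D d := fun _ _ => rfl
  have hFinj : Function.Injective F := by
    rw [injective_iff_map_eq_one]
    rintro ⟨z, d⟩ h
    rw [hF] at h
    rcases hZ z with hz | ⟨hz, _⟩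
    · rw [hz, map_one, one_mul] at h
      rw [hz, hinj d h]
      rfl
    · rw [hz] at h
      refine absurd ?_ (hane d⁻¹)
      rw [map_inv]
      exact eq_inv_of_mul_eq_one_left h
  have hrange : F.range = S := by
    rw [hS]
    refine le_antisymm ?_ ?_
    · have ham : a ∈ Subgroup.closure {a, b, c} := Subgroup.subset_closure (by simp)
      have hbm : b ∈ Subgroup.closure {a, b, c} := Subgroup.subset_closure (by simp)
      have hcm : c ∈ Subgroup.closure {a, b, c} := Subgroup.subset_closure (by simp)
      rintro _ ⟨⟨z, d⟩, rfl⟩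
      rw [hF]
      refine mul_mem ?_ ?_
      · rcases hZ z with hz | ⟨hz, _⟩
        · rw [hz, map_one]
          exact one_mem _
        · rw [hz]
          exact ham
      · rcases d with i | i <;> obtain ⟨n, rfl⟩ := ZMod.intCast_surjective i
        · rw [hDr]
          exact zpow_mem (mul_mem hbm hcm) n
        · rw [hDs]
          exact mul_mem hbm (zpow_mem (mul_mem hbm hcm) n)
    · rw [Subgroup.closure_le]
      have hbr : F (1, .sr ((0 : ℤ) : ZMod k)) = b := by
        rw [hF, map_one, one_mul, hDs, zpow_zero, mul_one]
      have hcr : F (1, .sr ((1 : ℤ) : ZMod k)) = c := by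
        rw [hF, map_one, one_mul, hDs, zpow_one, ← mul_assoc, hb, one_mul]
      rintro x (rfl | rfl | rfl)
      · exact ⟨(Multiplicative.ofAdd 1, 1), by rw [hF, hZ1, map_one, mul_one]⟩
      · exact ⟨_, hbr⟩
      · exact ⟨_, hcr⟩
  exact ⟨((MonoidHom.ofInjective hFinj).trans (MulEquiv.subgroupCongr hrange)).symm⟩

end Dihedral

end



/-! ### Orders of products of generators and entries of `Δ` -/

noncomputable section

open RealInnerProductSpace

namespace WalkModel

section Orders

variable {d : ℕ} (M : WalkModel d) (h : M.Irreducible) {x : Fin d → ℝ} (hx : M.IsCriticalPoint x)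

include hx h in
theorem exists_inner_simpleRoot_eq (c : Fin d → ℝ) : ∃ y, ∀ i, ⟪M.simpleRoot x i, y⟫ = c i :=
  ⟨M.invSqrtMap x (WithLp.toLp 2 c), fun i => M.inner_simpleRoot_invSqrtMap h hx i _⟩

theorem m_comm (i j : Fin d) : M.m h i j = M.m h j i := by
  unfold m
  rw [← orderOf_inv, mul_inv_rev, inv_eq_of_mul_eq_one_left (M.gen_mul_self h i),
    inv_eq_of_mul_eq_one_left (M.gen_mul_self h j)]

include hx in
-- Finiteness of `m_ij` is needed: a product of infinite order in `G` could still have a tangent map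
-- of finite order.
theorem orderOf_rootReflection_simpleRoot {i j : Fin d} (hm : 0 < M.m h i j) :
    orderOf (rootReflection (M.simpleRoot x i) * rootReflection (M.simpleRoot x j))
      = M.m h i j := by
  refine orderOf_eq_orderOf_iff.2 fun n => ?_
  have h1 : M.genWord h ((FreeGroup.of i * FreeGroup.of j) ^ n)
      = (M.gen h i * M.gen h j) ^ n := by simp [genWord]
  have h2 : M.reflWord x ((FreeGroup.of i * FreeGroup.of j) ^ n)
      = (rootReflection (M.simpleRoot x i) * rootReflection (M.simpleRoot x j)) ^ n := by
    simp [reflWord]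
  rw [← h1, ← h2]
  constructor
  · intro hw
    refine M.genWord_eq_one_of_reflWord_eq_one h hx hw ?_
    rw [h1]
    exact (orderOf_pos_iff.1 hm).pow
  · exact M.reflWord_eq_one_of_genWord_eq_one h hx

include hx in
-- The order shows only that `θ` is `π / m_ij` times an integer prime to `m_ij`. Hence the following
-- lemmas give polynomial equations for the entry, not its value.
theorem exists_angle_of_m_pos {i j : Fin d} (hij : i ≠ j) (hm : 0 < M.m h i j) :
    ∃ θ, 0 < Real.sin θ ∧ M.covMatrix x i j = -Real.cos θ ∧
      ∀ n : ℕ, Real.sin (n * θ) = 0 ↔ M.m h i j ∣ n := by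
  have hdual := M.exists_inner_simpleRoot_eq h hx
  obtain ⟨θ, h0, h1, hc⟩ := exists_angle hdual (M.norm_simpleRoot h hx) hij
  have hs := Real.sin_pos_of_pos_of_lt_pi h0 h1
  refine ⟨θ, hs, by rw [← M.inner_simpleRoot h hx, hc], fun n => ?_⟩
  rw [← rootReflection_mul_pow_eq_one_iff (M.norm_simpleRoot h hx i) (M.norm_simpleRoot h hx j)
    hc hs.ne' (linearCombination_pair_eq_zero hdual hij), ← orderOf_dvd_iff_pow_eq_one,
    M.orderOf_rootReflection_simpleRoot h hx hm]

include hx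

theorem covMatrix_eq_zero_of_m_eq_two {i j : Fin d} (hij : i ≠ j) (hm : M.m h i j = 2) :
    M.covMatrix x i j = 0 := by
  obtain ⟨θ, hs, hc, H⟩ := M.exists_angle_of_m_pos h hx hij (by omega)
  have h2 := (H 2).2 (by rw [hm])
  push_cast at h2
  rw [Real.sin_two_mul] at h2
  rw [hc]
  have : Real.cos θ = 0 := by simpa [hs.ne'] using h2
  simp [this]

theorem covMatrix_sq_of_m_eq_three {i j : Fin d} (hij : i ≠ j) (hm : M.m h i j = 3) :
    4 * M.covMatrix x i j ^ 2 = 1 := by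
  obtain ⟨θ, hs, hc, H⟩ := M.exists_angle_of_m_pos h hx hij (by omega)
  have h2 := (H 3).2 (by rw [hm])
  push_cast at h2
  rw [Real.sin_three_mul] at h2
  rw [hc]
  have h3 := Real.sin_sq_add_cos_sq θ
  have : Real.sin θ * (4 * Real.cos θ ^ 2 - 1) = 0 := by
    linear_combination h2 + 4 * Real.sin θ * h3
  have := (mul_eq_zero.1 this).resolve_left hs.ne'
  linear_combination this

theorem covMatrix_sq_of_m_eq_four {i j : Fin d} (hij : i ≠ j) (hm : M.m h i j = 4) :
    2 * M.covMatrix x i j ^ 2 = 1 := by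
  obtain ⟨θ, hs, hc, H⟩ := M.exists_angle_of_m_pos h hx hij (by omega)
  have h2 := (H 4).2 (by rw [hm])
  have h0 : Real.sin ((2 : ℕ) * θ) ≠ 0 := fun h0 => by
    have := (H 2).1 h0
    rw [hm] at this
    omega
  push_cast at h2 h0
  rw [show (4 : ℝ) * θ = 2 * (2 * θ) by ring, Real.sin_two_mul (2 * θ), Real.cos_two_mul] at h2
  rw [hc]
  have : 2 * Real.cos θ ^ 2 - 1 = 0 := by simpa [h0] using h2
  linear_combination this

/-- The polynomial is `sin 5θ / sin θ` written in `cos θ`. -/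
theorem covMatrix_of_m_eq_five {i j : Fin d} (hij : i ≠ j) (hm : M.m h i j = 5) :
    16 * M.covMatrix x i j ^ 4 - 12 * M.covMatrix x i j ^ 2 + 1 = 0 := by
  obtain ⟨θ, hs, hc, H⟩ := M.exists_angle_of_m_pos h hx hij (by omega)
  have h2 := (H 5).2 (by rw [hm])
  push_cast at h2
  rw [show (5 : ℝ) * θ = 3 * θ + 2 * θ by ring, Real.sin_add, Real.sin_three_mul,
    Real.cos_three_mul, Real.sin_two_mul, Real.cos_two_mul] at h2
  rw [hc]
  have h3 := Real.sin_sq_add_cos_sq θ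
  have : Real.sin θ * (16 * Real.cos θ ^ 4 - 12 * Real.cos θ ^ 2 + 1) = 0 := by
    linear_combination h2 + 4 * Real.sin θ * (2 * Real.cos θ ^ 2 - 1) * h3
  have := (mul_eq_zero.1 this).resolve_left hs.ne'
  linear_combination this

end Orders

/-! ### The isomorphism type of the group -/

section Iso

variable (M : WalkModel 3) (h : M.Irreducible) {x : Fin 3 → ℝ} (hx : M.IsCriticalPoint x)

theorem group_eq_closure_comp (σ : Equiv.Perm (Fin 3)) :
    M.group h = Subgroup.closure (Set.range fun i => M.gen h (σ i)) := by
  rw [group, ← σ.surjective.range_comp]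
  rfl

include hx in
-- The Coxeter group maps onto `G` by `f` and to the isometries by `ρ`. Relations of `G` hold in
-- `H`, so the kernel of `f` lies in that of `ρ`, which is trivial by the root table.
theorem nonempty_mulEquiv_coxeterGroup (σ : Equiv.Perm (Fin 3)) (C : CoxeterMatrix (Fin 3))
    (hC : ∀ i j, i ≠ j → M.m h (σ i) (σ j) = C i j) {c : (ℤ × ℤ) × (ℤ × ℤ)} {N : ℕ}
    (T : RootTable c N) (hT : ∃ t, T.IsReflectionLabelling C.simple t) {q y : ℝ}
    (hq : q ^ 2 = q + 1) (hy : y ≠ 0) (h01 : 4 * M.covMatrix x (σ 0) (σ 1) ^ 2 = 1)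
    (h02 : M.covMatrix x (σ 0) (σ 2) = 0)
    (hc2 : y * goldenVal q c.2 = -2 * M.covMatrix x (σ 1) (σ 2))
    (hc1 : goldenVal q c.1 = -2 * y * M.covMatrix x (σ 1) (σ 2)) :
    Nonempty (M.group h ≃* C.Group) ∧ Finite (M.group h) := by
  set α : Fin 3 → EuclideanSpace ℝ (Fin 3) := fun i => M.simpleRoot x (σ i)
  let cs := C.toCoxeterSystem
  have hf : C.IsLiftable fun i => M.gen h (σ i) := by
    intro i j
    by_cases hij : i = j
    · rw [hij, C.diagonal, pow_one, gen_mul_self]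
    · rw [← hC i j hij]
      exact pow_orderOf_eq_one _
  have hr : C.IsLiftable fun i => rootReflection (α i) := by
    intro i j
    have := M.reflWord_eq_one_of_genWord_eq_one h hx
      (w := (FreeGroup.of (σ i) * FreeGroup.of (σ j)) ^ C i j) (by simpa [genWord] using hf i j)
    simpa [reflWord] using this
  let f : C.Group →* Birational 3 := cs.lift ⟨_, hf⟩
  let ρ : C.Group →* _ := cs.lift ⟨_, hr⟩
  have hf' : ∀ i, f (C.simple i) = M.gen h (σ i) := cs.lift_apply_simple hf
  have hρ' : ∀ i, ρ (C.simple i) = rootReflection (α i) := cs.lift_apply_simple hr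
  have hin : ∀ i j, ⟪α i, α j⟫ = M.covMatrix x (σ i) (σ j) := fun i j =>
    M.inner_simpleRoot h hx _ _
  have hnorm : ∀ i, ‖α i‖ = 1 := fun i => M.norm_simpleRoot h hx _
  obtain ⟨t, ht⟩ := hT
  have hgen : Subgroup.closure (Set.range C.simple) = ⊤ := cs.subgroup_closure_range_simple
  obtain ⟨hinj, hfin⟩ := T.faithful_and_finite (ρ := ρ) (a := scaledRoots α y) hq
    (linearIndependent_scaledRoots ((M.linearIndependent_simpleRoot h hx).comp σ σ.injective)
      (by rw [hin, h01]) hy)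
    (fun i j => by
      rw [hρ']
      exact rootReflection_scaledRoots hnorm (by rw [hin, h01]) (by rw [hin, h02])
        (by rw [hin, hc2]) (by rw [hin, hc1]) i j)
    ht (fun i => cs.simple_mul_simple_self i) hgen
  have hfinj : Function.Injective f := by
    refine (injective_iff_map_eq_one f).2 fun w hw => ?_
    obtain ⟨L, rfl⟩ := Subgroup.exists_list_map_of_mem_closure_range (s := C.simple)
      (fun i => cs.simple_mul_simple_self i) (g := w) (by rw [hgen]; trivial)
    refine (injective_iff_map_eq_one ρ).1 hinj _ ?_
    have h1 := M.reflWord_eq_one_of_genWord_eq_one h hx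
      (w := (L.map fun i => FreeGroup.of (σ i)).prod)
    simp only [map_list_prod, List.map_map, genWord, reflWord, Function.comp_def,
      FreeGroup.lift_apply_of, hf', hρ'] at h1 hw ⊢
    exact h1 hw
  have hrange : f.range = M.group h := by
    rw [MonoidHom.range_eq_map, ← hgen, MonoidHom.map_closure, ← Set.range_comp,
      M.group_eq_closure_comp h σ]
    exact congrArg (fun g => Subgroup.closure (Set.range g)) (funext hf')
  let e : C.Group ≃* M.group h :=
    (MonoidHom.ofInjective hfinj).trans (MulEquiv.subgroupCongr hrange)
  exact ⟨⟨e.symm⟩, Finite.of_equiv _ e.toEquiv⟩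

variable {σ : Equiv.Perm (Fin 3)}

theorem m_eq_coxeterMatrix (C : CoxeterMatrix (Fin 3)) (h01 : M.m h (σ 0) (σ 1) = C 0 1)
    (h02 : M.m h (σ 0) (σ 2) = C 0 2) (h12 : M.m h (σ 1) (σ 2) = C 1 2) :
    ∀ i j, i ≠ j → M.m h (σ i) (σ j) = C i j := by
  intro i j hij
  fin_cases i <;> fin_cases j <;> first | exact absurd rfl hij | skip
  · exact h01
  · exact h02
  · exact (M.m_comm h _ _).trans (h01.trans (C.symmetric _ _))
  · exact h12
  · exact (M.m_comm h _ _).trans (h02.trans (C.symmetric _ _))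
  · exact (M.m_comm h _ _).trans (h12.trans (C.symmetric _ _))

theorem coxeter_pow_eq_one (C : CoxeterMatrix (Fin 3)) {i j : Fin 3} {n : ℕ} (hn : C i j = n) :
    (C.simple i * C.simple j) ^ n = 1 := by
  rw [← hn]
  exact C.toCoxeterSystem.simple_mul_simple_pow i j

include hx

theorem nonempty_mulEquiv_A (h01 : M.m h (σ 0) (σ 1) = 3) (h02 : M.m h (σ 0) (σ 2) = 2)
    (h12 : M.m h (σ 1) (σ 2) = 3) :
    Nonempty (M.group h ≃* (CoxeterMatrix.A 3).Group) ∧ Finite (M.group h) := by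
  have c01 : CoxeterMatrix.A 3 0 1 = 3 := by decide
  have c02 : CoxeterMatrix.A 3 0 2 = 2 := by decide
  have c12 : CoxeterMatrix.A 3 1 2 = 3 := by decide
  have b12 := M.covMatrix_sq_of_m_eq_three h hx (σ.injective.ne (by decide)) h12
  refine M.nonempty_mulEquiv_coxeterGroup h hx σ _
    (M.m_eq_coxeterMatrix h _ (h01.trans c01.symm) (h02.trans c02.symm) (h12.trans c12.symm))
    rootTableA (exists_isReflectionLabelling_A
      (fun i => (CoxeterMatrix.A 3).toCoxeterSystem.simple_mul_simple_self i)
      (coxeter_pow_eq_one _ c01) (coxeter_pow_eq_one _ c02) (coxeter_pow_eq_one _ c12))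
    -- The Cartan matrix has integer entries, so the choice of `q` is immaterial; `y = ±1` corrects
    -- the sign of the second edge.
    (y := -2 * M.covMatrix x (σ 1) (σ 2)) Real.goldenRatio_sq ?_
    (M.covMatrix_sq_of_m_eq_three h hx (σ.injective.ne (by decide)) h01)
    (M.covMatrix_eq_zero_of_m_eq_two h hx (σ.injective.ne (by decide)) h02) ?_ ?_
  · intro h0
    have : M.covMatrix x (σ 1) (σ 2) = 0 := by linarith
    rw [this] at b12
    norm_num at b12
  · simp [goldenVal]
  · simp only [goldenVal]
    push_cast
    linear_combination -b12

theorem nonempty_mulEquiv_B (h01 : M.m h (σ 0) (σ 1) = 3) (h02 : M.m h (σ 0) (σ 2) = 2)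
    (h12 : M.m h (σ 1) (σ 2) = 4) :
    Nonempty (M.group h ≃* (CoxeterMatrix.B 3).Group) ∧ Finite (M.group h) := by
  have c01 : CoxeterMatrix.B 3 0 1 = 3 := by decide
  have c02 : CoxeterMatrix.B 3 0 2 = 2 := by decide
  have c12 : CoxeterMatrix.B 3 1 2 = 4 := by decide
  have b12 := M.covMatrix_sq_of_m_eq_four h hx (σ.injective.ne (by decide)) h12
  refine M.nonempty_mulEquiv_coxeterGroup h hx σ _
    (M.m_eq_coxeterMatrix h _ (h01.trans c01.symm) (h02.trans c02.symm) (h12.trans c12.symm))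
    rootTableB (exists_isReflectionLabelling_B
      (fun i => (CoxeterMatrix.B 3).toCoxeterSystem.simple_mul_simple_self i)
      (coxeter_pow_eq_one _ c01) (coxeter_pow_eq_one _ c02) (coxeter_pow_eq_one _ c12))
    (y := -2 * M.covMatrix x (σ 1) (σ 2)) Real.goldenRatio_sq ?_
    (M.covMatrix_sq_of_m_eq_three h hx (σ.injective.ne (by decide)) h01)
    (M.covMatrix_eq_zero_of_m_eq_two h hx (σ.injective.ne (by decide)) h02) ?_ ?_
  · intro h0
    have : M.covMatrix x (σ 1) (σ 2) = 0 := by linarith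
    rw [this] at b12
    norm_num at b12
  · simp [goldenVal]
  · simp only [goldenVal]
    push_cast
    linear_combination -2 * b12

theorem nonempty_mulEquiv_H (h01 : M.m h (σ 0) (σ 1) = 3) (h02 : M.m h (σ 0) (σ 2) = 2)
    (h12 : M.m h (σ 1) (σ 2) = 5) :
    Nonempty (M.group h ≃* CoxeterMatrix.H₃.Group) ∧ Finite (M.group h) := by
  have c01 : CoxeterMatrix.H₃ 0 1 = 3 := by decide
  have c02 : CoxeterMatrix.H₃ 0 2 = 2 := by decide
  have c12 : CoxeterMatrix.H₃ 1 2 = 5 := by decide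
  set b := M.covMatrix x (σ 1) (σ 2) with hb
  have b12 : 16 * b ^ 4 - 12 * b ^ 2 + 1 = 0 :=
    M.covMatrix_of_m_eq_five h hx (σ.injective.ne (by decide)) h12
  -- The quartic splits, so `-2b` or `2b` is a root of `q² = q + 1`, possibly the conjugate of the
  -- golden ratio; `y` records the sign.
  have key : ∃ y : ℝ, y ^ 2 = 1 ∧ (-2 * y * b) ^ 2 = -2 * y * b + 1 := by
    have : ((-2 * b) ^ 2 - (-2 * b + 1)) * ((2 * b) ^ 2 - (2 * b + 1)) = 0 := by
      linear_combination b12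
    rcases mul_eq_zero.1 this with h1 | h1
    · exact ⟨1, by norm_num, by linear_combination h1⟩
    · exact ⟨-1, by norm_num, by linear_combination h1⟩
  obtain ⟨y, hy, hq⟩ := key
  refine M.nonempty_mulEquiv_coxeterGroup h hx σ _
    (M.m_eq_coxeterMatrix h _ (h01.trans c01.symm) (h02.trans c02.symm) (h12.trans c12.symm))
    rootTableH (exists_isReflectionLabelling_H
      (fun i => CoxeterMatrix.H₃.toCoxeterSystem.simple_mul_simple_self i)
      (coxeter_pow_eq_one _ c01) (coxeter_pow_eq_one _ c02) (coxeter_pow_eq_one _ c12))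
    (y := y) hq ?_
    (M.covMatrix_sq_of_m_eq_three h hx (σ.injective.ne (by decide)) h01)
    (M.covMatrix_eq_zero_of_m_eq_two h hx (σ.injective.ne (by decide)) h02) ?_ ?_
  · rintro rfl
    norm_num at hy
  · simp only [goldenVal]
    push_cast
    linear_combination -2 * b * hy
  · simp only [goldenVal]
    push_cast
    ring

/-- The tangent maps of the last two generators fix the first simple root, which is orthogonal to
theirs, while that of the first negates it. So the first generator is not in the group generated by
the others. -/
theorem nonempty_mulEquiv_dihedral {k : ℕ} (h01 : M.m h (σ 0) (σ 1) = 2)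
    (h02 : M.m h (σ 0) (σ 2) = 2) (h12 : M.m h (σ 1) (σ 2) = k) :
    Nonempty (M.group h ≃* Multiplicative (ZMod 2) × DihedralGroup k) := by
  have hcomm : ∀ i j, M.m h i j = 2 → M.gen h i * M.gen h j = M.gen h j * M.gen h i := by
    intro i j hm
    have h1 : (M.gen h i * M.gen h j) ^ 2 = 1 := hm ▸ pow_orderOf_eq_one _
    rw [sq] at h1
    rw [eq_inv_of_mul_eq_one_left h1, mul_inv_rev,
      inv_eq_of_mul_eq_one_left (M.gen_mul_self h i),
      inv_eq_of_mul_eq_one_left (M.gen_mul_self h j)]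
  have hne : ∀ i, M.simpleRoot x i ≠ 0 := fun i h0 => by
    have := M.norm_simpleRoot h hx i
    rw [h0] at this
    simp at this
  have hflip : ∀ i, rootReflection (M.simpleRoot x i) (M.simpleRoot x i) ≠ M.simpleRoot x i := by
    intro i hi
    rw [rootReflection_self] at hi
    have h2 : (2 : ℝ) • M.simpleRoot x i = 0 := by
      rw [two_smul]
      nth_rewrite 1 [← hi]
      exact neg_add_cancel _
    exact hne i ((smul_eq_zero.1 h2).resolve_left two_ne_zero)
  have hgen1 : ∀ i, M.gen h i ≠ 1 := by
    intro i hi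
    have := M.reflWord_eq_one_of_genWord_eq_one h hx (w := FreeGroup.of i) (by simpa [genWord])
    simp only [reflWord, FreeGroup.lift_apply_of] at this
    exact hflip i (by rw [this]; rfl)
  have hfix : ∀ i, M.covMatrix x (σ 0) i = 0 →
      M.reflWord x (FreeGroup.of i) (M.simpleRoot x (σ 0)) = M.simpleRoot x (σ 0) := by
    intro i hi
    rw [reflWord, FreeGroup.lift_apply_of, rootReflection_apply (M.norm_simpleRoot h hx i),
      real_inner_comm, M.inner_simpleRoot h hx, hi]
    simp
  have hstab : ∀ w : FreeGroup (Fin 3),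
      M.reflWord x w (M.simpleRoot x (σ 0)) = M.simpleRoot x (σ 0) →
      M.gen h (σ 0) ≠ M.genWord h w := by
    intro w hw heq
    have := M.reflWord_eq_one_of_genWord_eq_one h hx (w := FreeGroup.of (σ 0) * w⁻¹)
      (by simp [genWord, heq])
    rw [map_mul, map_inv, mul_inv_eq_one] at this
    refine hflip (σ 0) ?_
    rw [← this] at hw
    simpa [reflWord] using hw
  let S : Subgroup (EuclideanSpace ℝ (Fin 3) ≃ₗᵢ[ℝ] EuclideanSpace ℝ (Fin 3)) :=
    { carrier := {g | g (M.simpleRoot x (σ 0)) = M.simpleRoot x (σ 0)}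
      mul_mem' := fun {f g} hf hg => (congrArg f hg).trans hf
      one_mem' := rfl
      inv_mem' := fun {g} hg => (LinearIsometryEquiv.symm_apply_eq g).2 hg.symm }
  have hS1 : M.reflWord x (FreeGroup.of (σ 1)) ∈ S :=
    hfix _ (M.covMatrix_eq_zero_of_m_eq_two h hx (σ.injective.ne (by decide)) h01)
  have hS2 : M.reflWord x (FreeGroup.of (σ 2)) ∈ S :=
    hfix _ (M.covMatrix_eq_zero_of_m_eq_two h hx (σ.injective.ne (by decide)) h02)
  have hSn : ∀ n : ℤ, M.reflWord x ((FreeGroup.of (σ 1) * FreeGroup.of (σ 2)) ^ n) ∈ S := by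
    intro n
    rw [map_zpow, map_mul]
    exact zpow_mem (mul_mem hS1 hS2) n
  refine nonempty_mulEquiv_zmod_two_prod_dihedralGroup (M.gen_mul_self h (σ 0))
    (M.gen_mul_self h (σ 1)) (M.gen_mul_self h (σ 2)) (hcomm _ _ h01) (hcomm _ _ h02) h12
    (hgen1 _) (hgen1 _) ?_ ?_ _ ?_
  · intro n
    have := hstab _ (hSn n)
    simpa [genWord] using this
  · intro n
    have := hstab (FreeGroup.of (σ 1) * (FreeGroup.of (σ 1) * FreeGroup.of (σ 2)) ^ n)
      (show _ ∈ S by rw [map_mul]; exact mul_mem hS1 (hSn n))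
    simpa [genWord] using this
  · rw [M.group_eq_closure_comp h σ]
    congr 1
    ext g
    simp [Fin.exists_fin_succ, eq_comm]

end Iso

end WalkModel

end



noncomputable section

open RealInnerProductSpace

/-! ### Finite triples of orders -/

theorem cos_pi_div_le_cos_pi_div {m n : ℕ} (hm : 1 ≤ m) (hmn : m ≤ n) :
    Real.cos (Real.pi / m) ≤ Real.cos (Real.pi / n) := by
  have hm' : (1 : ℝ) ≤ m := by exact_mod_cast hm
  have hmn' : (m : ℝ) ≤ n := by exact_mod_cast hmn
  have hpi := Real.pi_pos
  refine Real.cos_le_cos_of_nonneg_of_le_pi (by positivity) (div_le_self hpi.le hm') ?_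
  gcongr

theorem half_le_cos_pi_div {m : ℕ} (hm : 3 ≤ m) : 1 / 2 ≤ Real.cos (Real.pi / m) := by
  have := cos_pi_div_le_cos_pi_div (by norm_num) hm
  push_cast at this
  rwa [Real.cos_pi_div_three] at this

theorem half_le_cos_sq_pi_div {m : ℕ} (hm : 4 ≤ m) : 1 / 2 ≤ Real.cos (Real.pi / m) ^ 2 := by
  have := cos_pi_div_le_cos_pi_div (by norm_num) hm
  push_cast at this
  rw [Real.cos_pi_div_four] at this
  have h2 := Real.sq_sqrt (show (0 : ℝ) ≤ 2 by norm_num)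
  nlinarith [Real.sqrt_nonneg 2]

theorem three_quarters_le_cos_sq_pi_div {m : ℕ} (hm : 6 ≤ m) :
    3 / 4 ≤ Real.cos (Real.pi / m) ^ 2 := by
  have := cos_pi_div_le_cos_pi_div (by norm_num) hm
  push_cast at this
  rw [Real.cos_pi_div_six] at this
  have h2 := Real.sq_sqrt (show (0 : ℝ) ≤ 3 by norm_num)
  nlinarith [Real.sqrt_nonneg 3]

/-- If all orders are at least 3, the cosines are at least `1/2`, and `3/4 + 1/4` already exhausts
the determinant. -/
theorem exists_eq_two_of_det_pos {a b c : ℕ} (ha : 2 ≤ a) (hb : 2 ≤ b) (hc : 2 ≤ c)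
    (hdet : 0 < 1 - Real.cos (Real.pi / a) ^ 2 - Real.cos (Real.pi / b) ^ 2
      - Real.cos (Real.pi / c) ^ 2
      - 2 * Real.cos (Real.pi / a) * Real.cos (Real.pi / b) * Real.cos (Real.pi / c)) :
    a = 2 ∨ b = 2 ∨ c = 2 := by
  by_contra! hne
  have h1 := half_le_cos_pi_div (m := a) (by omega)
  have h2 := half_le_cos_pi_div (m := b) (by omega)
  have h3 := half_le_cos_pi_div (m := c) (by omega)
  have h4 : 1 / 2 * (1 / 2) ≤ Real.cos (Real.pi / a) * Real.cos (Real.pi / b) :=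
    mul_le_mul h1 h2 (by norm_num) (by linarith)
  have h5 : 1 / 2 * (1 / 2) * (1 / 2)
      ≤ Real.cos (Real.pi / a) * Real.cos (Real.pi / b) * Real.cos (Real.pi / c) :=
    mul_le_mul h4 h3 (by norm_num) (by linarith)
  nlinarith

theorem classification_of_cos_sq_add_lt_one {a c : ℕ} (ha : 3 ≤ a) (hc : 3 ≤ c)
    (hdet : Real.cos (Real.pi / a) ^ 2 + Real.cos (Real.pi / c) ^ 2 < 1) :
    (a = 3 ∧ (c = 3 ∨ c = 4 ∨ c = 5)) ∨ (c = 3 ∧ (a = 3 ∨ a = 4 ∨ a = 5)) := by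
  have h1 := half_le_cos_pi_div ha
  have h2 := half_le_cos_pi_div hc
  by_cases h3 : a = 3
  · have : c < 6 := by
      by_contra! h6
      have := three_quarters_le_cos_sq_pi_div h6
      nlinarith
    omega
  · have h4 := half_le_cos_sq_pi_div (m := a) (by omega)
    have : c < 4 := by
      by_contra! h6
      have := half_le_cos_sq_pi_div h6
      linarith
    have : a < 6 := by
      by_contra! h6
      have := three_quarters_le_cos_sq_pi_div h6
      nlinarith
    omega

theorem isOfFinOrder_of_mem_finite {Γ : Type*} [Group Γ] {S : Subgroup Γ} [Finite S] {g : Γ}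
    (hg : g ∈ S) : IsOfFinOrder g :=
  S.subtype.isOfFinOrder (isOfFinOrder_of_finite (⟨g, hg⟩ : S))

/-! ### From the angle condition to the Weyl chamber -/

namespace WalkModel

section Weyl

variable {M : WalkModel 3} {h : M.Irreducible} {x : Fin 3 → ℝ} (hx : M.IsCriticalPoint x)
include hx

theorem isWeylChamber_of_scaled {σ : Equiv.Perm (Fin 3)} {a : Fin 3 → EuclideanSpace ℝ (Fin 3)}
    {c : Fin 3 → ℝ} (h : M.Irreducible) (hc : ∀ i, 0 < c i)
    (ha : ∀ i, a i = c i • M.simpleRoot x (σ i))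
    (hW : (∀ c : Fin 3 → ℝ, ∃ y, ∀ i, ⟪a i, y⟫ = c i) →
      IsWeylChamber (Subgroup.closure (Set.range fun i => rootReflection (a i)))
        {y | ∀ i, 0 ≤ ⟪a i, y⟫}) :
    IsWeylChamber (M.reflectionGroup x) (M.cone x) := by
  obtain ⟨h1, h2⟩ := simplicial_cone_and_group_congr σ c hc ha
  rw [h1, h2, ← M.cone_eq h hx, ← M.reflectionGroup_eq h hx] at hW
  refine hW fun v => ?_
  obtain ⟨y, hy⟩ := M.exists_inner_simpleRoot_eq h hx fun i => v (σ.symm i) / c (σ.symm i)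
  refine ⟨y, fun i => ?_⟩
  rw [ha, inner_smul_left, hy, Equiv.symm_apply_apply]
  exact mul_div_cancel₀ _ (hc i).ne'

/-- Unlike for the isomorphism type, the signs matter here: the scaling factors must be positive for
the rescaled roots to cut out the same cone. -/
theorem isWeylChamber_of_rootTable (h : M.Irreducible) (σ : Equiv.Perm (Fin 3))
    {c : (ℤ × ℤ) × (ℤ × ℤ)} {N : ℕ} (T : RootTable c N) {q y : ℝ} (hq : q ^ 2 = q + 1)
    (hq0 : 0 < q) (hy : 0 < y) (h01 : M.covMatrix x (σ 0) (σ 1) = -(1 / 2))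
    (h02 : M.covMatrix x (σ 0) (σ 2) = 0)
    (hc2 : y * goldenVal q c.2 = -2 * M.covMatrix x (σ 1) (σ 2))
    (hc1 : goldenVal q c.1 = -2 * y * M.covMatrix x (σ 1) (σ 2)) :
    IsWeylChamber (M.reflectionGroup x) (M.cone x) := by
  set α : Fin 3 → EuclideanSpace ℝ (Fin 3) := fun i => M.simpleRoot x (σ i)
  have hin : ∀ i j, ⟪α i, α j⟫ = M.covMatrix x (σ i) (σ j) := fun i j =>
    M.inner_simpleRoot h hx _ _
  have hpos : ∀ i, 0 < (![-2 * ⟪α 0, α 1⟫, 1, y] : Fin 3 → ℝ) i := by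
    intro i
    fin_cases i
    · simp [hin, h01]
    · simp
    · simpa using hy
  refine isWeylChamber_of_scaled hx h hpos (fun i => scaledRoots_eq (α := α) (x := y) i)
    fun hdual => T.isWeylChamber hq hq0 hdual fun i j => ?_
  rw [scaledRoots_eq i, rootReflection_smul (hpos i).ne', ← scaledRoots_eq i]
  exact rootReflection_scaledRoots (fun i => M.norm_simpleRoot h hx _)
    (by rw [hin, h01]; norm_num) (by rw [hin, h02]) (by rw [hin, hc2]) (by rw [hin, hc1]) i j

variable {σ : Equiv.Perm (Fin 3)}
  (hcos : ∀ i j, i ≠ j → M.covMatrix x i j = -Real.cos (Real.pi / M.m h i j))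
include hcos

omit hx in
theorem covMatrix_perm_eq {i j : Fin 3} (hij : i ≠ j) {n : ℕ} (hm : M.m h (σ i) (σ j) = n) :
    M.covMatrix x (σ i) (σ j) = -Real.cos (Real.pi / n) := by
  rw [hcos _ _ (σ.injective.ne hij), hm]

theorem isWeylChamber_A (h01 : M.m h (σ 0) (σ 1) = 3) (h02 : M.m h (σ 0) (σ 2) = 2)
    (h12 : M.m h (σ 1) (σ 2) = 3) : IsWeylChamber (M.reflectionGroup x) (M.cone x) := by
  have e01 := covMatrix_perm_eq hcos (by decide) h01
  have e02 := covMatrix_perm_eq hcos (by decide) h02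
  have e12 := covMatrix_perm_eq hcos (by decide) h12
  push_cast at e01 e02 e12
  rw [Real.cos_pi_div_three] at e01 e12
  rw [Real.cos_pi_div_two, neg_zero] at e02
  refine isWeylChamber_of_rootTable hx h σ rootTableA (y := 1) Real.goldenRatio_sq
    Real.goldenRatio_pos one_pos e01 e02 ?_ ?_ <;>
  · rw [e12]
    simp [goldenVal]

theorem isWeylChamber_B (h01 : M.m h (σ 0) (σ 1) = 3) (h02 : M.m h (σ 0) (σ 2) = 2)
    (h12 : M.m h (σ 1) (σ 2) = 4) : IsWeylChamber (M.reflectionGroup x) (M.cone x) := by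
  have e01 := covMatrix_perm_eq hcos (by decide) h01
  have e02 := covMatrix_perm_eq hcos (by decide) h02
  have e12 := covMatrix_perm_eq hcos (by decide) h12
  push_cast at e01 e02 e12
  rw [Real.cos_pi_div_three] at e01
  rw [Real.cos_pi_div_two, neg_zero] at e02
  rw [Real.cos_pi_div_four] at e12
  have h2 := Real.sq_sqrt (show (0 : ℝ) ≤ 2 by norm_num)
  refine isWeylChamber_of_rootTable hx h σ rootTableB (y := √2) Real.goldenRatio_sq
    Real.goldenRatio_pos (by positivity) e01 e02 ?_ ?_
  · rw [e12]
    simp only [goldenVal]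
    push_cast
    ring
  · rw [e12]
    simp only [goldenVal]
    push_cast
    linear_combination -h2

theorem isWeylChamber_H (h01 : M.m h (σ 0) (σ 1) = 3) (h02 : M.m h (σ 0) (σ 2) = 2)
    (h12 : M.m h (σ 1) (σ 2) = 5) : IsWeylChamber (M.reflectionGroup x) (M.cone x) := by
  have e01 := covMatrix_perm_eq hcos (by decide) h01
  have e02 := covMatrix_perm_eq hcos (by decide) h02
  have e12 := covMatrix_perm_eq hcos (by decide) h12
  push_cast at e01 e02 e12
  rw [Real.cos_pi_div_three] at e01
  rw [Real.cos_pi_div_two, neg_zero] at e02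
  rw [Real.cos_pi_div_five] at e12
  refine isWeylChamber_of_rootTable hx h σ rootTableH (y := 1) Real.goldenRatio_sq
    Real.goldenRatio_pos one_pos e01 e02 ?_ ?_ <;>
  · rw [e12]
    simp only [goldenVal, Real.goldenRatio]
    push_cast
    ring

theorem isWeylChamber_dihedral {k : ℕ} (hk : 1 ≤ k) (h01 : M.m h (σ 0) (σ 1) = 2)
    (h02 : M.m h (σ 0) (σ 2) = 2) (h12 : M.m h (σ 1) (σ 2) = k) :
    IsWeylChamber (M.reflectionGroup x) (M.cone x) := by
  have e01 := covMatrix_perm_eq hcos (by decide) h01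
  have e02 := covMatrix_perm_eq hcos (by decide) h02
  have e12 := covMatrix_perm_eq hcos (by decide) h12
  push_cast at e01 e02
  rw [Real.cos_pi_div_two, neg_zero] at e01 e02
  -- The case `k = 1` never occurs, because the two tangent reflections are distinct.
  have hk1 : k ≠ 1 := by
    rintro rfl
    obtain ⟨θ, hs, -, H⟩ := M.exists_angle_of_m_pos h hx (i := σ 1) (j := σ 2)
      (σ.injective.ne (by decide)) (by omega)
    have := (H 1).2 (by rw [h12])
    rw [Nat.cast_one, one_mul] at this
    exact hs.ne' this
  refine isWeylChamber_of_scaled (c := 1) (a := fun i => M.simpleRoot x (σ i)) hx h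
    (fun _ => one_pos) (fun i => (one_smul _ _).symm) fun hdual => ?_
  exact isWeylChamber_of_orthogonal_root hdual (fun i => M.norm_simpleRoot h hx _)
    (k := k) (by omega) (by rw [M.inner_simpleRoot h hx, e01])
    (by rw [M.inner_simpleRoot h hx, e02]) (by rw [M.inner_simpleRoot h hx, e12])

end Weyl

/-! ### Orders forced by finiteness and the Weyl property -/

section Classification

variable {M : WalkModel 3} {h : M.Irreducible} {x : Fin 3 → ℝ} (hx : M.IsCriticalPoint x)
include hx

/-- The chamber gives an angle `π / k`, so the product of the two reflections has order `k`;
finiteness of `G` makes `m_ij` positive and hence equal to `k`. -/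
theorem FiniteWithWeylProperty.covMatrix_eq (hG : M.FiniteWithWeylProperty h x) {i j : Fin 3}
    (hij : i ≠ j) : 2 ≤ M.m h i j ∧ M.covMatrix x i j = -Real.cos (Real.pi / M.m h i j) := by
  obtain ⟨hfin, hW⟩ := hG
  have hdual := M.exists_inner_simpleRoot_eq h hx
  have hnorm := M.norm_simpleRoot h hx
  rw [M.cone_eq h hx, M.reflectionGroup_eq h hx] at hW
  obtain ⟨k, hk, hc⟩ := angle_of_isWeylChamber hdual hnorm hW hij
  have hmem : ∀ i, M.gen h i ∈ M.group h := fun i => Subgroup.subset_closure ⟨i, rfl⟩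
  have hm : 0 < M.m h i j :=
    orderOf_pos_iff.2 (isOfFinOrder_of_mem_finite (mul_mem (hmem i) (hmem j)))
  have := orderOf_rootReflection_mul (hnorm i) (hnorm j) hc hk rfl
    (linearCombination_pair_eq_zero hdual hij)
  rw [M.orderOf_rootReflection_simpleRoot h hx hm] at this
  rw [← M.inner_simpleRoot h hx, this]
  exact ⟨hk, hc⟩

theorem FiniteWithWeylProperty.det_pos (hG : M.FiniteWithWeylProperty h x)
    (σ : Equiv.Perm (Fin 3)) :
    0 < 1 - Real.cos (Real.pi / M.m h (σ 0) (σ 1)) ^ 2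
      - Real.cos (Real.pi / M.m h (σ 0) (σ 2)) ^ 2 - Real.cos (Real.pi / M.m h (σ 1) (σ 2)) ^ 2
      - 2 * Real.cos (Real.pi / M.m h (σ 0) (σ 1)) * Real.cos (Real.pi / M.m h (σ 0) (σ 2))
        * Real.cos (Real.pi / M.m h (σ 1) (σ 2)) := by
  have h1 := (M.covMatrix_posDef h hx).det_pos
  rw [← Matrix.det_submatrix_equiv_self σ, Matrix.det_fin_three] at h1
  simp only [Matrix.submatrix_apply] at h1
  have e : ∀ i j : Fin 3, i ≠ j →
      M.covMatrix x (σ i) (σ j) = -Real.cos (Real.pi / M.m h (σ i) (σ j)) :=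
    fun i j hij => (hG.covMatrix_eq hx (σ.injective.ne hij)).2
  rw [M.covMatrix_self h hx, M.covMatrix_self h hx, M.covMatrix_self h hx,
    e 0 1 (by decide), e 0 2 (by decide), e 1 2 (by decide), e 1 0 (by decide),
    e 2 0 (by decide), e 2 1 (by decide), M.m_comm h (σ 1) (σ 0), M.m_comm h (σ 2) (σ 0),
    M.m_comm h (σ 2) (σ 1)] at h1
  linarith

theorem FiniteWithWeylProperty.orders (hG : M.FiniteWithWeylProperty h x) :
    (∃ k : ℕ, 1 ≤ k ∧ M.OrdersUpToPerm h (2, 2, k)) ∨ M.OrdersUpToPerm h (3, 2, 3) ∨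
      M.OrdersUpToPerm h (3, 2, 4) ∨ M.OrdersUpToPerm h (3, 2, 5) := by
  have hm : ∀ (σ : Equiv.Perm (Fin 3)) (i j : Fin 3), i ≠ j → 2 ≤ M.m h (σ i) (σ j) :=
    fun σ i j hij => (hG.covMatrix_eq hx (σ.injective.ne hij)).1
  -- Some order is 2; the permutation puts that pair at the two ends of a linear diagram.
  have hσ : ∃ σ : Equiv.Perm (Fin 3), M.m h (σ 0) (σ 2) = 2 := by
    rcases exists_eq_two_of_det_pos (hm 1 0 1 (by decide)) (hm 1 0 2 (by decide))
      (hm 1 1 2 (by decide)) (hG.det_pos hx 1) with h1 | h1 | h1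
    · exact ⟨Equiv.swap 1 2, h1⟩
    · exact ⟨1, h1⟩
    · exact ⟨Equiv.swap 0 1, h1⟩
  obtain ⟨σ, hσ⟩ := hσ
  have h01 := hm σ 0 1 (by decide)
  have h12 := hm σ 1 2 (by decide)
  have hrev : ∀ p q : ℕ, M.m h (σ 0) (σ 1) = q → M.m h (σ 1) (σ 2) = p →
      M.OrdersUpToPerm h (p, 2, q) := by
    rintro p q rfl rfl
    refine ⟨(Equiv.swap 0 2).trans σ, ?_⟩
    have e0 : Equiv.swap (0 : Fin 3) 2 0 = 2 := by decide
    have e1 : Equiv.swap (0 : Fin 3) 2 1 = 1 := by decide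
    have e2 : Equiv.swap (0 : Fin 3) 2 2 = 0 := by decide
    simp only [Equiv.trans_apply, e0, e1, e2]
    rw [M.m_comm h (σ 2) (σ 1), M.m_comm h (σ 2) (σ 0), M.m_comm h (σ 1) (σ 0), hσ]
  have hfwd : ∀ p q : ℕ, M.m h (σ 0) (σ 1) = p → M.m h (σ 1) (σ 2) = q →
      M.OrdersUpToPerm h (p, 2, q) := by
    rintro p q rfl rfl
    exact ⟨σ, by rw [hσ]⟩
  by_cases h2 : M.m h (σ 0) (σ 1) = 2
  · exact Or.inl ⟨_, by omega, hfwd _ _ h2 rfl⟩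
  by_cases h3 : M.m h (σ 1) (σ 2) = 2
  · exact Or.inl ⟨_, by omega, hrev _ _ rfl h3⟩
  right
  have hdet := hG.det_pos hx σ
  rw [hσ, Nat.cast_two, Real.cos_pi_div_two] at hdet
  rcases classification_of_cos_sq_add_lt_one (a := M.m h (σ 0) (σ 1)) (c := M.m h (σ 1) (σ 2))
    (by omega) (by omega) (by linarith) with ⟨ha, hc | hc | hc⟩ | ⟨ha, hc | hc | hc⟩
  · exact Or.inl (hfwd _ _ ha hc)
  · exact Or.inr (Or.inl (hfwd _ _ ha hc))
  · exact Or.inr (Or.inr (hfwd _ _ ha hc))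
  · exact Or.inl (hrev _ _ hc ha)
  · exact Or.inr (Or.inl (hrev _ _ hc ha))
  · exact Or.inr (Or.inr (hrev _ _ hc ha))

end Classification

end WalkModel

end


/-! ### The main theorem -/

theorem mainTheorem4 (M : WalkModel 3) (h : M.Irreducible) :
    -- the critical point exists and is unique
    (∃! x₀, M.IsCriticalPoint x₀) ∧
    -- the characterization
    (∀ x₀, M.IsCriticalPoint x₀ →
      (M.FiniteWithWeylProperty h x₀ ↔
        ((∃ k : ℕ, 1 ≤ k ∧ M.OrdersUpToPerm h (2, 2, k)) ∨ M.OrdersUpToPerm h (3, 2, 3) ∨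
          M.OrdersUpToPerm h (3, 2, 4) ∨ M.OrdersUpToPerm h (3, 2, 5)) ∧
        ∀ i j, i ≠ j → M.covMatrix x₀ i j = -Real.cos (Real.pi / M.m h i j))) ∧
    -- the isomorphism type of the group in each case
    (∀ k : ℕ, 1 ≤ k → M.OrdersUpToPerm h (2, 2, k) →
      Nonempty (M.group h ≃* Multiplicative (ZMod 2) × DihedralGroup k)) ∧
    (M.OrdersUpToPerm h (3, 2, 3) → Nonempty (M.group h ≃* (CoxeterMatrix.A 3).Group)) ∧
    (M.OrdersUpToPerm h (3, 2, 4) → Nonempty (M.group h ≃* (CoxeterMatrix.B 3).Group)) ∧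
    (M.OrdersUpToPerm h (3, 2, 5) → Nonempty (M.group h ≃* CoxeterMatrix.H₃.Group)) := by
  obtain ⟨x₁, hx₁, huniq⟩ := h.existsUnique_isCriticalPoint
  refine ⟨⟨x₁, hx₁, huniq⟩, fun x₀ hx => ⟨fun hG => ⟨hG.orders hx, fun i j hij =>
    (hG.covMatrix_eq hx hij).2⟩, ?_⟩, ?_, ?_, ?_, ?_⟩
  · rintro ⟨⟨k, hk, σ, hσ⟩ | ⟨σ, hσ⟩ | ⟨σ, hσ⟩ | ⟨σ, hσ⟩, hcos⟩ <;>
      simp only [Prod.mk.injEq] at hσ <;> obtain ⟨h01, h02, h12⟩ := hσ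
    · obtain ⟨e⟩ := M.nonempty_mulEquiv_dihedral h hx h01 h02 h12
      -- `DihedralGroup 0` is infinite, so finiteness of `G` uses `1 ≤ k`.
      have : NeZero k := ⟨by omega⟩
      exact ⟨Finite.of_equiv _ e.symm.toEquiv,
        WalkModel.isWeylChamber_dihedral hx hcos hk h01 h02 h12⟩
    · exact ⟨(M.nonempty_mulEquiv_A h hx h01 h02 h12).2,
        WalkModel.isWeylChamber_A hx hcos h01 h02 h12⟩
    · exact ⟨(M.nonempty_mulEquiv_B h hx h01 h02 h12).2,
        WalkModel.isWeylChamber_B hx hcos h01 h02 h12⟩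
    · exact ⟨(M.nonempty_mulEquiv_H h hx h01 h02 h12).2,
        WalkModel.isWeylChamber_H hx hcos h01 h02 h12⟩
  -- The isomorphism types use the orders and the existence of a critical point, but not the cosine
  -- condition.
  · rintro k - ⟨σ, hσ⟩
    simp only [Prod.mk.injEq] at hσ
    exact M.nonempty_mulEquiv_dihedral h hx₁ hσ.1 hσ.2.1 hσ.2.2
  all_goals
    rintro ⟨σ, hσ⟩
    simp only [Prod.mk.injEq] at hσ
  · exact (M.nonempty_mulEquiv_A h hx₁ hσ.1 hσ.2.1 hσ.2.2).1
  · exact (M.nonempty_mulEquiv_B h hx₁ hσ.1 hσ.2.1 hσ.2.2).1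
  · exact (M.nonempty_mulEquiv_H h hx₁ hσ.1 hσ.2.1 hσ.2.2).1
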